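/- Let $L$ be a lattice (for instance $\mathbb{Z}^d$; only its set of sites matters) and $I=\{+,z,-\}$, with conjugation $\overline{+}=-$, $\overline{z}=z$, $\overline{-}=+$. For finitely supported multi-indices $\alpha\in\mathbb{N}^{I\times L}$ write $|\alpha|=\sum_{x,i}\alpha_i(x)$, $|\alpha(x)|=\sum_i\alpha_i(x)$, $\overline{\alpha}_i(x)=\alpha_{\bar i}(x)$. Let $V(t,\alpha)\in\mathbb{C}$ ($t\in\mathbb{R}$) be an interaction potential such that $t\mapsto V(t,\alpha)$ is continuous for each $\alpha$, $\overline{V(t,\alpha)}=V(t,\overline{\alpha})$, and $$\|V\|:=\sum_{n\in\mathbb{N}}\ \sup_{x\in L,\,t\in\mathbb{R}}\ \sum_{|\alpha|=n}|\alpha(x)|\,|V(t,\alpha)|\,e^n<\infty$$ (time-independent potentials are a special case). *Classical system.* For finite $\Lambda\subset L$ let $\Xi_\Lambda=\prod_{x\in\Lambda}\overline{B_1(0)}$ with $\overline{B_1(0)}\subset\mathbb{R}^3$, with coordinates $M_\pm(x)=(M_1(x)\pm iM_2(x))/\sqrt2$, $M_z(x)=M_3(x)$; let $\mathfrak{P}_\Lambda=\mathbb{C}[\{M_i(x):i\in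 I,x\in\Lambda\}]$, and $\|A\|_\infty=\sup_{M\in\Xi_\Lambda}|A(M)|$. For $\Lambda_0\subset\Lambda$ regard $\mathfrak{P}_{\Lambda_0}\subset\mathfrak{P}_\Lambda$. Let $\tilde\epsilon_{\pm\mp z}=\pm1$, $\tilde\epsilon_{\pm z\pm}=\mp1$, $\tilde\epsilon_{z\pm\pm}=\pm1$, and $\tilde\epsilon_{ijk}=0$ otherwise. The Hamilton function $H_\Lambda(t)=\sum_{\alpha\in\mathbb{N}^{I\times\Lambda}}V(t,\alpha)M^\alpha$ and the Poisson bracket $\{M_i(x),M_j(y)\}=i\,\tilde\epsilon_{ijk}\,\delta(x,y)M_k(x)$ give the equations of motion $$\frac{d}{dt}M_i(t,x)=\sum_{\alpha\in\mathbb{N}^{I\times\Lambda}}V(t,\alpha)\sum_{j,k\in I}i\,\tilde\epsilon_{jik}\,\alpha_j(x)\,M^{\alpha-\delta_j(x)+\delta_k(x)}(t).$$ Let $\phi^t_\Lambda$ be the map $M(0)\mapsto M(t)$ on $\Xi_\Lambda$ and $\alpha^t_\Lambda A=A\circ\phi^t_\Lambda$. *Quantum system.* For $s\in\{\tfrac12,1,\tfrac32,\dots\}$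 let $\mathscr{H}_\Lambda=\bigotimes_{x\in\Lambda}\mathbb{C}^{2s+1}$, let $\hat S_k(x)$, $k=1,2,3$, be the generators of the spin-$s$ representation of $su(2)$ at site $x$ divided by $s$, and $\hat S_\pm(x)=(\hat S_1(x)\pm i\hat S_2(x))/\sqrt2$, $\hat S_z(x)=\hat S_3(x)$. The quantization $A\mapsto\hat A$ is the linear map that sends $M_{i_1}(x_1)\cdots M_{i_p}(x_p)$ to the product of $\hat S_{i_1}(x_1),\dots,\hat S_{i_p}(x_p)$ in normal order (all $+$ to the left of all $z$, all $z$ to the left of all $-$). Let $\hat H_\Lambda(t)=\sum_{\alpha\in\mathbb{N}^{I\times\Lambda}}V(t,\alpha)\,\widehat{M^\alpha}$, let $U_s(t)$ solve $\frac{d}{dt}U_s(t)=-is\hat H_\Lambda(t)U_s(t)$, $U_s(0)=1$ (so $U_s(t)=e^{-ist\hat H_\Lambda}$ if $V$ is time-independent), and $\hat\alpha^t_\Lambda\mathcal{A}=U_s(t)^*\mathcal{A}\,U_s(t)$. **Theorem.** The dynamics are well defined: for every finite $\Lambda\subset L$ and every $M_0\in\Xi_\Lambda$ the equations of motion have exactly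 one solution $M:\mathbb{R}\to\Xi_\Lambda$ with $M(0)=M_0$, and for every $s$ the propagator $U_s$ exists and is unique. Moreover, let $\Lambda_0\subset L$ be finite, $A\in\mathfrak{P}_{\Lambda_0}$ and $\epsilon>0$. Then there are constants $C(\epsilon,t,A)$, $t\in\mathbb{R}$ (which may depend on $V$, but not on $\Lambda$ or $s$), such that for every finite $\Lambda\subset L$ with $\Lambda_0\subset\Lambda$ there is a family $A(t)\in\mathfrak{P}_\Lambda$, $t\in\mathbb{R}$, independent of $s$, with $$\sup_{t\in\mathbb{R}}\|\alpha^t_\Lambda A-A(t)\|_\infty\le\epsilon$$ and, for all $t\in\mathbb{R}$ and all $s\in\{\tfrac12,1,\tfrac32,\dots\}$, $$\big\|\hat\alpha^t_\Lambda\hat A-\widehat{A(t)}\big\|\le\epsilon+\frac{C(\epsilon,t,A)}{s}.$$ -/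

import Mathlib

namespace SpinEgorov

noncomputable section

/-- The index set `I = {+, z, -}`. -/
inductive Idx : Type
  | plus
  | z
  | minus
  deriving DecidableEq

instance : Fintype Idx where
  elems := {Idx.plus, Idx.z, Idx.minus}
  complete := by
    intro i
    cases i <;> simp

/-- The conjugation `(+, z, -) ↦ (-, z, +)`. -/
def Idx.bar : Idx → Idx
  | Idx.plus => Idx.minus
  | Idx.z => Idx.z
  | Idx.minus => Idx.plus

/-- The structure constants `ε̃_{ijk}`. -/
def eps : Idx → Idx → Idx → ℤ
  | Idx.plus, Idx.minus, Idx.z => 1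
  | Idx.minus, Idx.plus, Idx.z => -1
  | Idx.plus, Idx.z, Idx.plus => -1
  | Idx.minus, Idx.z, Idx.minus => 1
  | Idx.z, Idx.plus, Idx.plus => 1
  | Idx.z, Idx.minus, Idx.minus => -1
  | _, _, _ => 0

/-- Finite multi-indices `α ∈ ℕ^{I × X}`, `|α| < ∞`, over a set `X` of sites. -/
abbrev MultiIndex (X : Type*) := (Idx × X) →₀ ℕ

/-- `|α(x)| = ∑_i α_i(x)`. -/
def siteDegree {X : Type*} (α : MultiIndex X) (x : X) : ℕ := ∑ i : Idx, α (i, x)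

/-- The conjugate multi-index, `ᾱ_i(x) = α_{ī}(x)`. -/
def conjIndex {X : Type*} (α : MultiIndex X) : MultiIndex X :=
  α.mapDomain (Prod.map Idx.bar id)

/-- The embedding `ℕ^{I × Λ} ⊂ ℕ^{I × L}` by adjoining zeroes. -/
def extendIndex {L : Type*} (Λ : Finset L) (α : MultiIndex Λ) : MultiIndex L :=
  α.mapDomain (Prod.map id Subtype.val)

/-- `∑_n sup_{x, t} ∑_{|α| = n} |α(x)| |V(t, α)| e^n`, as an extended nonnegative number. -/
def potentialNorm {L : Type*} (V : ℝ → MultiIndex L → ℂ) : ENNReal :=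
  ∑' n : ℕ, ⨆ (x : L) (t : ℝ), ∑' α : {α : MultiIndex L // α.degree = n},
    (siteDegree α.1 x : ENNReal) * ‖V t α.1‖ₑ * ENNReal.ofReal (Real.exp n)

/-! ### Classical spins -/

/-- Classical spin configurations `x ↦ M(x) ∈ ℝ³` on `Λ`. -/
abbrev Config {L : Type*} (Λ : Finset L) := Λ → EuclideanSpace ℝ (Fin 3)

/-- The phase space `Ξ_Λ`, the product of closed unit balls of `ℝ³`. -/
def phaseSpace {L : Type*} (Λ : Finset L) : Set (Config Λ) := {M | ∀ x, ‖M x‖ ≤ 1}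

/-- The coordinates `M_± = (M_1 ± i M_2) / √2`, `M_z = M_3`. -/
def ladder {L : Type*} {Λ : Finset L} (M : Config Λ) : Idx × Λ → ℂ
  | (Idx.plus, x) => ((M x 0 : ℂ) + Complex.I * (M x 1 : ℂ)) / (√2 : ℝ)
  | (Idx.z, x) => (M x 2 : ℂ)
  | (Idx.minus, x) => ((M x 0 : ℂ) - Complex.I * (M x 1 : ℂ)) / (√2 : ℝ)

/-- The polynomial algebra `𝔓_Λ` in the coordinates `M_i(x)`. -/
abbrev Poly {L : Type*} (Λ : Finset L) := MvPolynomial (Idx × Λ) ℂ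

/-- The value of a polynomial observable at a configuration. -/
def Poly.value {L : Type*} {Λ : Finset L} (A : Poly Λ) (M : Config Λ) : ℂ :=
  MvPolynomial.eval (ladder M) A

/-- The inclusion `𝔓_{Λ₀} ⊂ 𝔓_Λ` for `Λ₀ ⊆ Λ`. -/
def Poly.extend {L : Type*} {Λ₀ Λ : Finset L} (h : Λ₀ ⊆ Λ) (A : Poly Λ₀) : Poly Λ :=
  MvPolynomial.rename (Prod.map id fun x : Λ₀ => (⟨x.1, h x.2⟩ : Λ)) A

/-- The monomial `M^α`. -/
def monomialValue {L : Type*} {Λ : Finset L} (α : MultiIndex Λ) (M : Config Λ) : ℂ :=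
  α.prod fun p k => ladder M p ^ k

/-- The `(i, x)` component `{H_Λ(t), M_i(x)}` of the Hamiltonian vector field of
`H_Λ(t) = ∑_α V(t, α) M^α`, i.e.
`∑_α V(t, α) ∑_{j, k} i ε̃_{jik} α_j(x) M^{α - δ_j(x) + δ_k(x)}`. -/
def hamiltonianField {L : Type*} [DecidableEq L] (V : ℝ → MultiIndex L → ℂ) (Λ : Finset L)
    (t : ℝ) (M : Config Λ) (i : Idx) (x : Λ) : ℂ :=
  ∑' α : MultiIndex Λ, V t (extendIndex Λ α) * ∑ j : Idx, ∑ k : Idx,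
    Complex.I * (eps j i k : ℂ) * (α (j, x) : ℂ) *
      monomialValue (α - Finsupp.single (j, x) 1 + Finsupp.single (k, x) 1) M

/-- `M` is a global solution in `Ξ_Λ` of the Hamiltonian equations of motion with `M(0) = M₀`. -/
structure IsClassicalSolution {L : Type*} [DecidableEq L] (V : ℝ → MultiIndex L → ℂ)
    (Λ : Finset L) (M₀ : Config Λ) (M : ℝ → Config Λ) : Prop where
  initial : M 0 = M₀
  mem_phaseSpace : ∀ t, M t ∈ phaseSpace Λ
  hasDerivAt : ∀ (t : ℝ) (i : Idx) (x : Λ),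
    HasDerivAt (fun r => ladder (M r) (i, x)) (hamiltonianField V Λ t (M t) i x) t

open Classical in
/-- The flow `φ^t_Λ` : `M₀ ↦ M(t)`, where `M` is the solution starting at `M₀`. -/
def classicalFlow {L : Type*} [DecidableEq L] (V : ℝ → MultiIndex L → ℂ) (Λ : Finset L)
    (t : ℝ) (M₀ : Config Λ) : Config Λ :=
  if h : ∃ M, IsClassicalSolution V Λ M₀ M then h.choose t else M₀

/-- The classical time evolution `α^t_Λ A = A ∘ φ^t_Λ`. -/
def classicalEvolution {L : Type*} [DecidableEq L] (V : ℝ → MultiIndex L → ℂ) (Λ : Finset L)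
    (t : ℝ) (A : Config Λ → ℂ) : Config Λ → ℂ :=
  fun M₀ => A (classicalFlow V Λ t M₀)

/-! ### Quantum spins of magnitude `s = n / 2` -/

/-- `⨂_{x ∈ Λ} ℂ^{n+1}`, written in the product basis. -/
abbrev SpinSpace {L : Type*} (Λ : Finset L) (n : ℕ) := EuclideanSpace ℂ (Λ → Fin (n + 1))

/-- The algebra of operators on the spin space, with the operator norm. -/
abbrev SpinOp {L : Type*} (Λ : Finset L) (n : ℕ) := SpinSpace Λ n →L[ℂ] SpinSpace Λ n

/-- The raising operator of the spin-`n/2` representation of `su(2)` in the orthonormal basis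
`|m⟩`, `m = s, s-1, …, -s` (the basis vector of index `a` has `m = s - a`):
`|m⟩ ↦ √(s(s+1) - m(m+1)) |m+1⟩`, with `s(s+1) - m(m+1) = b (n+1-b)` for `m = s - b`. -/
def raising (n : ℕ) : Matrix (Fin (n + 1)) (Fin (n + 1)) ℂ :=
  fun a b => if (a : ℕ) + 1 = (b : ℕ) then ((√((b : ℝ) * ((n : ℝ) + 1 - (b : ℝ))) : ℝ) : ℂ) else 0

/-- The three generators of the spin-`n/2` representation of `su(2)` on `ℂ^{n+1}`. -/
def generator (n : ℕ) : Fin 3 → Matrix (Fin (n + 1)) (Fin (n + 1)) ℂ :=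
  ![(1 / 2 : ℂ) • (raising n + (raising n).conjTranspose),
    (1 / (2 * Complex.I) : ℂ) • (raising n - (raising n).conjTranspose),
    Matrix.diagonal fun a => ((n : ℂ) / 2 - (a : ℕ))]

/-- The generators rescaled by `s⁻¹`. -/
def rescaledSpin (n : ℕ) (k : Fin 3) : Matrix (Fin (n + 1)) (Fin (n + 1)) ℂ :=
  ((n : ℂ) / 2)⁻¹ • generator n k

/-- `S_± = (S_1 ± i S_2) / √2`, `S_z = S_3` on a single site. -/
def spinMatrix (n : ℕ) : Idx → Matrix (Fin (n + 1)) (Fin (n + 1)) ℂ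
  | Idx.plus => ((√2 : ℝ) : ℂ)⁻¹ • (rescaledSpin n 0 + Complex.I • rescaledSpin n 1)
  | Idx.z => rescaledSpin n 2
  | Idx.minus => ((√2 : ℝ) : ℂ)⁻¹ • (rescaledSpin n 0 - Complex.I • rescaledSpin n 1)

/-- The matrix of `T` acting on the tensor factor at `x` (identity on the other factors). -/
def siteMatrix {X : Type*} [Fintype X] [DecidableEq X] {n : ℕ} (x : X)
    (T : Matrix (Fin (n + 1)) (Fin (n + 1)) ℂ) :
    Matrix (X → Fin (n + 1)) (X → Fin (n + 1)) ℂ :=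
  fun σ τ => if ∀ y, y ≠ x → σ y = τ y then T (σ x) (τ x) else 0

/-- The spin operator `Ŝ_i(x)` on the spin space of `Λ`. -/
def spinOp {L : Type*} [DecidableEq L] (Λ : Finset L) (n : ℕ) (p : Idx × Λ) : SpinOp Λ n :=
  Matrix.toEuclideanCLM (𝕜 := ℂ) (n := Λ → Fin (n + 1)) (siteMatrix p.2 (spinMatrix n p.1))

theorem siteMatrix_mul_apply {X : Type*} [Fintype X] [DecidableEq X] {n : ℕ} {x y : X}
    (hxy : x ≠ y) (S T : Matrix (Fin (n + 1)) (Fin (n + 1)) ℂ) (σ τ : X → Fin (n + 1)) :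
    (siteMatrix x S * siteMatrix y T) σ τ =
      if ∀ w, w ≠ x → w ≠ y → σ w = τ w then S (σ x) (τ x) * T (σ y) (τ y) else 0 := by
  rw [Matrix.mul_apply, Finset.sum_eq_single (Function.update σ x (τ x))]
  · have h1 : ∀ w, w ≠ x → σ w = Function.update σ x (τ x) w := by
      intro w hw
      rw [Function.update_of_ne hw]
    have h2 : (∀ w, w ≠ y → Function.update σ x (τ x) w = τ w) ↔
        ∀ w, w ≠ x → w ≠ y → σ w = τ w := by
      constructor
      · intro h w hx hy
        have := h w hy
        rwa [Function.update_of_ne hx] at this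
      · intro h w hy
        by_cases hx : w = x
        · subst hx
          simp
        · rw [Function.update_of_ne hx]
          exact h w hx hy
    simp only [siteMatrix]
    rw [if_pos h1]
    simp only [h2, Function.update_self, Function.update_of_ne hxy.symm]
    split_ifs <;> simp
  · intro ρ _ hρ
    simp only [siteMatrix]
    split_ifs with h1 h2
    · exfalso
      apply hρ
      funext w
      by_cases hw : w = x
      · subst hw
        simp [h2 w hxy]
      · rw [Function.update_of_ne hw]
        exact (h1 w hw).symm
    all_goals simp
  · simp

theorem spinOp_commute {L : Type*} [DecidableEq L] (Λ : Finset L) (n : ℕ) {p q : Idx × Λ}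
    (h : p.1 = q.1) : Commute (spinOp Λ n p) (spinOp Λ n q) := by
  obtain ⟨i, x⟩ := p
  obtain ⟨j, y⟩ := q
  obtain rfl : i = j := h
  by_cases hxy : x = y
  · subst hxy
    exact Commute.refl _
  · simp only [Commute, SemiconjBy, spinOp, ← map_mul]
    congr 1
    ext σ τ
    rw [siteMatrix_mul_apply hxy, siteMatrix_mul_apply (Ne.symm hxy)]
    congr 1
    · exact propext ⟨fun h w a b => h w b a, fun h w a b => h w b a⟩
    · exact mul_comm _ _

/-- The rearrangement of a word of spin variables in which all indices `+` stand to the left of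
all indices `z`, and these to the left of all indices `-`. -/
def normalOrder {X : Type*} (w : List (Idx × X)) : List (Idx × X) :=
  w.filter (fun p => p.1 = Idx.plus) ++ w.filter (fun p => p.1 = Idx.z) ++
    w.filter (fun p => p.1 = Idx.minus)

/-- The normal-ordered product `:Ŝ_{i_1}(x_1) ⋯ Ŝ_{i_p}(x_p):`. -/
def wick {L : Type*} [DecidableEq L] (Λ : Finset L) (n : ℕ) (w : List (Idx × Λ)) : SpinOp Λ n :=
  ((normalOrder w).map (spinOp Λ n)).prod

theorem wick_perm {L : Type*} [DecidableEq L] (Λ : Finset L) (n : ℕ) {w w' : List (Idx × Λ)}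
    (h : w.Perm w') : wick Λ n w = wick Λ n w' := by
  have key : ∀ i : Idx, ((w.filter (fun p => p.1 = i)).map (spinOp Λ n)).prod =
      ((w'.filter (fun p => p.1 = i)).map (spinOp Λ n)).prod := by
    intro i
    apply List.Perm.prod_eq' ((h.filter _).map _)
    rw [List.pairwise_map]
    apply List.pairwise_of_forall_mem_list
    intro p hp q hq
    simp only [List.mem_filter, decide_eq_true_eq] at hp hq
    exact spinOp_commute Λ n (hp.2.trans hq.2.symm)
  simp only [wick, normalOrder, List.map_append, List.prod_append, key]

/-- The quantization of `M^α`: the normal-ordered product of the word of its factors, which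
does not depend on the order in which the factors are listed. -/
def quantMonomial {L : Type*} [DecidableEq L] (Λ : Finset L) (n : ℕ) (α : MultiIndex Λ) :
    SpinOp Λ n :=
  Quot.lift (wick Λ n) (fun _ _ h => wick_perm Λ n h) (Finsupp.toMultiset α)

/-- The quantization `Â` of a polynomial `A`, linear in `A`. -/
def quantize {L : Type*} [DecidableEq L] {Λ : Finset L} (n : ℕ) (A : Poly Λ) : SpinOp Λ n :=
  ∑ α ∈ A.support, A.coeff α • quantMonomial Λ n α

/-- The quantum Hamiltonian `Ĥ_Λ(t)`: term by term quantization of `∑_α V(t, α) M^α`. -/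
def quantumHamiltonian {L : Type*} [DecidableEq L] (V : ℝ → MultiIndex L → ℂ) (Λ : Finset L)
    (n : ℕ) (t : ℝ) : SpinOp Λ n :=
  ∑' α : MultiIndex Λ, V t (extendIndex Λ α) • quantMonomial Λ n α

/-- `U` solves `U'(t) = -i s Ĥ_Λ(t) U(t)`, `U(0) = 1`, with `s = n / 2`. -/
structure IsPropagator {L : Type*} [DecidableEq L] (V : ℝ → MultiIndex L → ℂ) (Λ : Finset L)
    (n : ℕ) (U : ℝ → SpinOp Λ n) : Prop where
  initial : U 0 = 1
  hasDerivAt : ∀ t : ℝ,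
    HasDerivAt U (-(Complex.I * ((n : ℂ) / 2)) • (quantumHamiltonian V Λ n t * U t)) t

open Classical in
/-- The propagator `U_s(t; Ĥ_Λ)`. -/
def propagator {L : Type*} [DecidableEq L] (V : ℝ → MultiIndex L → ℂ) (Λ : Finset L)
    (n : ℕ) : ℝ → SpinOp Λ n :=
  if h : ∃ U, IsPropagator V Λ n U then h.choose else fun _ => 1

/-- The Heisenberg evolution `U_s(t; Ĥ_Λ)* 𝒜 U_s(t; Ĥ_Λ)`. -/
def quantumEvolution {L : Type*} [DecidableEq L] (V : ℝ → MultiIndex L → ℂ) (Λ : Finset L)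
    (n : ℕ) (t : ℝ) (A : SpinOp Λ n) : SpinOp Λ n :=
  star (propagator V Λ n t) * A * propagator V Λ n t

end

end SpinEgorov

/-!
Both the classical monomials `M^α(t)` and the quantized monomials in the Heisenberg picture are
families `m_α(t)` evolving by the same Liouville equation
`m_α' = ∑_β V(t, β) m({M^β, M^α})`, where `m` is extended linearly to polynomials: exactly in the
classical case, and up to `O(1/s)` per bracket in the quantum case, since `is` times a commutator of
normally ordered products is the normally ordered Poisson bracket up to `O(1/s)`. It therefore
suffices to solve the transposed equation for the coefficients of an observable, in a way that only
depends on `V`: the resulting polynomial then approximates both evolutions.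

The Liouville operator is unbounded, because the bracket with `M^β` costs a factor `|α|` and raises
the degree by `|β| - 1`. The weighted `ℓ¹`-norms `∑_γ |b_γ| z^|γ|` absorb this loss if `z` decreases
in time at the rate `‖V‖`. Starting at `z = e` they remain available down to `z = 5/2` for the short
time `1 / (5 ‖V‖)`, as `5/2 + 1/5 < e`. Since the monomials are bounded by `(3/2)^|γ|` on both
sides, truncating the equation to degree at most `D` then costs a geometrically small error, and
iterating finitely many short steps reaches every time.
-/

namespace SpinEgorov

open Set Filter Topology MvPolynomial
open scoped NNReal Matrix

/-! ### Global solutions of ordinary differential equations -/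

section ODE

variable {E : Type*} [NormedAddCommGroup E] [NormedSpace ℝ E]

/-- The radial retraction of a normed space onto its closed ball of radius `R > 0`. It turns
locally Lipschitz vector fields into globally Lipschitz ones. -/
noncomputable def retract (R : ℝ) (x : E) : E := (R / max R ‖x‖) • x

theorem retract_of_norm_le {R : ℝ} (hR : 0 < R) {x : E} (hx : ‖x‖ ≤ R) : retract R x = x := by
  rw [retract, max_eq_left hx, div_self hR.ne', one_smul]

theorem norm_retract_le {R : ℝ} (hR : 0 < R) (x : E) : ‖retract R x‖ ≤ R := by
  have hmax : 0 < max R ‖x‖ := lt_max_of_lt_left hR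
  rw [retract, norm_smul, Real.norm_of_nonneg (by positivity), div_mul_eq_mul_div,
    div_le_iff₀ hmax]
  gcongr
  exact le_max_right _ _

theorem norm_retract_le_norm {R : ℝ} (hR : 0 < R) (x : E) : ‖retract R x‖ ≤ ‖x‖ := by
  have hmax : 0 < max R ‖x‖ := lt_max_of_lt_left hR
  rw [retract, norm_smul, Real.norm_of_nonneg (by positivity)]
  exact mul_le_of_le_one_left (norm_nonneg _) ((div_le_one hmax).2 (le_max_left _ _))

theorem lipschitzWith_retract {R : ℝ} (hR : 0 < R) : LipschitzWith 2 (retract R : E → E) := by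
  refine LipschitzWith.of_dist_le_mul fun x y => ?_
  rw [dist_eq_norm, dist_eq_norm, NNReal.coe_ofNat, two_mul]
  have hx : 0 < max R ‖x‖ := lt_max_of_lt_left hR
  have hy : 0 < max R ‖y‖ := lt_max_of_lt_left hR
  have hratio : R / max R ‖x‖ ≤ 1 := (div_le_one hx).2 (le_max_left _ _)
  have hmax : |max R ‖y‖ - max R ‖x‖| ≤ ‖x - y‖ := by
    rw [max_comm R ‖y‖, max_comm R ‖x‖, norm_sub_rev x y]
    exact (abs_max_sub_max_le_abs ‖y‖ ‖x‖ R).trans (abs_norm_sub_norm_le y x)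
  have hsplit : retract R x - retract R y = (R / max R ‖x‖) •
      ((x - y) + ((max R ‖y‖ - max R ‖x‖) / max R ‖y‖) • y) := by
    have hcoeff : R / max R ‖y‖ =
        R / max R ‖x‖ - R / max R ‖x‖ * ((max R ‖y‖ - max R ‖x‖) / max R ‖y‖) := by
      field_simp
      ring
    rw [retract, retract, hcoeff]
    module
  calc ‖retract R x - retract R y‖
      = R / max R ‖x‖ * ‖(x - y) + ((max R ‖y‖ - max R ‖x‖) / max R ‖y‖) • y‖ := by
        rw [hsplit, norm_smul, Real.norm_of_nonneg (by positivity)]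
    _ ≤ ‖(x - y) + ((max R ‖y‖ - max R ‖x‖) / max R ‖y‖) • y‖ :=
        mul_le_of_le_one_left (norm_nonneg _) hratio
    _ ≤ ‖x - y‖ + |max R ‖y‖ - max R ‖x‖| / max R ‖y‖ * ‖y‖ := by
        refine (norm_add_le _ _).trans_eq ?_
        rw [norm_smul, norm_div, Real.norm_eq_abs, Real.norm_of_nonneg hy.le]
    _ ≤ ‖x - y‖ + ‖x - y‖ := by
        gcongr
        rw [div_mul_eq_mul_div, div_le_iff₀ hy]
        exact mul_le_mul hmax (le_max_right _ _) (norm_nonneg _) (norm_nonneg _)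

theorem norm_le_gronwallBound_of_hasDerivWithinAt_Icc_of_nonneg {x x' : ℝ → E} {T K C : ℝ}
    (hx : ∀ t ∈ Icc (-T) T, HasDerivWithinAt x (x' t) (Icc (-T) T) t)
    (hbound : ∀ t ∈ Icc (-T) T, ‖x' t‖ ≤ K * ‖x t‖ + C) {t : ℝ} (ht : t ∈ Icc 0 T) :
    ‖x t‖ ≤ gronwallBound ‖x 0‖ K C t := by
  have hT : 0 ≤ T := ht.1.trans ht.2
  have hsub : Icc 0 T ⊆ Icc (-T) T := Icc_subset_Icc_left (by linarith)
  have h := norm_le_gronwallBound_of_norm_deriv_right_le (f := x) (f' := x') (a := 0) (b := T)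
    (fun s hs => ((hx s (hsub hs)).continuousWithinAt).mono hsub)
    (fun s hs => (hx s (hsub (Ico_subset_Icc_self hs))).mono_of_mem_nhdsWithin
      (mem_of_superset (Icc_mem_nhdsGE hs.2) (Icc_subset_Icc_left (by linarith [hs.1]))))
    le_rfl (fun s hs => hbound s (hsub (Ico_subset_Icc_self hs))) t ht
  rwa [sub_zero] at h

theorem norm_le_gronwallBound_of_hasDerivWithinAt_Icc {x x' : ℝ → E} {T K C : ℝ}
    (hx : ∀ t ∈ Icc (-T) T, HasDerivWithinAt x (x' t) (Icc (-T) T) t)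
    (hbound : ∀ t ∈ Icc (-T) T, ‖x' t‖ ≤ K * ‖x t‖ + C) {t : ℝ} (ht : t ∈ Icc (-T) T) :
    ‖x t‖ ≤ gronwallBound ‖x 0‖ K C |t| := by
  rcases le_total 0 t with h | h
  · rw [abs_of_nonneg h]
    exact norm_le_gronwallBound_of_hasDerivWithinAt_Icc_of_nonneg hx hbound ⟨h, ht.2⟩
  · have hneg : MapsTo (fun s : ℝ => -s) (Icc (-T) T) (Icc (-T) T) := fun s hs =>
      ⟨neg_le_neg hs.2, neg_le.1 hs.1⟩
    have hreflect : ∀ s ∈ Icc (-T) T,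
        HasDerivWithinAt (fun s => x (-s)) (-x' (-s)) (Icc (-T) T) s := fun s hs => by
      simpa [Function.comp_def] using
        (hx (-s) (hneg hs)).scomp s (hasDerivAt_neg s).hasDerivWithinAt hneg
    have := norm_le_gronwallBound_of_hasDerivWithinAt_Icc_of_nonneg hreflect
      (fun s hs => by simpa only [norm_neg] using hbound (-s) (hneg hs))
      (t := -t) ⟨by linarith, by linarith [ht.1]⟩
    simpa only [neg_neg, neg_zero, abs_of_nonpos h] using this

theorem exists_hasDerivAt_of_forall_Icc {f : ℝ → E → E}
    (hlip : ∀ T : ℝ, ∃ K : ℝ≥0, ∀ t ∈ Icc (-T) T, LipschitzWith K (f t)) {x₀ : E}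
    (hex : ∀ T : ℝ, 0 ≤ T → ∃ x : ℝ → E, x 0 = x₀ ∧
      ∀ t ∈ Icc (-T) T, HasDerivWithinAt x (f t (x t)) (Icc (-T) T) t) :
    ∃ x : ℝ → E, x 0 = x₀ ∧ ∀ t, HasDerivAt x (f t (x t)) t := by
  choose! x hx0 hx using hex
  have hderiv : ∀ T t, |t| < T → HasDerivAt (x T) (f t (x T t)) t := fun T t ht => by
    have hT : 0 ≤ T := (abs_nonneg t).trans ht.le
    have ht' := abs_lt.1 ht
    exact (hx T hT t (abs_le.1 ht.le)).hasDerivAt (Icc_mem_nhds ht'.1 ht'.2)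
  have hagree : ∀ S T s, |s| < S → S ≤ T → x S s = x T s := fun S T s hs hST => by
    obtain ⟨K, hK⟩ := hlip S
    have hS : 0 < S := (abs_nonneg s).trans_lt hs
    refine ODE_solution_unique_of_mem_Ioo (v := f) (s := fun _ => univ) (K := K) (t₀ := 0)
      (fun t ht => (hK t (Ioo_subset_Icc_self ht)).lipschitzOnWith) ⟨by linarith, hS⟩
      (fun t ht => ⟨hderiv S t (abs_lt.2 ht), mem_univ _⟩)
      (fun t ht => ⟨hderiv T t ((abs_lt.2 ht).trans_le hST), mem_univ _⟩)
      ?_ (abs_lt.1 hs)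
    rw [hx0 S hS.le, hx0 T (hS.le.trans hST)]
  refine ⟨fun t => x (|t| + 1) t, hx0 _ (by positivity), fun t => ?_⟩
  have hev : (fun s => x (|s| + 1) s) =ᶠ[𝓝 t] x (|t| + 2) := by
    filter_upwards [continuous_abs.continuousAt.eventually_lt
      (continuousAt_const (y := |t| + 1)) (by linarith)] with s hs
    exact hagree _ _ s (by linarith) (by linarith)
  have h := hderiv (|t| + 2) t (by linarith)
  rw [← hev.eq_of_nhds] at h
  exact h.congr_of_eventuallyEq hev

variable [CompleteSpace E]

theorem exists_solution_Icc_of_bounded {f : ℝ → E → E} (hcont : ∀ x, Continuous fun t => f t x)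
    {T : ℝ} (hT : 0 ≤ T) {K B : ℝ≥0} (hlip : ∀ t ∈ Icc (-T) T, LipschitzWith K (f t))
    (hbound : ∀ t ∈ Icc (-T) T, ∀ x, ‖f t x‖ ≤ B) (x₀ : E) :
    ∃ x : ℝ → E, x 0 = x₀ ∧
      ∀ t ∈ Icc (-T) T, HasDerivWithinAt x (f t (x t)) (Icc (-T) T) t := by
  have hpl : IsPicardLindelof f (⟨0, by simpa using hT, hT⟩ : Icc (-T) T) x₀
      (B * T.toNNReal) 0 B K :=
    { lipschitzOnWith := fun t ht => (hlip t ht).lipschitzOnWith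
      continuousOn := fun x _ => (hcont x).continuousOn
      norm_le := fun t ht x _ => hbound t ht x
      mul_max_le := by simp [hT] }
  exact hpl.exists_eq_forall_mem_Icc_hasDerivWithinAt₀

/- Cutting the field off outside a ball makes it bounded without affecting its solution, because
Grönwall's inequality confines the solution to that ball. -/
theorem exists_solution_Icc {f : ℝ → E → E} (hcont : ∀ x, Continuous fun t => f t x)
    {T : ℝ} (hT : 0 ≤ T) {K : ℝ≥0} (hlip : ∀ t ∈ Icc (-T) T, LipschitzWith K (f t)) (x₀ : E) :
    ∃ x : ℝ → E, x 0 = x₀ ∧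
      ∀ t ∈ Icc (-T) T, HasDerivWithinAt x (f t (x t)) (Icc (-T) T) t := by
  obtain ⟨C, hC⟩ : ∃ C, ∀ t ∈ Icc (-T) T, ‖f t 0‖ ≤ C :=
    isCompact_Icc.exists_bound_of_continuousOn (hcont 0).continuousOn
  have hC0 : 0 ≤ C := (norm_nonneg _).trans (hC 0 ⟨by linarith, hT⟩)
  have hgrowth : ∀ t ∈ Icc (-T) T, ∀ x, ‖f t x‖ ≤ K * ‖x‖ + C := fun t ht x => by
    have hdist := (hlip t ht).dist_le_mul x 0
    rw [dist_eq_norm, dist_zero_right] at hdist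
    linarith [norm_sub_norm_le (f t x) (f t 0), hC t ht]
  set R : ℝ := max 1 (gronwallBound ‖x₀‖ K C T)
  have hR : 0 < R := lt_max_of_lt_left one_pos
  obtain ⟨x, hx0, hx⟩ := exists_solution_Icc_of_bounded (f := fun t x => f t (retract R x))
    (B := ⟨K * R + C, by positivity⟩) (fun x => hcont _) hT
    (fun t ht => (hlip t ht).comp (lipschitzWith_retract hR))
    (fun t ht x => (hgrowth t ht _).trans <| by
      change _ ≤ K * R + C
      gcongr
      exact norm_retract_le hR x) x₀
  refine ⟨x, hx0, fun t ht => ?_⟩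
  have hgronwall := norm_le_gronwallBound_of_hasDerivWithinAt_Icc hx
    (fun s hs => (hgrowth s hs _).trans <| by
      gcongr
      exact norm_retract_le_norm hR _) ht
  have hball : ‖x t‖ ≤ R := by
    refine hgronwall.trans (le_max_of_le_right ?_)
    rw [hx0]
    exact gronwallBound_mono (norm_nonneg _) hC0 K.coe_nonneg (abs_le.2 ht)
  simpa only [retract_of_norm_le hR hball] using hx t ht

theorem exists_global_solution {f : ℝ → E → E} (hcont : ∀ x, Continuous fun t => f t x)
    (hlip : ∀ T : ℝ, ∃ K : ℝ≥0, ∀ t ∈ Icc (-T) T, LipschitzWith K (f t)) (x₀ : E) :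
    ∃ x : ℝ → E, x 0 = x₀ ∧ ∀ t, HasDerivAt x (f t (x t)) t :=
  exists_hasDerivAt_of_forall_Icc hlip fun T hT =>
    (hlip T).elim fun _ hK => exists_solution_Icc hcont hT hK x₀

theorem exists_linear_solution {A : ℝ → E →L[ℝ] E} (hA : Continuous A) (t₀ : ℝ) (x₀ : E) :
    ∃ x : ℝ → E, x t₀ = x₀ ∧ ∀ t, HasDerivAt x (A t (x t)) t := by
  have hcont : Continuous fun t => A (t + t₀) := hA.comp (continuous_id.add continuous_const)
  obtain ⟨x, hx0, hx⟩ := exists_global_solution (f := fun t => A (t + t₀))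
    (fun x => hcont.clm_apply continuous_const)
    (fun T => by
      obtain ⟨C, hC⟩ := isCompact_Icc.exists_bound_of_continuousOn (s := Icc (-T) T)
        hcont.continuousOn
      exact ⟨C.toNNReal, fun t ht => (A (t + t₀)).lipschitz.weaken
        (NNReal.le_toNNReal_of_coe_le (hC t ht))⟩) x₀
  refine ⟨fun t => x (t - t₀), by simpa using hx0, fun t => ?_⟩
  simpa only [sub_add_cancel] using (hx (t - t₀)).comp_sub_const t t₀

end ODE

/-! ### Summability of interaction potentials -/

section Potential

theorem sum_siteDegree {X : Type*} [Fintype X] (α : MultiIndex X) :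
    ∑ x, siteDegree α x = α.degree := by
  rw [Finsupp.degree_eq_sum, Fintype.sum_prod_type_right]
  rfl

theorem siteDegree_le_degree {X : Type*} [Finite X] (α : MultiIndex X) (x : X) :
    siteDegree α x ≤ α.degree := by
  have := Fintype.ofFinite X
  rw [← sum_siteDegree]
  exact Finset.single_le_sum_of_canonicallyOrdered (Finset.mem_univ x)

theorem le_sum_siteDegree_mul {X : Type*} [Fintype X] {β : MultiIndex X} (hβ : β ≠ 0)
    {a : ℝ} (ha : 0 ≤ a) :
    a ≤ ∑ x, (siteDegree β x : ℝ) * a := by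
  rw [← Finset.sum_mul, ← Nat.cast_sum, sum_siteDegree]
  refine le_mul_of_one_le_left ha (Nat.one_le_cast.2 (Nat.one_le_iff_ne_zero.2 ?_))
  rwa [ne_eq, Finsupp.degree_eq_zero_iff]

theorem extendIndex_injective {L : Type*} (Λ : Finset L) :
    Function.Injective (extendIndex Λ) :=
  Finsupp.mapDomain_injective (Function.injective_id.prodMap Subtype.val_injective)

theorem degree_extendIndex {L : Type*} (Λ : Finset L) (α : MultiIndex Λ) :
    (extendIndex Λ α).degree = α.degree :=
  Finsupp.degree_mapDomain _ _

theorem siteDegree_extendIndex {L : Type*} (Λ : Finset L) (α : MultiIndex Λ) (x : Λ) :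
    siteDegree (extendIndex Λ α) x.1 = siteDegree α x :=
  Finset.sum_congr rfl fun i _ => Finsupp.mapDomain_apply
    (Function.injective_id.prodMap Subtype.val_injective) α (i, x)

/-- `W` is a potential on the set `X` of sites with
`sup_{x,t} ∑_{|β| = n} |β(x)| |W(t, β)| e^n ≤ v n` and `∑ v n < ∞`. Sums over `β` are replaced by
their finite partial sums. -/
structure IsBoundedPotential {X : Type*} (W : ℝ → MultiIndex X → ℂ) (v : ℕ → ℝ) : Prop where
  continuous : ∀ β, Continuous fun t => W t β
  nonneg : ∀ n, 0 ≤ v n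
  summable : Summable v
  sum_le : ∀ (n : ℕ) (x : X) (t : ℝ) (s : Finset (MultiIndex X)), (∀ β ∈ s, β.degree = n) →
    ∑ β ∈ s, (siteDegree β x : ℝ) * ‖W t β‖ * Real.exp n ≤ v n

theorem sum_extendIndex_le_tsum {L : Type*} (Λ : Finset L) {n : ℕ} (f : MultiIndex L → ENNReal)
    {s : Finset (MultiIndex Λ)} (hs : ∀ β ∈ s, β.degree = n) :
    ∑ β ∈ s, f (extendIndex Λ β) ≤ ∑' α : {α : MultiIndex L // α.degree = n}, f α.1 := by
  rw [← Finset.tsum_subtype s fun β => f (extendIndex Λ β)]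
  exact ENNReal.tsum_comp_le_tsum_of_injective
    (f := fun β : s => ⟨extendIndex Λ β.1, (degree_extendIndex Λ β.1).trans (hs β.1 β.2)⟩)
    (fun _ _ h => Subtype.ext (extendIndex_injective Λ (congrArg Subtype.val h)))
    fun α : {α : MultiIndex L // α.degree = n} => f α.1

theorem exists_isBoundedPotential {L : Type*} {V : ℝ → MultiIndex L → ℂ}
    (hnorm : potentialNorm V < ⊤) (hcont : ∀ α, Continuous fun t => V t α) :
    ∃ v : ℕ → ℝ, ∀ Λ : Finset L,
      IsBoundedPotential (fun t (β : MultiIndex Λ) => V t (extendIndex Λ β)) v := by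
  set w : ℕ → ENNReal := fun n => ⨆ (x : L) (t : ℝ), ∑' α : {α : MultiIndex L // α.degree = n},
    (siteDegree α.1 x : ENNReal) * ‖V t α.1‖ₑ * ENNReal.ofReal (Real.exp n)
  have hsum : ∑' n, w n ≠ ⊤ := hnorm.ne
  refine ⟨fun n => (w n).toReal, fun Λ => ⟨fun β => hcont _, fun n => ENNReal.toReal_nonneg,
    ENNReal.summable_toReal hsum, fun n x t s hs => ?_⟩⟩
  rw [← ENNReal.ofReal_le_iff_le_toReal (ENNReal.ne_top_of_tsum_ne_top hsum n),
    ENNReal.ofReal_sum_of_nonneg fun β _ => by positivity]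
  have hterm : ∀ β : MultiIndex Λ, ENNReal.ofReal ((siteDegree β x : ℝ) *
      ‖V t (extendIndex Λ β)‖ * Real.exp n) = (siteDegree (extendIndex Λ β) x.1 : ENNReal) *
        ‖V t (extendIndex Λ β)‖ₑ * ENNReal.ofReal (Real.exp n) := fun β => by
    rw [ENNReal.ofReal_mul (by positivity), ENNReal.ofReal_mul (by positivity),
      ENNReal.ofReal_natCast, ofReal_norm, siteDegree_extendIndex]
  simp only [hterm]
  exact (sum_extendIndex_le_tsum Λ (fun α => (siteDegree α x.1 : ENNReal) * ‖V t α‖ₑ *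
    ENNReal.ofReal (Real.exp n)) hs).trans (le_iSup₂_of_le x.1 t le_rfl)

namespace IsBoundedPotential

variable {X : Type*} {W : ℝ → MultiIndex X → ℂ} {v : ℕ → ℝ}

theorem sum_le_tsum (hW : IsBoundedPotential W v) (x : X) (t : ℝ) (s : Finset (MultiIndex X)) :
    ∑ β ∈ s, (siteDegree β x : ℝ) * ‖W t β‖ * Real.exp β.degree ≤ ∑' n, v n := by
  rw [← Finset.sum_fiberwise_of_maps_to (t := s.image Finsupp.degree) (g := Finsupp.degree)
    fun β hβ => Finset.mem_image_of_mem _ hβ]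
  refine (Finset.sum_le_sum (g := v) fun n _ => ?_).trans
    (hW.summable.sum_le_tsum _ fun n _ => hW.nonneg n)
  refine (Finset.sum_congr rfl fun β hβ => ?_).trans_le
    (hW.sum_le n x t {β ∈ s | β.degree = n} fun β hβ => (Finset.mem_filter.1 hβ).2)
  rw [(Finset.mem_filter.1 hβ).2]

theorem tsum_nonneg (hW : IsBoundedPotential W v) : 0 ≤ ∑' n, v n := _root_.tsum_nonneg hW.nonneg

theorem summable_site (hW : IsBoundedPotential W v) (x : X) (t : ℝ) :
    Summable fun β => (siteDegree β x : ℝ) * ‖W t β‖ * Real.exp β.degree :=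
  summable_of_sum_le (fun _ => by positivity) (hW.sum_le_tsum x t)

theorem tsum_site_le (hW : IsBoundedPotential W v) (x : X) (t : ℝ) :
    ∑' β, (siteDegree β x : ℝ) * ‖W t β‖ * Real.exp β.degree ≤ ∑' n, v n :=
  (hW.summable_site x t).tsum_le_of_sum_le (hW.sum_le_tsum x t)

section

variable [Fintype X]

theorem sum_norm_le_of_degree (hW : IsBoundedPotential W v) {n : ℕ} (hn : n ≠ 0) (t : ℝ)
    {s : Finset (MultiIndex X)} (hs : ∀ β ∈ s, β.degree = n) :
    ∑ β ∈ s, ‖W t β‖ * Real.exp n ≤ Fintype.card X * v n := by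
  calc ∑ β ∈ s, ‖W t β‖ * Real.exp n
      ≤ ∑ β ∈ s, ∑ x, (siteDegree β x : ℝ) * (‖W t β‖ * Real.exp n) := by
        refine Finset.sum_le_sum fun β hβ => le_sum_siteDegree_mul ?_ (by positivity)
        rintro rfl
        exact hn (by rw [← hs 0 hβ, map_zero])
    _ = ∑ x, ∑ β ∈ s, (siteDegree β x : ℝ) * ‖W t β‖ * Real.exp n := by
        rw [Finset.sum_comm]
        simp only [mul_assoc]
    _ ≤ ∑ _x : X, v n := Finset.sum_le_sum fun x _ => hW.sum_le n x t s hs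
    _ = Fintype.card X * v n := by simp

variable {E : Type*} [NormedAddCommGroup E] [NormedSpace ℂ E] {c : MultiIndex X → E} {κ : ℝ}

theorem norm_sum_smul_le_of_degree (hW : IsBoundedPotential W v)
    (hc : ∀ β, ‖c β‖ ≤ κ * Real.exp β.degree) {n : ℕ} (hn : n ≠ 0) (t : ℝ)
    {s : Finset (MultiIndex X)} (hs : ∀ β ∈ s, β.degree = n) :
    ‖∑ β ∈ s, W t β • c β‖ ≤ κ * (Fintype.card X * v n) := by
  have hκ : 0 ≤ κ := by simpa using (norm_nonneg _).trans (hc 0)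
  calc ‖∑ β ∈ s, W t β • c β‖
      ≤ ∑ β ∈ s, κ * (‖W t β‖ * Real.exp n) := norm_sum_le_of_le _ fun β hβ => by
        rw [norm_smul, mul_left_comm, ← hs β hβ]
        exact mul_le_mul_of_nonneg_left (hc β) (norm_nonneg _)
    _ ≤ κ * (Fintype.card X * v n) := by
        rw [← Finset.mul_sum]
        exact mul_le_mul_of_nonneg_left (hW.sum_norm_le_of_degree hn t hs) hκ

end

variable [Finite X]

theorem summable_norm_exp (hW : IsBoundedPotential W v) (t : ℝ) :
    Summable fun β => ‖W t β‖ * Real.exp β.degree := by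
  classical
  have := Fintype.ofFinite X
  refine Summable.of_nonneg_of_le (fun _ => by positivity) (fun β => ?_)
    ((hasSum_ite_eq (0 : MultiIndex X) ‖W t 0‖).summable.add
      (summable_sum fun x (_ : x ∈ Finset.univ) => hW.summable_site x t))
  by_cases hβ : β = 0
  · simp only [hβ, map_zero, Nat.cast_zero, Real.exp_zero, mul_one, if_true]
    exact le_add_of_nonneg_right (Finset.sum_nonneg fun _ _ => by positivity)
  · simp only [if_neg hβ, zero_add, mul_assoc]
    exact le_sum_siteDegree_mul hβ (by positivity)

variable {E : Type*} [NormedAddCommGroup E] [NormedSpace ℂ E] {c : MultiIndex X → E} {κ : ℝ}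

theorem summable_norm_smul (hW : IsBoundedPotential W v)
    (hc : ∀ β, ‖c β‖ ≤ κ * Real.exp β.degree) (t : ℝ) :
    Summable fun β => ‖W t β • c β‖ := by
  refine Summable.of_nonneg_of_le (fun _ => norm_nonneg _) (fun β => ?_)
    ((hW.summable_norm_exp t).mul_left κ)
  rw [norm_smul, mul_left_comm]
  exact mul_le_mul_of_nonneg_left (hc β) (norm_nonneg _)

variable [CompleteSpace E]

theorem summable_smul (hW : IsBoundedPotential W v)
    (hc : ∀ β, ‖c β‖ ≤ κ * Real.exp β.degree) (t : ℝ) :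
    Summable fun β => W t β • c β :=
  (hW.summable_norm_smul hc t).of_norm

theorem hasSum_sum_degree_smul (hW : IsBoundedPotential W v)
    (hc : ∀ β, ‖c β‖ ≤ κ * Real.exp β.degree) (t : ℝ) :
    HasSum (fun n => ∑ β ∈ (Finsupp.finite_of_degree_eq (σ := Idx × X) n).toFinset, W t β • c β)
      (∑' β, W t β • c β) := by
  refine ((hW.summable_smul hc t).hasSum.tsum_fiberwise Finsupp.degree).congr_fun fun n => ?_
  rw [← Finset.tsum_subtype', Set.Finite.coe_toFinset]
  rfl

/- Degree by degree the sum converges uniformly in `t`, whereas `∑_β sup_t |W(t, β)|` may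
diverge. -/
theorem continuous_tsum_smul (hW : IsBoundedPotential W v)
    (hc : ∀ β, ‖c β‖ ≤ κ * Real.exp β.degree) :
    Continuous fun t => ∑' β, W t β • c β := by
  have := Fintype.ofFinite X
  have hterm : ∀ n, Continuous fun t =>
      ∑ β ∈ (Finsupp.finite_of_degree_eq (σ := Idx × X) n).toFinset, W t β • c β := fun n =>
    continuous_finsetSum _ fun β _ => (hW.continuous β).smul continuous_const
  have hsplit := fun t => (hW.hasSum_sum_degree_smul hc t).tsum_eq.symm.trans
    (hW.hasSum_sum_degree_smul hc t).summable.tsum_eq_zero_add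
  simp only [hsplit]
  refine (hterm 0).add (continuous_tsum (fun n => hterm (n + 1))
    (((summable_nat_add_iff 1).2 hW.summable).mul_left (Fintype.card X : ℝ) |>.mul_left κ)
    fun n t => hW.norm_sum_smul_le_of_degree hc n.succ_ne_zero t fun β hβ => by simpa using hβ)

end IsBoundedPotential

end Potential

/-! ### Linear functionals and the coefficient norm on polynomials -/

section Observe

variable {σ : Type*} {E : Type*} [NormedAddCommGroup E] [NormedSpace ℂ E]

/-- The linear map on polynomials with prescribed values on the monomials. Evaluation at a
configuration and quantization are both of this form. -/
noncomputable def observe (m : (σ →₀ ℕ) → E) : MvPolynomial σ ℂ →ₗ[ℂ] E :=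
  (basisMonomials σ ℂ).constr ℂ m

theorem observe_monomial (m : (σ →₀ ℕ) → E) (γ : σ →₀ ℕ) (c : ℂ) :
    observe m (monomial γ c) = c • m γ := by
  have h : monomial γ c = c • (basisMonomials σ ℂ) γ := by
    rw [coe_basisMonomials, smul_monomial, smul_eq_mul, mul_one]
  rw [h, map_smul, observe, Module.Basis.constr_basis]

theorem observe_apply (m : (σ →₀ ℕ) → E) (A : MvPolynomial σ ℂ) :
    observe m A = ∑ γ ∈ A.support, A.coeff γ • m γ := by
  conv_lhs => rw [A.as_sum, map_sum]
  exact Finset.sum_congr rfl fun γ _ => observe_monomial m γ _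

/-- The `ℓ¹` norm of the coefficients of a polynomial. -/
noncomputable def coeffNorm (A : MvPolynomial σ ℂ) : ℝ := ∑ γ ∈ A.support, ‖A.coeff γ‖

theorem coeffNorm_nonneg (A : MvPolynomial σ ℂ) : 0 ≤ coeffNorm A :=
  Finset.sum_nonneg fun _ _ => norm_nonneg _

theorem coeffNorm_eq_sum_of_subset {A : MvPolynomial σ ℂ} {s : Finset (σ →₀ ℕ)}
    (hs : A.support ⊆ s) : coeffNorm A = ∑ γ ∈ s, ‖A.coeff γ‖ := by
  refine Finset.sum_subset hs fun γ _ hγ => ?_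
  rw [notMem_support_iff.1 hγ, norm_zero]

theorem sum_norm_coeff_le_coeffNorm (A : MvPolynomial σ ℂ) (s : Finset (σ →₀ ℕ)) :
    ∑ γ ∈ s, ‖A.coeff γ‖ ≤ coeffNorm A := by
  classical
  rw [coeffNorm_eq_sum_of_subset (s := s ∪ A.support) Finset.subset_union_right]
  exact Finset.sum_le_sum_of_subset_of_nonneg Finset.subset_union_left fun _ _ _ => norm_nonneg _

theorem coeffNorm_add_le (A B : MvPolynomial σ ℂ) :
    coeffNorm (A + B) ≤ coeffNorm A + coeffNorm B := by
  classical
  rw [coeffNorm_eq_sum_of_subset (s := A.support ∪ B.support) support_add,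
    coeffNorm_eq_sum_of_subset (A := A) (s := A.support ∪ B.support) Finset.subset_union_left,
    coeffNorm_eq_sum_of_subset (A := B) (s := A.support ∪ B.support) Finset.subset_union_right,
    ← Finset.sum_add_distrib]
  refine Finset.sum_le_sum fun γ _ => ?_
  rw [coeff_add]
  exact norm_add_le _ _

theorem coeffNorm_monomial_le (γ : σ →₀ ℕ) (c : ℂ) : coeffNorm (monomial γ c) ≤ ‖c‖ := by
  classical
  rw [coeffNorm_eq_sum_of_subset (s := {γ}) support_monomial_subset]
  simp

theorem coeffNorm_sum_monomial_le {ι : Type*} (s : Finset ι) (γ : ι → σ →₀ ℕ) (c : ι → ℂ) :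
    coeffNorm (∑ i ∈ s, monomial (γ i) (c i)) ≤ ∑ i ∈ s, ‖c i‖ := by
  classical
  induction s using Finset.induction_on with
  | empty => simp [coeffNorm]
  | insert i s hi ih =>
    rw [Finset.sum_insert hi, Finset.sum_insert hi]
    exact (coeffNorm_add_le _ _).trans (add_le_add (coeffNorm_monomial_le _ _) ih)

theorem norm_coeff_le_coeffNorm (A : MvPolynomial σ ℂ) (γ : σ →₀ ℕ) :
    ‖A.coeff γ‖ ≤ coeffNorm A := by
  by_cases h : γ ∈ A.support
  · exact Finset.single_le_sum (f := fun γ => ‖A.coeff γ‖) (fun _ _ => norm_nonneg _) h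
  · rw [notMem_support_iff.1 h, norm_zero]
    exact coeffNorm_nonneg A

end Observe

/-! ### Words and formal expansions -/

section Words

variable {σ : Type*}

theorem card_toMultiset_eq_degree (α : σ →₀ ℕ) : α.toMultiset.card = α.degree := by
  rw [Finsupp.card_toMultiset, Finsupp.degree_apply]
  rfl

theorem prod_map_toMultiset {M : Type*} [CommMonoid M] (α : σ →₀ ℕ) (f : σ → M) :
    (α.toMultiset.map f).prod = α.prod fun p k => f p ^ k := by
  classical
  rw [Finset.prod_multiset_map_count, Finsupp.toFinset_toMultiset]
  simp only [Finsupp.count_toMultiset, Finsupp.prod]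

theorem length_of_coe_eq_toMultiset {w : List σ} {α : σ →₀ ℕ}
    (h : (w : Multiset σ) = α.toMultiset) : w.length = α.degree := by
  rw [← card_toMultiset_eq_degree, ← h, Multiset.coe_card]

theorem sum_map_of_coe_eq_toMultiset [Fintype σ] {M : Type*} [AddCommMonoid M] {w : List σ}
    {α : σ →₀ ℕ} (h : (w : Multiset σ) = α.toMultiset) (f : σ → M) :
    (w.map f).sum = ∑ p, α p • f p := by
  classical
  rw [← Multiset.sum_coe, ← Multiset.map_coe, h, Finset.sum_multiset_map_count,
    Finsupp.toFinset_toMultiset]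
  simp only [Finsupp.count_toMultiset]
  exact Finset.sum_subset (Finset.subset_univ _) fun p _ hp => by
    rw [Finsupp.notMem_support_iff.1 hp, zero_smul]

/-- The product of the values `S p` of the letters `p` of a word, in order. -/
def wordProd {M : Type*} [Monoid M] (S : σ → M) (w : List σ) : M := (w.map S).prod

section Monoid

variable {M : Type*} [Monoid M] (S : σ → M)

@[simp]
theorem wordProd_nil : wordProd S [] = 1 := rfl

@[simp]
theorem wordProd_cons (p : σ) (w : List σ) : wordProd S (p :: w) = S p * wordProd S w := by
  simp [wordProd]

@[simp]
theorem wordProd_append (u w : List σ) : wordProd S (u ++ w) = wordProd S u * wordProd S w := by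
  simp [wordProd]

end Monoid

section Norm

variable {𝒜 : Type*} [NormedRing 𝒜] [NormOneClass 𝒜] {S S' : σ → 𝒜}

theorem norm_wordProd_le {κ : ℝ} (hS : ∀ p, ‖S p‖ ≤ κ) (w : List σ) :
    ‖wordProd S w‖ ≤ κ ^ w.length := by
  induction w with
  | nil => simp
  | cons p w ih =>
    rw [wordProd_cons, List.length_cons, pow_succ']
    exact norm_mul_le_of_le (hS p) ih

theorem norm_wordProd_sub_le {η : ℝ} (hS : ∀ p, ‖S p‖ ≤ 1) (hS' : ∀ p, ‖S' p‖ ≤ 1)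
    (hη : ∀ p, ‖S p - S' p‖ ≤ η) (w : List σ) :
    ‖wordProd S w - wordProd S' w‖ ≤ w.length * η := by
  induction w with
  | nil => simp
  | cons p w ih =>
    have hw : ‖wordProd S w‖ ≤ 1 := by simpa using norm_wordProd_le hS w
    calc ‖wordProd S (p :: w) - wordProd S' (p :: w)‖
        = ‖(S p - S' p) * wordProd S w + S' p * (wordProd S w - wordProd S' w)‖ := by
          rw [wordProd_cons, wordProd_cons, sub_mul, mul_sub, sub_add_sub_cancel]
      _ ≤ η * 1 + 1 * (w.length * η) :=
          norm_add_le_of_le (norm_mul_le_of_le (hη p) hw) (norm_mul_le_of_le (hS' p) ih)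
      _ = (p :: w).length * η := by
          push_cast [List.length_cons]
          ring

end Norm

theorem wordProd_X {w : List σ} {α : σ →₀ ℕ} (h : (w : Multiset σ) = α.toMultiset) :
    wordProd (X : σ → MvPolynomial σ ℂ) w = monomial α 1 := by
  rw [wordProd, ← Multiset.prod_coe, ← Multiset.map_coe, h, monomial_eq, C_1, one_mul,
    prod_map_toMultiset]

/-- A formal linear combination of words. It records the Leibniz expansion of a bracket, to be
evaluated both in commuting and in non-commuting variables. -/
abbrev Expansion (σ : Type*) := List (ℂ × List σ)

namespace Expansion

/-- The value of an expansion at variables in an algebra. -/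
def eval {𝒜 : Type*} [Ring 𝒜] [Algebra ℂ 𝒜] (S : σ → 𝒜) (f : Expansion σ) : 𝒜 :=
  (f.map fun t => t.1 • wordProd S t.2).sum

/-- The `ℓ¹` norm of the coefficients of an expansion. -/
noncomputable def size (f : Expansion σ) : ℝ := (f.map fun t => ‖t.1‖).sum

/-- Multiplication of every word of an expansion by `a` on the left and `b` on the right. -/
def sandwich (a b : List σ) (f : Expansion σ) : Expansion σ :=
  f.map fun t => (t.1, a ++ t.2 ++ b)

section Eval

variable {𝒜 : Type*} [Ring 𝒜] [Algebra ℂ 𝒜] (S : σ → 𝒜)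

@[simp]
theorem eval_nil : eval S [] = 0 := rfl

@[simp]
theorem eval_cons (t : ℂ × List σ) (f : Expansion σ) :
    eval S (t :: f) = t.1 • wordProd S t.2 + eval S f := by
  simp [eval]

@[simp]
theorem eval_append (f g : Expansion σ) : eval S (f ++ g) = eval S f + eval S g := by
  simp [eval]

@[simp]
theorem eval_sandwich (a b : List σ) (f : Expansion σ) :
    eval S (f.sandwich a b) = wordProd S a * eval S f * wordProd S b := by
  simp only [eval, sandwich, List.map_map]
  rw [← List.sum_map_mul_left, ← List.sum_map_mul_right]
  simp [Function.comp_def, mul_assoc]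

end Eval

@[simp]
theorem size_nil : size ([] : Expansion σ) = 0 := rfl

@[simp]
theorem size_cons (t : ℂ × List σ) (f : Expansion σ) : size (t :: f) = ‖t.1‖ + size f := by
  simp [size]

@[simp]
theorem size_append (f g : Expansion σ) : size (f ++ g) = size f + size g := by
  simp [size]

@[simp]
theorem size_sandwich (a b : List σ) (f : Expansion σ) : size (f.sandwich a b) = size f := by
  simp [size, sandwich, Function.comp_def]

theorem exists_length_eq_of_mem_sandwich {a b : List σ} {f : Expansion σ} {t : ℂ × List σ}
    (ht : t ∈ f.sandwich a b) : ∃ t' ∈ f, t.2.length = a.length + t'.2.length + b.length := by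
  obtain ⟨t', ht', rfl⟩ := List.mem_map.1 ht
  exact ⟨t', ht', by simp [add_assoc]⟩

theorem coeffNorm_eval_X_le (f : Expansion σ) :
    coeffNorm (f.eval (X : σ → MvPolynomial σ ℂ)) ≤ f.size := by
  classical
  induction f with
  | nil => simp [coeffNorm]
  | cons t f ih =>
    rw [eval_cons, size_cons, wordProd_X (α := Multiset.toFinsupp (t.2 : Multiset σ)) (by simp),
      smul_monomial, smul_eq_mul, mul_one]
    exact (coeffNorm_add_le _ _).trans (add_le_add (coeffNorm_monomial_le _ _) ih)

theorem degree_of_mem_support_eval_X {f : Expansion σ} {N : ℕ}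
    (hf : ∀ t ∈ f, t.2.length + 1 = N) {γ : σ →₀ ℕ}
    (hγ : γ ∈ (f.eval (X : σ → MvPolynomial σ ℂ)).support) : γ.degree + 1 = N := by
  classical
  induction f with
  | nil => simp at hγ
  | cons t f ih =>
    rw [eval_cons, wordProd_X (α := Multiset.toFinsupp (t.2 : Multiset σ)) (by simp),
      smul_monomial] at hγ
    rcases Finset.mem_union.1 (support_add hγ) with h | h
    · rw [Finset.mem_singleton.1 (support_monomial_subset h), ← card_toMultiset_eq_degree]
      simpa using hf t (by simp)
    · exact ih (fun t ht => hf t (by simp [ht])) h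

end Expansion

end Words

/-! ### Poisson brackets -/

section Brackets

/-- A bracket satisfying the Leibniz rule in both arguments. The factors are kept in order, so
that commutators qualify. -/
structure IsBiderivation {𝒜 : Type*} [Ring 𝒜] (B : 𝒜 → 𝒜 → 𝒜) : Prop where
  mul_left : ∀ a a' b, B (a * a') b = B a b * a' + a * B a' b
  mul_right : ∀ a b b', B a (b * b') = B a b * b' + b * B a b'

namespace IsBiderivation

variable {𝒜 : Type*} [Ring 𝒜] {B : 𝒜 → 𝒜 → 𝒜}

theorem one_left (hB : IsBiderivation B) (b : 𝒜) : B 1 b = 0 := by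
  simpa using hB.mul_left 1 1 b

theorem one_right (hB : IsBiderivation B) (a : 𝒜) : B a 1 = 0 := by
  simpa using hB.mul_right a 1 1

end IsBiderivation

variable {X : Type*} [DecidableEq X]

/-- The Poisson bracket `{M_i(x), M_j(y)} = i δ(x, y) ∑_k ε̃_{ijk} M_k(x)` as an expansion. -/
noncomputable def letterBracket (p q : Idx × X) : Expansion (Idx × X) :=
  if p.2 = q.2 then
    [Idx.plus, Idx.z, Idx.minus].map fun k => (Complex.I * (eps p.1 q.1 k : ℂ), [(k, p.2)])
  else []

theorem sum_idx {M : Type*} [AddCommMonoid M] (f : Idx → M) :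
    ∑ i, f i = f Idx.plus + (f Idx.z + f Idx.minus) := by
  have huniv : (Finset.univ : Finset Idx) = {Idx.plus, Idx.z, Idx.minus} := rfl
  rw [huniv, Finset.sum_insert (by decide), Finset.sum_insert (by decide), Finset.sum_singleton]

theorem eval_letterBracket {𝒜 : Type*} [Ring 𝒜] [Algebra ℂ 𝒜] (S : Idx × X → 𝒜) (p q : Idx × X) :
    (letterBracket p q).eval S =
      if p.2 = q.2 then ∑ k, (Complex.I * (eps p.1 q.1 k : ℂ)) • S (k, p.2) else 0 := by
  rw [sum_idx, letterBracket]
  split_ifs <;> simp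

/-- The Leibniz expansion of the bracket of a letter with a word. -/
noncomputable def letterWordBracket (p : Idx × X) : List (Idx × X) → Expansion (Idx × X)
  | [] => []
  | q :: w => (letterBracket p q).sandwich [] w ++ (letterWordBracket p w).sandwich [q] []

/-- The Leibniz expansion of the bracket of two words. -/
noncomputable def wordBracket : List (Idx × X) → List (Idx × X) → Expansion (Idx × X)
  | [], _ => []
  | p :: u, w => (letterWordBracket p w).sandwich [] u ++ (wordBracket u w).sandwich [p] []

section Eval

variable {𝒜 : Type*} [Ring 𝒜] [Algebra ℂ 𝒜] {S : Idx × X → 𝒜} {B : 𝒜 → 𝒜 → 𝒜}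

theorem eval_letterWordBracket (hB : IsBiderivation B)
    (hS : ∀ p q, B (S p) (S q) = (letterBracket p q).eval S) (p : Idx × X) (w : List (Idx × X)) :
    (letterWordBracket p w).eval S = B (S p) (wordProd S w) := by
  induction w with
  | nil => simp [letterWordBracket, hB.one_right]
  | cons q w ih => simp [letterWordBracket, ih, ← hS, hB.mul_right]

theorem eval_wordBracket (hB : IsBiderivation B)
    (hS : ∀ p q, B (S p) (S q) = (letterBracket p q).eval S) (u w : List (Idx × X)) :
    (wordBracket u w).eval S = B (wordProd S u) (wordProd S w) := by
  induction u with
  | nil => simp [wordBracket, hB.one_left]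
  | cons p u ih => simp [wordBracket, ih, eval_letterWordBracket hB hS, hB.mul_left]

end Eval

theorem size_letterBracket_le (p q : Idx × X) :
    (letterBracket p q).size ≤ if p.2 = q.2 then 1 else 0 := by
  obtain ⟨i, x⟩ := p
  obtain ⟨j, y⟩ := q
  simp only [letterBracket]
  split_ifs
  · cases i <;> cases j <;> simp [eps]
  · simp

theorem size_letterWordBracket_le (p : Idx × X) (w : List (Idx × X)) :
    (letterWordBracket p w).size ≤ (w.map fun q => if p.2 = q.2 then (1 : ℝ) else 0).sum := by
  induction w with
  | nil => simp [letterWordBracket]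
  | cons q w ih =>
    simpa [letterWordBracket] using add_le_add (size_letterBracket_le p q) ih

theorem size_wordBracket_le (u w : List (Idx × X)) :
    (wordBracket u w).size ≤
      (u.map fun p => (w.map fun q => if p.2 = q.2 then (1 : ℝ) else 0).sum).sum := by
  induction u with
  | nil => simp [wordBracket]
  | cons p u ih =>
    simpa [wordBracket] using add_le_add (size_letterWordBracket_le p w) ih

theorem length_of_mem_letterBracket {p q : Idx × X} {t : ℂ × List (Idx × X)}
    (ht : t ∈ letterBracket p q) : t.2.length = 1 := by
  simp only [letterBracket] at ht
  split_ifs at ht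
  · obtain ⟨k, -, rfl⟩ := List.mem_map.1 ht
    rfl
  · simp at ht

theorem length_of_mem_letterWordBracket {p : Idx × X} {w : List (Idx × X)}
    {t : ℂ × List (Idx × X)} (ht : t ∈ letterWordBracket p w) : t.2.length = w.length := by
  induction w generalizing t with
  | nil => simp [letterWordBracket] at ht
  | cons q w ih =>
    rcases List.mem_append.1 ht with ht | ht <;>
      obtain ⟨t', ht', hlen⟩ := Expansion.exists_length_eq_of_mem_sandwich ht
    · simp [hlen, length_of_mem_letterBracket ht', add_comm]
    · simp [hlen, ih ht', add_comm]

theorem length_of_mem_wordBracket {u w : List (Idx × X)} {t : ℂ × List (Idx × X)}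
    (ht : t ∈ wordBracket u w) : t.2.length + 1 = u.length + w.length := by
  induction u generalizing t with
  | nil => simp [wordBracket] at ht
  | cons p u ih =>
    rcases List.mem_append.1 ht with ht | ht <;>
      obtain ⟨t', ht', hlen⟩ := Expansion.exists_length_eq_of_mem_sandwich ht
    · have := length_of_mem_letterWordBracket ht'
      simp only [hlen, List.length_nil, List.length_cons]
      omega
    · have := ih ht'
      simp only [hlen, List.length_nil, List.length_cons]
      omega

/-- `∑_x |β(x)| |α(x)|`, which bounds the coefficients of `{M^β, M^α}`. -/
def overlap {X : Type*} [Fintype X] (β α : MultiIndex X) : ℕ :=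
  ∑ x, siteDegree β x * siteDegree α x

theorem overlap_le {X : Type*} [Fintype X] (β α : MultiIndex X) :
    overlap β α ≤ β.degree * α.degree := by
  rw [← sum_siteDegree α, Finset.mul_sum]
  exact Finset.sum_le_sum fun x _ => Nat.mul_le_mul_right _ (siteDegree_le_degree β x)

theorem overlap_le_degree_mul_exp {X : Type*} [Fintype X] (β α : MultiIndex X) :
    (overlap β α : ℝ) ≤ α.degree * Real.exp β.degree := by
  calc (overlap β α : ℝ)
      ≤ α.degree * β.degree := by exact_mod_cast (overlap_le β α).trans_eq (mul_comm _ _)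
    _ ≤ α.degree * Real.exp β.degree := by
        gcongr
        linarith [Real.add_one_le_exp (β.degree : ℝ)]

variable [Fintype X]

/-- The Poisson bracket of two polynomials. -/
noncomputable def poisson (A B : MvPolynomial (Idx × X) ℂ) : MvPolynomial (Idx × X) ℂ :=
  ∑ p, ∑ q, pderiv p A * pderiv q B * (letterBracket p q).eval MvPolynomial.X

/-- The Poisson bracket `{M^β, M^α}`. -/
noncomputable def monomialBracket (β α : MultiIndex X) : MvPolynomial (Idx × X) ℂ :=
  poisson (monomial β 1) (monomial α 1)

theorem isBiderivation_poisson :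
    IsBiderivation (poisson : MvPolynomial (Idx × X) ℂ → MvPolynomial (Idx × X) ℂ → _) := by
  constructor <;>
  · intro a b c
    simp only [poisson, Derivation.leibniz, smul_eq_mul, Finset.sum_mul, Finset.mul_sum,
      ← Finset.sum_add_distrib]
    refine Finset.sum_congr rfl fun p _ => Finset.sum_congr rfl fun q _ => ?_
    ring

theorem poisson_X_right (A : MvPolynomial (Idx × X) ℂ) (q : Idx × X) :
    poisson A (MvPolynomial.X q) =
      ∑ p, pderiv p A * (letterBracket p q).eval MvPolynomial.X := by
  refine Finset.sum_congr rfl fun p _ => ?_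
  rw [Finset.sum_eq_single q (fun q' _ hq' => by rw [pderiv_X_of_ne hq'.symm]; simp) (by simp)]
  simp

theorem poisson_eq_sum_pderiv_mul (A B : MvPolynomial (Idx × X) ℂ) :
    poisson A B = ∑ q, pderiv q B * poisson A (MvPolynomial.X q) := by
  simp_rw [poisson_X_right, Finset.mul_sum]
  rw [poisson, Finset.sum_comm]
  refine Finset.sum_congr rfl fun q _ => Finset.sum_congr rfl fun p _ => ?_
  ring

theorem poisson_X_X (p q : Idx × X) :
    poisson (MvPolynomial.X p) (MvPolynomial.X q) = (letterBracket p q).eval MvPolynomial.X := by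
  rw [poisson_X_right, Finset.sum_eq_single p
    (fun p' _ hp' => by rw [pderiv_X_of_ne hp'.symm, zero_mul]) (by simp)]
  simp

theorem monomialBracket_eq_eval {u w : List (Idx × X)} {β α : MultiIndex X}
    (hu : (u : Multiset (Idx × X)) = β.toMultiset) (hw : (w : Multiset (Idx × X)) = α.toMultiset) :
    monomialBracket β α = (wordBracket u w).eval MvPolynomial.X := by
  rw [eval_wordBracket isBiderivation_poisson poisson_X_X, monomialBracket, wordProd_X hu,
    wordProd_X hw]

theorem size_wordBracket_le_overlap {u w : List (Idx × X)} {β α : MultiIndex X}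
    (hu : (u : Multiset (Idx × X)) = β.toMultiset) (hw : (w : Multiset (Idx × X)) = α.toMultiset) :
    (wordBracket u w).size ≤ overlap β α := by
  refine (size_wordBracket_le u w).trans_eq ?_
  rw [sum_map_of_coe_eq_toMultiset hu]
  simp only [sum_map_of_coe_eq_toMultiset hw, overlap, siteDegree, nsmul_eq_mul, mul_ite, mul_one,
    mul_zero, Fintype.sum_prod_type_right, Nat.cast_sum, Nat.cast_mul, Finset.sum_mul]
  refine Finset.sum_congr rfl fun x _ => Finset.sum_congr rfl fun i _ => ?_
  rw [Finset.sum_eq_single x (fun y _ hy => by simp [hy.symm]) (by simp)]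
  simp

theorem coeffNorm_monomialBracket_le (β α : MultiIndex X) :
    coeffNorm (monomialBracket β α) ≤ overlap β α := by
  have hβ := Multiset.coe_toList β.toMultiset
  have hα := Multiset.coe_toList α.toMultiset
  rw [monomialBracket_eq_eval hβ hα]
  exact (Expansion.coeffNorm_eval_X_le _).trans (size_wordBracket_le_overlap hβ hα)

theorem degree_of_mem_support_monomialBracket {β α γ : MultiIndex X}
    (hγ : γ ∈ (monomialBracket β α).support) : γ.degree + 1 = β.degree + α.degree := by
  have hβ := Multiset.coe_toList β.toMultiset
  have hα := Multiset.coe_toList α.toMultiset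
  rw [monomialBracket_eq_eval hβ hα] at hγ
  rw [← length_of_coe_eq_toMultiset hβ, ← length_of_coe_eq_toMultiset hα]
  exact Expansion.degree_of_mem_support_eval_X (fun t ht => length_of_mem_wordBracket ht) hγ

end Brackets

/-! ### Weighted norms with shrinking weights -/

section WeightedNorm

/-- A smooth approximation of `‖a‖`, which need not be differentiable where `a` vanishes. -/
noncomputable def smoothNorm (η : ℝ) (a : ℂ) : ℝ := √(‖a‖ ^ 2 + η ^ 2)

theorem norm_le_smoothNorm (η : ℝ) (a : ℂ) : ‖a‖ ≤ smoothNorm η a :=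
  Real.le_sqrt_of_sq_le (le_add_of_nonneg_right (sq_nonneg η))

theorem exists_hasDerivAt_smoothNorm {b : ℝ → ℂ} {b' : ℂ} {θ η : ℝ} (hη : 0 < η)
    (hb : HasDerivAt b b' θ) :
    ∃ y, HasDerivAt (fun θ => smoothNorm η (b θ)) y θ ∧ y ≤ ‖b'‖ := by
  refine ⟨_, (hb.norm_sq.add_const (η ^ 2)).sqrt (by positivity), ?_⟩
  rw [div_le_iff₀ (by positivity)]
  have hinner : inner ℝ (b θ) b' ≤ ‖b θ‖ * ‖b'‖ := real_inner_le_norm _ _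
  have hnorm : ‖b θ‖ ≤ √(‖b θ‖ ^ 2 + η ^ 2) := norm_le_smoothNorm η (b θ)
  nlinarith [norm_nonneg b']

variable {ι : Type*} [Fintype ι] {k : ι → ℕ} {b b' : ℝ → ι → ℂ} {ρ z₀ : ℝ}

theorem tendsto_sum_smoothNorm_mul (a : ι → ℂ) (w : ι → ℝ) :
    Tendsto (fun η => ∑ γ, smoothNorm η (a γ) * w γ) (𝓝[>] 0) (𝓝 (∑ γ, ‖a γ‖ * w γ)) := by
  refine (Continuous.tendsto' ?_ 0 _ ?_).mono_left nhdsWithin_le_nhds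
  · unfold smoothNorm
    fun_prop
  · simp [smoothNorm]

theorem sum_deriv_smoothNorm_mul_pow_nonpos {a : ι → ℂ} {u y : ι → ℝ} {η z : ℝ} (hρ : 0 ≤ ρ)
    (hz : 0 < z) (hy : ∀ γ, y γ ≤ u γ)
    (hcol : ∑ γ, u γ * z ^ (k γ + 1) ≤ ρ * ∑ γ, ‖a γ‖ * (k γ * z ^ k γ)) :
    ∑ γ, (y γ * z ^ k γ + smoothNorm η (a γ) * (k γ * z ^ (k γ - 1) * -ρ)) ≤ 0 := by
  refine nonpos_of_mul_nonpos_left ?_ hz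
  have hterm : ∀ γ, (y γ * z ^ k γ + smoothNorm η (a γ) * (k γ * z ^ (k γ - 1) * -ρ)) * z ≤
      u γ * z ^ (k γ + 1) - ρ * (‖a γ‖ * (k γ * z ^ k γ)) := fun γ => by
    have hpow : (k γ : ℝ) * z ^ (k γ - 1) * z = k γ * z ^ k γ := by
      rcases Nat.eq_zero_or_pos (k γ) with h | h
      · simp [h]
      · rw [mul_assoc, pow_sub_one_mul h.ne']
    calc _ = y γ * z ^ (k γ + 1) -
          ρ * (smoothNorm η (a γ) * (k γ * z ^ (k γ - 1) * z)) := by ring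
      _ ≤ _ := by
        rw [hpow]
        gcongr
        exacts [hy γ, norm_le_smoothNorm η (a γ)]
  rw [Finset.sum_mul]
  calc _ ≤ ∑ γ, (u γ * z ^ (k γ + 1) - ρ * (‖a γ‖ * (k γ * z ^ k γ))) :=
        Finset.sum_le_sum fun γ _ => hterm γ
    _ ≤ 0 := by
        rw [Finset.sum_sub_distrib, ← Finset.mul_sum]
        exact sub_nonpos.2 hcol

theorem antitoneOn_sum_smoothNorm_mul_pow
    (hb : ∀ θ γ, HasDerivAt (fun θ => b θ γ) (b' θ γ) θ) (hρ : 0 ≤ ρ) (hz : ρ < z₀)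
    (hcol : ∀ θ, ∀ z ∈ Ioc 0 z₀,
      ∑ γ, ‖b' θ γ‖ * z ^ (k γ + 1) ≤ ρ * ∑ γ, ‖b θ γ‖ * (k γ * z ^ k γ)) {η : ℝ} (hη : 0 < η) :
    AntitoneOn (fun θ => ∑ γ, smoothNorm η (b θ γ) * (z₀ - ρ * θ) ^ k γ) (Icc 0 1) := by
  choose y hy hyle using fun θ γ => exists_hasDerivAt_smoothNorm hη (hb θ γ)
  have hweight : ∀ θ, HasDerivAt (fun θ => z₀ - ρ * θ) (-ρ) θ := fun θ => by
    simpa using ((hasDerivAt_id θ).const_mul ρ).const_sub z₀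
  have hsum := fun θ => HasDerivAt.fun_sum fun γ (_ : γ ∈ Finset.univ) =>
    (hy θ γ).fun_mul ((hweight θ).fun_pow (k γ))
  refine antitoneOn_of_deriv_nonpos (convex_Icc 0 1)
    (fun θ _ => (hsum θ).continuousAt.continuousWithinAt)
    (fun θ _ => (hsum θ).differentiableAt.differentiableWithinAt) fun θ hθ => ?_
  rw [interior_Icc] at hθ
  have hpos : 0 < z₀ - ρ * θ := by nlinarith [hθ.2]
  have hle : z₀ - ρ * θ ≤ z₀ := sub_le_self _ (mul_nonneg hρ hθ.1.le)
  rw [(hsum θ).deriv]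
  exact sum_deriv_smoothNorm_mul_pow_nonpos hρ hpos (hyle θ) (hcol θ _ ⟨hpos, hle⟩)

/- The hypothesis `hcol` loses one factor `k γ`, i.e. one derivative in the weight `z`; the
shrinking of the weight at rate `ρ` provides exactly this derivative with the opposite sign. -/
theorem sum_norm_mul_sub_pow_le
    (hb : ∀ θ γ, HasDerivAt (fun θ => b θ γ) (b' θ γ) θ) (hρ : 0 ≤ ρ) (hz : ρ < z₀)
    (hcol : ∀ θ, ∀ z ∈ Ioc 0 z₀,
      ∑ γ, ‖b' θ γ‖ * z ^ (k γ + 1) ≤ ρ * ∑ γ, ‖b θ γ‖ * (k γ * z ^ k γ))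
    {θ : ℝ} (hθ : θ ∈ Icc (0 : ℝ) 1) :
    ∑ γ, ‖b θ γ‖ * (z₀ - ρ * θ) ^ k γ ≤ ∑ γ, ‖b 0 γ‖ * z₀ ^ k γ := by
  refine le_of_tendsto_of_tendsto (tendsto_sum_smoothNorm_mul _ _)
    (tendsto_sum_smoothNorm_mul _ _) (eventually_mem_nhdsWithin.mono fun η hη => ?_)
  simpa using antitoneOn_sum_smoothNorm_mul_pow hb hρ hz hcol hη
    (left_mem_Icc.2 zero_le_one) hθ hθ.1

end WeightedNorm

/-! ### The Liouville operator -/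

section Liouville

variable {X : Type*} [Fintype X] {W : ℝ → MultiIndex X → ℂ} {v : ℕ → ℝ}

theorem IsBoundedPotential.hasSum_overlap_le (hW : IsBoundedPotential W v)
    (α : MultiIndex X) (t : ℝ) :
    ∃ a ≤ (α.degree : ℝ) * ∑' n, v n,
      HasSum (fun β => ‖W t β‖ * overlap β α * Real.exp β.degree) a := by
  refine ⟨∑ x, (siteDegree α x : ℝ) *
    ∑' β, (siteDegree β x : ℝ) * ‖W t β‖ * Real.exp β.degree, ?_, ?_⟩
  · rw [← sum_siteDegree, Nat.cast_sum, Finset.sum_mul]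
    exact Finset.sum_le_sum fun x _ =>
      mul_le_mul_of_nonneg_left (hW.tsum_site_le x t) (Nat.cast_nonneg _)
  · refine (hasSum_sum fun x (_ : x ∈ Finset.univ) =>
      (hW.summable_site x t).hasSum.mul_left (siteDegree α x : ℝ)).congr_fun fun β => ?_
    rw [overlap, Nat.cast_sum, Finset.mul_sum, Finset.sum_mul]
    refine Finset.sum_congr rfl fun x _ => ?_
    push_cast
    ring

variable [DecidableEq X]

/-- The matrix element `({H(t), M^α})_γ` of the Liouville operator of the Hamilton function
`H(t) = ∑_β W(t, β) M^β`. -/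
noncomputable def liouville (W : ℝ → MultiIndex X → ℂ) (t : ℝ) (γ α : MultiIndex X) : ℂ :=
  ∑' β, W t β • (monomialBracket β α).coeff γ

theorem norm_coeff_monomialBracket_le (β α γ : MultiIndex X) :
    ‖(monomialBracket β α).coeff γ‖ ≤ α.degree * Real.exp β.degree :=
  (norm_coeff_le_coeffNorm _ _).trans
    ((coeffNorm_monomialBracket_le β α).trans (overlap_le_degree_mul_exp β α))

theorem continuous_liouville (hW : IsBoundedPotential W v) (γ α : MultiIndex X) :
    Continuous fun t => liouville W t γ α :=
  hW.continuous_tsum_smul fun β => norm_coeff_monomialBracket_le β α γ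

theorem hasSum_liouville (hW : IsBoundedPotential W v) (t : ℝ) (γ α : MultiIndex X) :
    HasSum (fun β => W t β • (monomialBracket β α).coeff γ) (liouville W t γ α) :=
  (hW.summable_smul (fun β => norm_coeff_monomialBracket_le β α γ) t).hasSum

theorem sum_coeff_monomialBracket_mul_pow_le (β α : MultiIndex X) (s : Finset (MultiIndex X))
    {z : ℝ} (hz : 0 ≤ z) :
    ∑ γ ∈ s, ‖(monomialBracket β α).coeff γ‖ * z ^ (γ.degree + 1) ≤
      overlap β α * z ^ (β.degree + α.degree) := by
  have hterm : ∀ γ, ‖(monomialBracket β α).coeff γ‖ * z ^ (γ.degree + 1) =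
      ‖(monomialBracket β α).coeff γ‖ * z ^ (β.degree + α.degree) := fun γ => by
    by_cases hγ : γ ∈ (monomialBracket β α).support
    · rw [degree_of_mem_support_monomialBracket hγ]
    · rw [notMem_support_iff.1 hγ, norm_zero, zero_mul, zero_mul]
  simp only [hterm, ← Finset.sum_mul]
  refine mul_le_mul_of_nonneg_right ?_ (pow_nonneg hz _)
  exact (sum_norm_coeff_le_coeffNorm _ s).trans (coeffNorm_monomialBracket_le β α)

theorem sum_norm_liouville_mul_pow_le (hW : IsBoundedPotential W v) (t : ℝ) (α : MultiIndex X)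
    (s : Finset (MultiIndex X)) {z : ℝ} (hz : z ∈ Icc 0 (Real.exp 1)) :
    ∑ γ ∈ s, ‖liouville W t γ α‖ * z ^ (γ.degree + 1) ≤
      (∑' n, v n) * (α.degree * z ^ α.degree) := by
  obtain ⟨a, ha, hsum⟩ := hW.hasSum_overlap_le α t
  have hpow (n : ℕ) : 0 ≤ z ^ n := pow_nonneg hz.1 n
  have hnorm : ∀ γ, Summable fun β => ‖W t β • (monomialBracket β α).coeff γ‖ := fun γ =>
    hW.summable_norm_smul (fun β => norm_coeff_monomialBracket_le β α γ) t
  have hterm : ∀ β, ∑ γ ∈ s, ‖W t β • (monomialBracket β α).coeff γ‖ * z ^ (γ.degree + 1) ≤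
      ‖W t β‖ * overlap β α * Real.exp β.degree * z ^ α.degree := fun β => by
    simp only [norm_smul, mul_assoc, ← Finset.mul_sum]
    refine mul_le_mul_of_nonneg_left ?_ (norm_nonneg _)
    refine (sum_coeff_monomialBracket_mul_pow_le β α s hz.1).trans ?_
    rw [pow_add, ← Real.exp_one_pow]
    exact mul_le_mul_of_nonneg_left (mul_le_mul_of_nonneg_right
      (pow_le_pow_left₀ hz.1 hz.2 _) (hpow _)) (Nat.cast_nonneg _)
  calc ∑ γ ∈ s, ‖liouville W t γ α‖ * z ^ (γ.degree + 1)
      ≤ ∑ γ ∈ s, (∑' β, ‖W t β • (monomialBracket β α).coeff γ‖) * z ^ (γ.degree + 1) :=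
        Finset.sum_le_sum fun γ _ =>
          mul_le_mul_of_nonneg_right (norm_tsum_le_tsum_norm (hnorm γ)) (hpow _)
    _ ≤ a * z ^ α.degree :=
        hasSum_le hterm (hasSum_sum fun γ _ => (hnorm γ).hasSum.mul_right _)
          (hsum.mul_right (z ^ α.degree))
    _ ≤ (α.degree * ∑' n, v n) * z ^ α.degree := mul_le_mul_of_nonneg_right ha (hpow _)
    _ = (∑' n, v n) * (α.degree * z ^ α.degree) := by ring

end Liouville

/-! ### Approximate Liouville flows -/

section Flow

/-- A family `m(t)` of values of the monomials that evolves by the Liouville equation of `W`, up to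
an error of size `δ` in each commutator. Both the classical monomials (with `δ = 0`) and the
quantized ones in the Heisenberg picture (with `δ` of order `1 / s`) are of this kind. The bounds
`3 / 2` and `2` on the growth per degree only need to be smaller than `e`. -/
structure IsApproxFlow {X : Type*} [Fintype X] [DecidableEq X] {E : Type*} [NormedAddCommGroup E]
    [NormedSpace ℂ E] (W : ℝ → MultiIndex X → ℂ) (δ : ℝ) (m : ℝ → MultiIndex X → E) : Prop where
  norm_le : ∀ t γ, ‖m t γ‖ ≤ (3 / 2 : ℝ) ^ γ.degree
  exists_deriv : ∃ D : ℝ → MultiIndex X → MultiIndex X → E,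
    (∀ t α, HasDerivAt (fun t => m t α) (∑' β, W t β • D t β α) t) ∧
    ∀ t β α, ‖D t β α - observe (m t) (monomialBracket β α)‖ ≤
      δ * (overlap β α * 2 ^ (β.degree + α.degree))

variable {X : Type*}

/-- The multi-indices of degree at most `D`, to which the Liouville operator is truncated in order
to obtain a linear differential equation in finite dimension. -/
abbrev BoundedIndex (X : Type*) (D : ℕ) := {γ : MultiIndex X // γ.degree ≤ D}

noncomputable instance [Finite X] (D : ℕ) : Fintype (BoundedIndex X D) :=
  have : Finite (BoundedIndex X D) := (Finsupp.finite_of_degree_le D).to_subtype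
  Fintype.ofFinite _

section

variable {E : Type*} [NormedAddCommGroup E] [NormedSpace ℂ E] {m : MultiIndex X → E}

theorem observe_sub_sum_boundedIndex [Finite X] (m : MultiIndex X → E)
    (A : MvPolynomial (Idx × X) ℂ) (D : ℕ) :
    observe m A - ∑ γ : BoundedIndex X D, A.coeff γ.1 • m γ.1 =
      ∑ γ ∈ A.support with D < γ.degree, A.coeff γ • m γ := by
  classical
  have hsum : ∑ γ ∈ A.support with γ.degree ≤ D, A.coeff γ • m γ =
      ∑ γ : BoundedIndex X D, A.coeff γ.1 • m γ.1 := by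
    rw [← Finset.sum_subtype (Finsupp.finite_of_degree_le (σ := Idx × X) D).toFinset
      (by simp) fun γ => A.coeff γ • m γ]
    refine Finset.sum_subset (fun γ hγ => by simpa using (Finset.mem_filter.1 hγ).2)
      fun γ hγ hγ' => ?_
    have hdegree : γ.degree ≤ D := by simpa using hγ
    have hsupport : γ ∉ A.support := fun h => hγ' (Finset.mem_filter.2 ⟨h, hdegree⟩)
    rw [notMem_support_iff.1 hsupport, zero_smul]
  rw [observe_apply, ← hsum, ← Finset.sum_filter_add_sum_filter_not A.support
    (fun γ => γ.degree ≤ D), add_sub_cancel_left]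
  simp only [not_le]

theorem three_halves_pow_le {k D N : ℕ} (hD : D ≤ k) (hN : k ≤ N) :
    (3 / 2 : ℝ) ^ k ≤ (3 / 4) ^ D * 2 ^ N := by
  calc (3 / 2 : ℝ) ^ k = (3 / 4) ^ k * 2 ^ k := by
        rw [← mul_pow]
        norm_num
    _ ≤ (3 / 4) ^ D * 2 ^ N := mul_le_mul (pow_le_pow_of_le_one (by norm_num) (by norm_num) hD)
        (pow_le_pow_right₀ one_le_two hN) (by positivity) (by positivity)

theorem norm_observe_sub_sum_boundedIndex_le [Finite X]
    (hm : ∀ γ, ‖m γ‖ ≤ (3 / 2 : ℝ) ^ γ.degree) {A : MvPolynomial (Idx × X) ℂ} {N : ℕ}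
    (hA : ∀ γ ∈ A.support, γ.degree ≤ N) (D : ℕ) :
    ‖observe m A - ∑ γ : BoundedIndex X D, A.coeff γ.1 • m γ.1‖ ≤
      (3 / 4 : ℝ) ^ D * 2 ^ N * coeffNorm A := by
  rw [observe_sub_sum_boundedIndex, coeffNorm, Finset.mul_sum]
  calc ‖∑ γ ∈ A.support with D < γ.degree, A.coeff γ • m γ‖
      ≤ ∑ γ ∈ A.support with D < γ.degree, (3 / 4 : ℝ) ^ D * 2 ^ N * ‖A.coeff γ‖ :=
        norm_sum_le_of_le _ fun γ hγ => by
          obtain ⟨hsupport, hdegree⟩ := Finset.mem_filter.1 hγ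
          rw [norm_smul, mul_comm]
          exact mul_le_mul_of_nonneg_right ((hm γ).trans
            (three_halves_pow_le hdegree.le (hA γ hsupport))) (norm_nonneg _)
    _ ≤ ∑ γ ∈ A.support, (3 / 4 : ℝ) ^ D * 2 ^ N * ‖A.coeff γ‖ :=
        Finset.sum_le_sum_of_subset_of_nonneg (Finset.filter_subset _ _) fun _ _ _ => by positivity

end

variable [Fintype X] [DecidableEq X] {W : ℝ → MultiIndex X → ℂ} {v : ℕ → ℝ}

theorem exists_truncated_flow (hW : IsBoundedPotential W v) (D : ℕ) (t₁ σ : ℝ)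
    (b₀ : BoundedIndex X D → ℂ) :
    ∃ b : ℝ → BoundedIndex X D → ℂ, b 0 = b₀ ∧ ∀ θ γ, HasDerivAt (fun θ => b θ γ)
      (-(σ : ℂ) * ∑ α : BoundedIndex X D, liouville W (t₁ + θ * σ) γ.1 α.1 * b θ α) θ := by
  set A : ℝ → (BoundedIndex X D → ℂ) →L[ℝ] BoundedIndex X D → ℂ := fun θ =>
    ContinuousLinearMap.pi fun γ => (-(σ : ℂ)) • ∑ α : BoundedIndex X D,
      liouville W (t₁ + θ * σ) γ.1 α.1 • ContinuousLinearMap.proj α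
  have happly : ∀ θ b γ, A θ b γ =
      -(σ : ℂ) * ∑ α : BoundedIndex X D, liouville W (t₁ + θ * σ) γ.1 α.1 * b α := fun θ b γ => by
    simp [A]
  have hA : Continuous A := by
    refine continuous_clm_apply.2 fun b => continuous_pi fun γ => ?_
    simp only [happly]
    exact continuous_const.mul (continuous_finsetSum _ fun α _ =>
      ((continuous_liouville hW γ.1 α.1).comp (by fun_prop)).mul continuous_const)
  obtain ⟨b, hb0, hb⟩ := exists_linear_solution hA 0 b₀
  exact ⟨b, hb0, fun θ γ => happly θ (b θ) γ ▸ hasDerivAt_pi.1 (hb θ) γ⟩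

section

variable {E : Type*} [NormedAddCommGroup E] [NormedSpace ℂ E] {m : MultiIndex X → E} {δ : ℝ}

theorem norm_sub_sum_monomialBracket_le (hm : ∀ γ, ‖m γ‖ ≤ (3 / 2 : ℝ) ^ γ.degree)
    {α β : MultiIndex X} {F : E} (hF : ‖F - observe m (monomialBracket β α)‖ ≤
      δ * (overlap β α * 2 ^ (β.degree + α.degree))) (D : ℕ) :
    ‖F - ∑ γ : BoundedIndex X D, (monomialBracket β α).coeff γ.1 • m γ.1‖ ≤
      (δ + (3 / 4) ^ D) * (overlap β α * 2 ^ (β.degree + α.degree)) := by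
  calc _ ≤ ‖F - observe m (monomialBracket β α)‖ + ‖observe m (monomialBracket β α) -
          ∑ γ : BoundedIndex X D, (monomialBracket β α).coeff γ.1 • m γ.1‖ :=
        norm_sub_le_norm_sub_add_norm_sub _ _ _
    _ ≤ δ * (overlap β α * 2 ^ (β.degree + α.degree)) +
          (3 / 4) ^ D * 2 ^ (β.degree + α.degree) * overlap β α := by
        refine add_le_add hF ((norm_observe_sub_sum_boundedIndex_le hm (fun γ hγ =>
          (Nat.le_succ _).trans (degree_of_mem_support_monomialBracket hγ).le) D).trans ?_)
        exact mul_le_mul_of_nonneg_left (coeffNorm_monomialBracket_le β α) (by positivity)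
    _ = _ := by ring

theorem norm_tsum_sub_liouville_le [CompleteSpace E] (hW : IsBoundedPotential W v) (hδ : 0 ≤ δ)
    (hm : ∀ γ, ‖m γ‖ ≤ (3 / 2 : ℝ) ^ γ.degree) {t : ℝ} {α : MultiIndex X} {F : MultiIndex X → E}
    (hF : ∀ β, ‖F β - observe m (monomialBracket β α)‖ ≤
      δ * (overlap β α * 2 ^ (β.degree + α.degree))) (D : ℕ) :
    ‖∑' β, W t β • F β - ∑ γ : BoundedIndex X D, liouville W t γ.1 α • m γ.1‖ ≤
      (δ + (3 / 4) ^ D) * ((∑' n, v n) * (α.degree * 2 ^ α.degree)) := by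
  obtain ⟨a, ha, hoverlap⟩ := hW.hasSum_overlap_le α t
  set G : MultiIndex X → E := fun β =>
    ∑ γ : BoundedIndex X D, (monomialBracket β α).coeff γ.1 • m γ.1
  have hG : HasSum (fun β => W t β • G β)
      (∑ γ : BoundedIndex X D, liouville W t γ.1 α • m γ.1) := by
    simp_rw [G, Finset.smul_sum, ← smul_assoc]
    exact hasSum_sum fun γ _ => (hasSum_liouville hW t γ.1 α).smul_const _
  have hdiff : ∀ β, ‖W t β • (F β - G β)‖ ≤
      (δ + (3 / 4) ^ D) * 2 ^ α.degree * (‖W t β‖ * overlap β α * Real.exp β.degree) := fun β => by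
    calc ‖W t β • (F β - G β)‖
        ≤ ‖W t β‖ * ((δ + (3 / 4) ^ D) * (overlap β α * 2 ^ (β.degree + α.degree))) := by
          rw [norm_smul]
          exact mul_le_mul_of_nonneg_left (norm_sub_sum_monomialBracket_le hm (hF β) D)
            (norm_nonneg _)
      _ = (δ + (3 / 4) ^ D) * 2 ^ α.degree * (‖W t β‖ * overlap β α * 2 ^ β.degree) := by ring
      _ ≤ _ := by
          rw [← Real.exp_one_pow]
          gcongr
          linarith [Real.exp_one_gt_d9]
  have hFG : HasSum (fun β => W t β • (F β - G β)) (∑' β, W t β • (F β - G β)) :=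
    (Summable.of_norm_bounded (hoverlap.summable.mul_left _) hdiff).hasSum
  have hsplit : ∑' β, W t β • F β - ∑ γ : BoundedIndex X D, liouville W t γ.1 α • m γ.1 =
      ∑' β, W t β • (F β - G β) := by
    rw [sub_eq_iff_eq_add, ← (hFG.add hG).tsum_eq]
    simp only [← smul_add, sub_add_cancel]
  rw [hsplit]
  calc _ ≤ (δ + (3 / 4) ^ D) * 2 ^ α.degree * a :=
        tsum_of_norm_bounded (hoverlap.mul_left _) hdiff
    _ ≤ (δ + (3 / 4) ^ D) * 2 ^ α.degree * (α.degree * ∑' n, v n) :=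
        mul_le_mul_of_nonneg_left ha (by positivity)
    _ = _ := by ring

end

end Flow

/-! ### Transport of observables along approximate flows -/

section Transport

universe u

section

variable {X : Type*} [Finite X] {D : ℕ}

theorem observe_eq_sum_boundedIndex {E : Type*} [NormedAddCommGroup E] [NormedSpace ℂ E]
    (m : MultiIndex X → E) {A : MvPolynomial (Idx × X) ℂ} (hA : ∀ γ ∈ A.support, γ.degree ≤ D) :
    observe m A = ∑ γ : BoundedIndex X D, A.coeff γ.1 • m γ.1 := by
  rw [← sub_eq_zero, observe_sub_sum_boundedIndex, Finset.filter_false_of_mem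
    fun γ hγ => not_lt.2 (hA γ hγ), Finset.sum_empty]

theorem sum_norm_coeff_boundedIndex_mul_exp_pow_le {A : MvPolynomial (Idx × X) ℂ} {d : ℕ}
    (hA : ∀ γ ∈ A.support, γ.degree ≤ d) :
    ∑ γ : BoundedIndex X D, ‖A.coeff γ.1‖ * Real.exp 1 ^ γ.1.degree ≤
      Real.exp d * coeffNorm A := by
  have hterm : ∀ γ, ‖A.coeff γ‖ * Real.exp 1 ^ γ.degree ≤ Real.exp d * ‖A.coeff γ‖ := fun γ => by
    by_cases hγ : γ ∈ A.support
    · rw [mul_comm, Real.exp_one_pow]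
      gcongr
      exact hA γ hγ
    · simp [notMem_support_iff.1 hγ]
  refine (Finset.sum_le_sum fun γ _ => hterm γ.1).trans ?_
  rw [← Finset.mul_sum, ← Finset.sum_subtype (Finsupp.finite_of_degree_le (σ := Idx × X) D).toFinset
    (by simp) fun γ => ‖A.coeff γ‖]
  exact mul_le_mul_of_nonneg_left (sum_norm_coeff_le_coeffNorm _ _) (Real.exp_pos _).le

end

theorem natCast_mul_two_pow_le (k : ℕ) : (k : ℝ) * 2 ^ k ≤ 4 * (5 / 2) ^ k := by
  induction k with
  | zero => simp
  | succ k ih =>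
    have hpow : (2 : ℝ) ^ k ≤ (5 / 2) ^ k := pow_le_pow_left₀ (by norm_num) (by norm_num) k
    rw [pow_succ, pow_succ, Nat.cast_succ]
    nlinarith

theorem sum_smul_smul_add_sum_mul_smul {ι E : Type*} [Fintype ι] [AddCommGroup E] [Module ℂ E]
    (A : ι → ι → ℂ) (σ : ℂ) (c : ι → ℂ) (x y : ι → E) :
    ∑ γ, (c γ • σ • x γ + (-σ * ∑ α, A γ α * c α) • y γ) =
      σ • ∑ α, c α • (x α - ∑ γ, A γ α • y γ) := by
  have hswap : ∑ γ, (∑ α, A γ α * c α) • y γ = ∑ α, c α • ∑ γ, A γ α • y γ := by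
    simp only [Finset.sum_smul, Finset.smul_sum, smul_smul]
    rw [Finset.sum_comm]
    simp only [mul_comm]
  simp only [smul_sub, Finset.sum_sub_distrib, neg_mul, neg_smul, mul_smul, ← Finset.smul_sum,
    hswap, ← sub_eq_add_neg]
  simp only [Finset.smul_sum, smul_comm σ]

section

variable {X : Type*} [Fintype X] [DecidableEq X] {W : ℝ → MultiIndex X → ℂ} {v : ℕ → ℝ} {D : ℕ}

theorem sum_norm_sum_liouville_mul_pow_le (hW : IsBoundedPotential W v) (t : ℝ)
    (c : BoundedIndex X D → ℂ) {z : ℝ} (hz : z ∈ Icc 0 (Real.exp 1)) :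
    ∑ γ : BoundedIndex X D, ‖∑ α : BoundedIndex X D, liouville W t γ.1 α.1 * c α‖ *
        z ^ (γ.1.degree + 1) ≤
      (∑' n, v n) * ∑ α, ‖c α‖ * (α.1.degree * z ^ α.1.degree) := by
  have hpow (n : ℕ) : 0 ≤ z ^ n := pow_nonneg hz.1 n
  have hcol : ∀ α : BoundedIndex X D, ∑ γ : BoundedIndex X D,
      ‖liouville W t γ.1 α.1‖ * z ^ (γ.1.degree + 1) ≤
        (∑' n, v n) * (α.1.degree * z ^ α.1.degree) := fun α => by
    rw [← Finset.sum_subtype (Finsupp.finite_of_degree_le (σ := Idx × X) D).toFinset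
      (by simp) fun γ => ‖liouville W t γ α.1‖ * z ^ (γ.degree + 1)]
    exact sum_norm_liouville_mul_pow_le hW t α.1 _ hz
  calc _ ≤ ∑ γ : BoundedIndex X D, ∑ α : BoundedIndex X D,
          ‖c α‖ * (‖liouville W t γ.1 α.1‖ * z ^ (γ.1.degree + 1)) := by
        refine Finset.sum_le_sum fun γ _ => ?_
        refine (mul_le_mul_of_nonneg_right (norm_sum_le _ _) (hpow _)).trans_eq ?_
        rw [Finset.sum_mul]
        exact Finset.sum_congr rfl fun α _ => by rw [norm_mul]; ring
    _ = ∑ α : BoundedIndex X D, ‖c α‖ * ∑ γ : BoundedIndex X D,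
          ‖liouville W t γ.1 α.1‖ * z ^ (γ.1.degree + 1) := by
        rw [Finset.sum_comm]
        simp only [Finset.mul_sum]
    _ ≤ ∑ α : BoundedIndex X D, ‖c α‖ * ((∑' n, v n) * (α.1.degree * z ^ α.1.degree)) :=
        Finset.sum_le_sum fun α _ => mul_le_mul_of_nonneg_left (hcol α) (norm_nonneg _)
    _ = _ := by
        rw [Finset.mul_sum]
        exact Finset.sum_congr rfl fun α _ => by ring

/- Over this time the weight shrinks from `e` to at least `e - 1 / 5 > 5 / 2`. -/
theorem exists_truncated_flow_sum_norm_mul_pow_le (hW : IsBoundedPotential W v) (t₁ σ : ℝ)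
    (hσ : |σ| * ∑' n, v n ≤ 1 / 5) (b₀ : BoundedIndex X D → ℂ) :
    ∃ b : ℝ → BoundedIndex X D → ℂ, b 0 = b₀ ∧ (∀ θ γ, HasDerivAt (fun θ => b θ γ)
      (-(σ : ℂ) * ∑ α : BoundedIndex X D, liouville W (t₁ + θ * σ) γ.1 α.1 * b θ α) θ) ∧
      ∀ θ ∈ Icc (0 : ℝ) 1, ∑ γ : BoundedIndex X D, ‖b θ γ‖ * (5 / 2 : ℝ) ^ γ.1.degree ≤
        ∑ γ : BoundedIndex X D, ‖b₀ γ‖ * Real.exp 1 ^ γ.1.degree := by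
  obtain ⟨b, hb0, hb⟩ := exists_truncated_flow hW D t₁ σ b₀
  have he : (27 / 10 : ℝ) < Real.exp 1 := by linarith [Real.exp_one_gt_d9]
  set ρ := |σ| * ∑' n, v n
  have hρ : 0 ≤ ρ := mul_nonneg (abs_nonneg _) hW.tsum_nonneg
  have hcol : ∀ θ, ∀ z ∈ Ioc 0 (Real.exp 1), ∑ γ : BoundedIndex X D, ‖-(σ : ℂ) *
      ∑ α : BoundedIndex X D, liouville W (t₁ + θ * σ) γ.1 α.1 * b θ α‖ * z ^ (γ.1.degree + 1) ≤
        ρ * ∑ γ, ‖b θ γ‖ * (γ.1.degree * z ^ γ.1.degree) := fun θ z hz => by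
    simp only [norm_mul, norm_neg, Complex.norm_real, Real.norm_eq_abs, mul_assoc |σ|,
      ← Finset.mul_sum, ρ]
    exact mul_le_mul_of_nonneg_left (sum_norm_sum_liouville_mul_pow_le hW _ _
      (Ioc_subset_Icc_self hz)) (abs_nonneg _)
  refine ⟨b, hb0, hb, fun θ hθ => ?_⟩
  calc ∑ γ : BoundedIndex X D, ‖b θ γ‖ * (5 / 2 : ℝ) ^ γ.1.degree
      ≤ ∑ γ : BoundedIndex X D, ‖b θ γ‖ * (Real.exp 1 - ρ * θ) ^ γ.1.degree := by
        gcongr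
        nlinarith [hθ.1, hθ.2]
    _ ≤ ∑ γ : BoundedIndex X D, ‖b 0 γ‖ * Real.exp 1 ^ γ.1.degree :=
        sum_norm_mul_sub_pow_le hb hρ (by linarith) hcol hθ
    _ = _ := by rw [hb0]

variable {E : Type*} [NormedAddCommGroup E] [NormedSpace ℂ E] [CompleteSpace E] {δ : ℝ}

theorem norm_sum_smul_tsum_sub_liouville_le (hW : IsBoundedPotential W v) (hδ : 0 ≤ δ)
    {m : MultiIndex X → E} (hm : ∀ γ, ‖m γ‖ ≤ (3 / 2 : ℝ) ^ γ.degree) {t : ℝ}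
    {F : MultiIndex X → MultiIndex X → E} (hF : ∀ β α,
      ‖F β α - observe m (monomialBracket β α)‖ ≤ δ * (overlap β α * 2 ^ (β.degree + α.degree)))
    {c : BoundedIndex X D → ℂ} {K : ℝ} (hc : ∑ α, ‖c α‖ * (5 / 2 : ℝ) ^ α.1.degree ≤ K) :
    ‖∑ α, c α • (∑' β, W t β • F β α.1 - ∑ γ : BoundedIndex X D, liouville W t γ.1 α.1 • m γ.1)‖ ≤
      (∑' n, v n) * (4 * K * (δ + (3 / 4) ^ D)) := by
  have hv := hW.tsum_nonneg
  calc _ ≤ ∑ α, (δ + (3 / 4) ^ D) * (∑' n, v n) * 4 * (‖c α‖ * (5 / 2 : ℝ) ^ α.1.degree) := by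
        refine norm_sum_le_of_le _ fun α _ => ?_
        rw [norm_smul]
        calc _ ≤ ‖c α‖ * ((δ + (3 / 4) ^ D) * ((∑' n, v n) * (4 * (5 / 2) ^ α.1.degree))) := by
              refine mul_le_mul_of_nonneg_left ((norm_tsum_sub_liouville_le hW hδ hm
                (fun β => hF β α.1) D).trans ?_) (norm_nonneg _)
              exact mul_le_mul_of_nonneg_left (mul_le_mul_of_nonneg_left
                (natCast_mul_two_pow_le _) hv) (by positivity)
          _ = _ := by ring
    _ ≤ (δ + (3 / 4) ^ D) * (∑' n, v n) * 4 * K := by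
        rw [← Finset.mul_sum]
        exact mul_le_mul_of_nonneg_left hc (by positivity)
    _ = _ := by ring

/- The flow of the coefficients is dual to that of the monomials, so that without truncation and
for `δ = 0` the sum `∑ b_γ m_γ` would be constant. -/
theorem norm_sum_smul_sub_sum_smul_le (hW : IsBoundedPotential W v) {t₁ σ : ℝ}
    (hσ : |σ| * ∑' n, v n ≤ 1) {b : ℝ → BoundedIndex X D → ℂ}
    (hb : ∀ θ γ, HasDerivAt (fun θ => b θ γ)
      (-(σ : ℂ) * ∑ α : BoundedIndex X D, liouville W (t₁ + θ * σ) γ.1 α.1 * b θ α) θ) {K : ℝ}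
    (hK : ∀ θ ∈ Icc (0 : ℝ) 1, ∑ γ : BoundedIndex X D, ‖b θ γ‖ * (5 / 2 : ℝ) ^ γ.1.degree ≤ K)
    {m : ℝ → MultiIndex X → E} (hδ : 0 ≤ δ) (hm : IsApproxFlow W δ m) :
    ‖∑ γ : BoundedIndex X D, b 0 γ • m t₁ γ.1 - ∑ γ : BoundedIndex X D, b 1 γ • m (t₁ + σ) γ.1‖ ≤
      4 * K * (δ + (3 / 4) ^ D) := by
  obtain ⟨F, hF, hFle⟩ := hm.exists_deriv
  have htime : ∀ θ : ℝ, HasDerivAt (fun θ : ℝ => t₁ + θ * σ) σ θ := fun θ => by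
    simpa using ((hasDerivAt_id θ).mul_const σ).const_add t₁
  have hderiv : ∀ θ, HasDerivAt (fun θ => ∑ γ : BoundedIndex X D, b θ γ • m (t₁ + θ * σ) γ.1)
      ((σ : ℂ) • ∑ α : BoundedIndex X D, b θ α •
        (∑' β, W (t₁ + θ * σ) β • F (t₁ + θ * σ) β α.1 -
          ∑ γ : BoundedIndex X D, liouville W (t₁ + θ * σ) γ.1 α.1 • m (t₁ + θ * σ) γ.1)) θ :=
    fun θ => by
      rw [← sum_smul_smul_add_sum_mul_smul
        (fun γ α : BoundedIndex X D => liouville W (t₁ + θ * σ) γ.1 α.1)]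
      exact HasDerivAt.fun_sum fun γ _ => (hb θ γ).smul (HasDerivAt.scomp
        (g₁ := fun t => m t γ.1) (h := fun θ => t₁ + θ * σ) θ (hF (t₁ + θ * σ) γ.1) (htime θ))
  have hderiv_le : ∀ θ ∈ Icc (0 : ℝ) 1, ‖(σ : ℂ) • ∑ α : BoundedIndex X D, b θ α •
      (∑' β, W (t₁ + θ * σ) β • F (t₁ + θ * σ) β α.1 - ∑ γ : BoundedIndex X D,
        liouville W (t₁ + θ * σ) γ.1 α.1 • m (t₁ + θ * σ) γ.1)‖ ≤
      4 * K * (δ + (3 / 4) ^ D) := fun θ hθ => by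
    have hK0 : 0 ≤ K := (Finset.sum_nonneg fun _ _ => by positivity).trans (hK θ hθ)
    rw [norm_smul, Complex.norm_real, Real.norm_eq_abs]
    calc _ ≤ |σ| * ((∑' n, v n) * (4 * K * (δ + (3 / 4) ^ D))) :=
          mul_le_mul_of_nonneg_left (norm_sum_smul_tsum_sub_liouville_le hW hδ (hm.norm_le _)
            (hFle _) (hK θ hθ)) (abs_nonneg _)
      _ = (|σ| * ∑' n, v n) * (4 * K * (δ + (3 / 4) ^ D)) := by ring
      _ ≤ _ := mul_le_of_le_one_left (by positivity) hσ
  simpa using (convex_Icc (0 : ℝ) 1).norm_image_sub_le_of_norm_hasDerivWithin_le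
    (fun θ _ => (hderiv θ).hasDerivWithinAt) hderiv_le (right_mem_Icc.2 zero_le_one)
    (left_mem_Icc.2 zero_le_one)

end

/-- The values of `B` at time `t₁` and of `B'` at time `t₀` agree up to `ε + C δ` along every
`δ`-approximate Liouville flow of `W`. -/
def Transports {X : Type u} [Fintype X] [DecidableEq X] (W : ℝ → MultiIndex X → ℂ)
    (t₁ t₀ ε C : ℝ) (B B' : MvPolynomial (Idx × X) ℂ) : Prop :=
  ∀ (E : Type u) [NormedAddCommGroup E] [NormedSpace ℂ E] [CompleteSpace E] (δ : ℝ)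
    (m : ℝ → MultiIndex X → E), 0 ≤ δ → IsApproxFlow W δ m →
      ‖observe (m t₁) B - observe (m t₀) B'‖ ≤ ε + C * δ

theorem Transports.trans {X : Type u} [Fintype X] [DecidableEq X] {W : ℝ → MultiIndex X → ℂ}
    {t₂ t₁ t₀ ε₁ ε₂ C₁ C₂ : ℝ} {B₂ B₁ B₀ : MvPolynomial (Idx × X) ℂ}
    (h₁ : Transports W t₂ t₁ ε₁ C₁ B₂ B₁) (h₂ : Transports W t₁ t₀ ε₂ C₂ B₁ B₀) :
    Transports W t₂ t₀ (ε₁ + ε₂) (C₁ + C₂) B₂ B₀ := fun E _ _ _ δ m hδ hm => by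
  calc _ ≤ (ε₁ + C₁ * δ) + (ε₂ + C₂ * δ) := (norm_sub_le_norm_sub_add_norm_sub _ _ _).trans
        (add_le_add (h₁ E δ m hδ hm) (h₂ E δ m hδ hm))
    _ = ε₁ + ε₂ + (C₁ + C₂) * δ := by ring

theorem exists_short_time_transport (d : ℕ) (K : ℝ) {ε : ℝ} (hε : 0 < ε) :
    ∃ (d' : ℕ) (K' C : ℝ), ∀ {X : Type u} [Fintype X] [DecidableEq X]
      {W : ℝ → MultiIndex X → ℂ} {v : ℕ → ℝ}, IsBoundedPotential W v →
      ∀ {t₁ t₀ : ℝ}, |t₀ - t₁| * ∑' n, v n ≤ 1 / 5 → ∀ {B : MvPolynomial (Idx × X) ℂ},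
      (∀ γ ∈ B.support, γ.degree ≤ d) → coeffNorm B ≤ K →
      ∃ B' : MvPolynomial (Idx × X) ℂ, (∀ γ ∈ B'.support, γ.degree ≤ d') ∧ coeffNorm B' ≤ K' ∧
        Transports W t₁ t₀ ε C B B' := by
  set K' := Real.exp d * K
  obtain ⟨D, hD, hdD⟩ : ∃ D : ℕ, 4 * K' * (3 / 4) ^ D < ε ∧ d ≤ D :=
    ((((tendsto_pow_atTop_nhds_zero_of_lt_one (by norm_num) (by norm_num)).const_mul
      (4 * K')).eventually_lt_const (by rwa [mul_zero])).and (eventually_ge_atTop d)).exists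
  refine ⟨D, K', 4 * K', fun {X} _ _ {W v} hW {t₁ t₀} ht {B} hBd hBK => ?_⟩
  obtain ⟨b, hb0, hb, hbound⟩ := exists_truncated_flow_sum_norm_mul_pow_le hW t₁ (t₀ - t₁) ht
    fun γ : BoundedIndex X D => B.coeff γ.1
  have hK' : ∀ θ ∈ Icc (0 : ℝ) 1, ∑ γ : BoundedIndex X D, ‖b θ γ‖ * (5 / 2 : ℝ) ^ γ.1.degree ≤ K' :=
    fun θ hθ => (hbound θ hθ).trans ((sum_norm_coeff_boundedIndex_mul_exp_pow_le hBd).trans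
      (mul_le_mul_of_nonneg_left hBK (Real.exp_pos _).le))
  refine ⟨∑ γ : BoundedIndex X D, monomial γ.1 (b 1 γ), fun γ hγ => ?_, ?_,
    fun E _ _ _ δ m hδ hm => ?_⟩
  · classical
    obtain ⟨γ', -, hγ'⟩ := Finset.mem_biUnion.1 (support_sum hγ)
    rw [Finset.mem_singleton.1 (support_monomial_subset hγ')]
    exact γ'.2
  · refine (coeffNorm_sum_monomial_le _ _ _).trans ((Finset.sum_le_sum fun γ _ => ?_).trans
      (hK' 1 (right_mem_Icc.2 zero_le_one)))
    exact le_mul_of_one_le_right (norm_nonneg _) (one_le_pow₀ (by norm_num))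
  · have hdiff := norm_sum_smul_sub_sum_smul_le hW (ht.trans (by norm_num)) hb hK' hδ hm
    rw [observe_eq_sum_boundedIndex _ fun γ hγ => (hBd γ hγ).trans hdD, map_sum]
    simp only [observe_monomial]
    rw [hb0, add_sub_cancel] at hdiff
    linarith

theorem exists_iterated_transport (k : ℕ) :
    ∀ (d : ℕ) (K : ℝ) {ε : ℝ}, 0 < ε → ∃ C : ℝ, ∀ {X : Type u} [Fintype X] [DecidableEq X]
      {W : ℝ → MultiIndex X → ℂ} {v : ℕ → ℝ}, IsBoundedPotential W v →
      ∀ {t₁ t₀ : ℝ}, |t₀ - t₁| * ∑' n, v n ≤ (k + 1) / 5 → ∀ {B : MvPolynomial (Idx × X) ℂ},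
      (∀ γ ∈ B.support, γ.degree ≤ d) → coeffNorm B ≤ K →
      ∃ B' : MvPolynomial (Idx × X) ℂ, Transports W t₁ t₀ ε C B B' := by
  induction k with
  | zero =>
    intro d K ε hε
    obtain ⟨d', K', C, hshort⟩ := exists_short_time_transport.{u} d K hε
    refine ⟨C, fun hW _ _ ht _ hBd hBK => ?_⟩
    obtain ⟨B', -, -, hB'⟩ := hshort hW (by simpa using ht) hBd hBK
    exact ⟨B', hB'⟩
  | succ k ih =>
    intro d K ε hε
    obtain ⟨d', K', C₁, hshort⟩ := exists_short_time_transport.{u} d K (half_pos hε)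
    obtain ⟨C₂, hrest⟩ := ih d' K' (half_pos hε)
    refine ⟨C₁ + C₂, fun {X} _ _ {W v} hW {t₁ t₀} ht {B} hBd hBK => ?_⟩
    have hk : (0 : ℝ) < k + 2 := by positivity
    set τ := t₁ + (t₀ - t₁) / (k + 2)
    have hstep : |t₀ - t₁| / (k + 2) * ∑' n, v n ≤ 1 / 5 := by
      rw [div_mul_eq_mul_div, div_le_iff₀ hk]
      push_cast at ht
      linarith
    have hfirst : |τ - t₁| = |t₀ - t₁| / (k + 2) := by
      rw [add_sub_cancel_left, abs_div, abs_of_pos hk]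
    have hlast : |t₀ - τ| = (k + 1) * (|t₀ - t₁| / (k + 2)) := by
      have hsub : t₀ - τ = (k + 1) * ((t₀ - t₁) / (k + 2)) := by
        simp only [τ]
        field_simp
        ring
      rw [hsub, abs_mul, abs_div, abs_of_pos hk, abs_of_pos (by positivity)]
    obtain ⟨B₁, hB₁d, hB₁K, hB₁⟩ := hshort hW (by rwa [hfirst]) hBd hBK
    obtain ⟨B₂, hB₂⟩ := hrest hW (t₁ := τ) (t₀ := t₀) (by rw [hlast]; nlinarith) hB₁d hB₁K
    exact ⟨B₂, by simpa only [add_halves] using hB₁.trans hB₂⟩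

theorem exists_transport (T : ℝ) (d : ℕ) (K : ℝ) {ε : ℝ} (hε : 0 < ε) :
    ∃ C : ℝ, ∀ {X : Type u} [Fintype X] [DecidableEq X]
      {W : ℝ → MultiIndex X → ℂ} {v : ℕ → ℝ}, IsBoundedPotential W v →
      ∀ {t₁ t₀ : ℝ}, |t₀ - t₁| * ∑' n, v n ≤ T → ∀ {B : MvPolynomial (Idx × X) ℂ},
      (∀ γ ∈ B.support, γ.degree ≤ d) → coeffNorm B ≤ K →
      ∃ B' : MvPolynomial (Idx × X) ℂ, Transports W t₁ t₀ ε C B B' := by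
  obtain ⟨k, hk⟩ := exists_nat_ge (5 * T)
  obtain ⟨C, hC⟩ := exists_iterated_transport.{u} k d K hε
  exact ⟨C, fun hW _ _ ht => hC hW (by linarith)⟩

end Transport

/-! ### The classical Hamiltonian vector field -/

section Ladder

theorem Idx.bar_bar (i : Idx) : i.bar.bar = i := by cases i <;> rfl

theorem Idx.sum_bar {M : Type*} [AddCommMonoid M] (f : Idx → M) : ∑ i : Idx, f i.bar = ∑ i, f i :=
  (Function.Involutive.bijective Idx.bar_bar).sum_comp f

theorem eps_bar (i j k : Idx) : eps i.bar j.bar k.bar = -eps i j k := by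
  cases i <;> cases j <;> cases k <;> rfl

/-- The coordinates `(M_+, M_z, M_-)` of a vector, as a real-linear map. -/
noncomputable def ladderVec : EuclideanSpace ℝ (Fin 3) →L[ℝ] Idx → ℂ :=
  LinearMap.toContinuousLinearMap
    { toFun := fun v i => match i with
        | Idx.plus => ((v 0 : ℂ) + Complex.I * (v 1 : ℂ)) / (√2 : ℝ)
        | Idx.z => (v 2 : ℂ)
        | Idx.minus => ((v 0 : ℂ) - Complex.I * (v 1 : ℂ)) / (√2 : ℝ)
      map_add' := fun v w => by
        funext i
        cases i <;> simp <;> ring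
      map_smul' := fun c v => by
        funext i
        cases i <;> simp <;> ring }

/-- The left inverse of `ladderVec`, which recovers a vector from `M_+` and `M_z`. -/
noncomputable def ofLadderVec : (Idx → ℂ) →L[ℝ] EuclideanSpace ℝ (Fin 3) :=
  LinearMap.toContinuousLinearMap
    { toFun := fun w => !₂[√2 * (w Idx.plus).re, √2 * (w Idx.plus).im, (w Idx.z).re]
      map_add' := fun v w => by
        ext i
        fin_cases i <;> simp <;> ring
      map_smul' := fun c v => by
        ext i
        fin_cases i <;> simp <;> ring }

theorem ofLadderVec_ladderVec (v : EuclideanSpace ℝ (Fin 3)) : ofLadderVec (ladderVec v) = v := by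
  ext i
  fin_cases i <;> simp [ofLadderVec, ladderVec, Complex.div_ofReal_re, Complex.div_ofReal_im] <;>
    field_simp

theorem conj_ladderVec (v : EuclideanSpace ℝ (Fin 3)) (i : Idx) :
    (starRingEnd ℂ) (ladderVec v i) = ladderVec v i.bar := by
  cases i <;> simp [ladderVec, Idx.bar, sub_eq_add_neg]

theorem ladderVec_ofLadderVec {w : Idx → ℂ} (hw : ∀ i, (starRingEnd ℂ) (w i) = w i.bar) :
    ladderVec (ofLadderVec w) = w := by
  have hplus : ladderVec (ofLadderVec w) Idx.plus = w Idx.plus := by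
    apply Complex.ext <;>
      simp [ofLadderVec, ladderVec, Complex.div_ofReal_re, Complex.div_ofReal_im]
  have hz : (w Idx.z).im = 0 := Complex.conj_eq_iff_im.1 (hw Idx.z)
  funext i
  cases i
  · exact hplus
  · apply Complex.ext <;> simp [ofLadderVec, ladderVec, hz]
  · exact (conj_ladderVec _ _).symm.trans ((congrArg _ hplus).trans (hw Idx.plus))

theorem ofReal_inner_eq_sum_ladderVec (v w : EuclideanSpace ℝ (Fin 3)) :
    ((inner ℝ v w : ℝ) : ℂ) = ∑ i, ladderVec v i.bar * ladderVec w i := by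
  have hsq : ((√2 : ℝ) : ℂ) ^ 2 = 2 := by
    rw [← Complex.ofReal_pow, Real.sq_sqrt zero_le_two, Complex.ofReal_ofNat]
  have hne : ((√2 : ℝ) : ℂ) ≠ 0 := by simp
  rw [sum_idx]
  simp only [ladderVec, LinearMap.coe_toContinuousLinearMap', LinearMap.coe_mk, AddHom.coe_mk,
    Idx.bar, PiLp.inner_apply, Fin.sum_univ_three, RCLike.inner_apply, conj_trivial]
  push_cast
  field_simp
  rw [hsq]
  linear_combination (2 * (v 1 : ℂ) * (w 1 : ℂ)) * Complex.I_sq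

theorem sum_norm_ladderVec_sq (v : EuclideanSpace ℝ (Fin 3)) :
    ∑ i, ‖ladderVec v i‖ ^ 2 = ‖v‖ ^ 2 := by
  have h := ofReal_inner_eq_sum_ladderVec v v
  simp only [← conj_ladderVec, Complex.conj_mul', real_inner_self_eq_norm_sq] at h
  exact_mod_cast h.symm

theorem norm_ladderVec_le (v : EuclideanSpace ℝ (Fin 3)) (i : Idx) : ‖ladderVec v i‖ ≤ ‖v‖ := by
  refine (sq_le_sq₀ (norm_nonneg _) (norm_nonneg _)).1 ?_
  rw [← sum_norm_ladderVec_sq]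
  exact Finset.single_le_sum (f := fun i => ‖ladderVec v i‖ ^ 2) (fun _ _ => sq_nonneg _)
    (Finset.mem_univ i)

variable {L : Type*} {Λ : Finset L}

theorem ladder_eq_ladderVec (M : Config Λ) (i : Idx) (x : Λ) :
    ladder M (i, x) = ladderVec (M x) i := by
  cases i <;> rfl

theorem conj_ladder (M : Config Λ) (p : Idx × Λ) :
    (starRingEnd ℂ) (ladder M p) = ladder M (Prod.map Idx.bar id p) := by
  rw [ladder_eq_ladderVec M p.1 p.2, conj_ladderVec, ← ladder_eq_ladderVec]
  rfl

theorem norm_ladder_le {M : Config Λ} (hM : M ∈ phaseSpace Λ) (p : Idx × Λ) :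
    ‖ladder M p‖ ≤ 1 := by
  rw [ladder_eq_ladderVec M p.1 p.2]
  exact (norm_ladderVec_le _ _).trans (hM p.2)

theorem norm_ladder_sub_le (M M' : Config Λ) (p : Idx × Λ) :
    ‖ladder M p - ladder M' p‖ ≤ dist M M' := by
  rw [ladder_eq_ladderVec M p.1 p.2, ladder_eq_ladderVec M' p.1 p.2, ← Pi.sub_apply, ← map_sub]
  refine (norm_ladderVec_le _ _).trans ?_
  rw [← dist_eq_norm]
  exact dist_le_pi_dist M M' p.2

theorem observe_monomialValue (M : Config Λ) (A : Poly Λ) :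
    observe (fun γ => monomialValue γ M) A = eval (ladder M) A := by
  rw [observe_apply, eval_eq]
  rfl

theorem observe_monomialValue_smul {E : Type*} [NormedAddCommGroup E] [NormedSpace ℂ E] (e : E)
    (M : Config Λ) (A : Poly Λ) :
    observe (fun γ => monomialValue γ M • e) A = eval (ladder M) A • e := by
  simp only [← observe_monomialValue, observe_apply, Finset.sum_smul, smul_assoc]

theorem monomialValue_add (α β : MultiIndex Λ) (M : Config Λ) :
    monomialValue (α + β) M = monomialValue α M * monomialValue β M :=
  Finsupp.prod_add_index' (by simp) fun _ _ _ => pow_add _ _ _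

theorem monomialValue_single (p : Idx × Λ) (M : Config Λ) :
    monomialValue (Finsupp.single p 1) M = ladder M p := by
  simp [monomialValue]

theorem monomialValue_eq_wordProd (γ : MultiIndex Λ) (M : Config Λ) :
    monomialValue γ M = wordProd (ladder M) γ.toMultiset.toList := by
  rw [wordProd, ← Multiset.prod_coe, ← Multiset.map_coe, Multiset.coe_toList,
    prod_map_toMultiset]
  rfl

theorem norm_monomialValue_le {M : Config Λ} (hM : M ∈ phaseSpace Λ) (γ : MultiIndex Λ) :
    ‖monomialValue γ M‖ ≤ 1 := by
  rw [monomialValue_eq_wordProd]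
  simpa using norm_wordProd_le (norm_ladder_le hM) _

theorem norm_monomialValue_sub_le {M M' : Config Λ} (hM : M ∈ phaseSpace Λ)
    (hM' : M' ∈ phaseSpace Λ) (γ : MultiIndex Λ) :
    ‖monomialValue γ M - monomialValue γ M'‖ ≤ γ.degree * dist M M' := by
  rw [monomialValue_eq_wordProd, monomialValue_eq_wordProd,
    ← length_of_coe_eq_toMultiset (Multiset.coe_toList γ.toMultiset)]
  exact norm_wordProd_sub_le (norm_ladder_le hM) (norm_ladder_le hM') (norm_ladder_sub_le M M') _

theorem norm_eval_le_coeffNorm {M : Config Λ} (hM : M ∈ phaseSpace Λ) (A : Poly Λ) :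
    ‖eval (ladder M) A‖ ≤ coeffNorm A := by
  rw [← observe_monomialValue, observe_apply]
  refine norm_sum_le_of_le _ fun γ _ => ?_
  rw [norm_smul]
  exact mul_le_of_le_one_right (norm_nonneg _) (norm_monomialValue_le hM γ)

theorem norm_eval_sub_le {M M' : Config Λ} (hM : M ∈ phaseSpace Λ) (hM' : M' ∈ phaseSpace Λ)
    {A : Poly Λ} {N : ℕ} (hA : ∀ γ ∈ A.support, γ.degree ≤ N) :
    ‖eval (ladder M) A - eval (ladder M') A‖ ≤ coeffNorm A * (N * dist M M') := by
  rw [← observe_monomialValue, ← observe_monomialValue, observe_apply, observe_apply,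
    ← Finset.sum_sub_distrib, coeffNorm, Finset.sum_mul]
  refine norm_sum_le_of_le _ fun γ hγ => ?_
  rw [← smul_sub, norm_smul]
  refine mul_le_mul_of_nonneg_left ((norm_monomialValue_sub_le hM hM' γ).trans ?_) (norm_nonneg _)
  exact mul_le_mul_of_nonneg_right (Nat.cast_le.2 (hA γ hγ)) dist_nonneg

end Ladder

section Conjugation

theorem conjIndex_apply {X : Type*} (γ : MultiIndex X) (i : Idx) (x : X) :
    conjIndex γ (i, x) = γ (i.bar, x) := by
  have hinj : Function.Injective (Prod.map Idx.bar id : Idx × X → Idx × X) :=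
    (Function.Involutive.injective Idx.bar_bar).prodMap Function.injective_id
  have hi : ((i, x) : Idx × X) = Prod.map Idx.bar id (i.bar, x) := by
    simp [Idx.bar_bar]
  rw [conjIndex, hi, Finsupp.mapDomain_apply hinj]

theorem conjIndex_conjIndex {X : Type*} (γ : MultiIndex X) : conjIndex (conjIndex γ) = γ := by
  ext ⟨i, x⟩
  rw [conjIndex_apply, conjIndex_apply, Idx.bar_bar]

theorem conjIndex_sub_single {X : Type*} (β : MultiIndex X) (j : Idx) (x : X) :
    conjIndex (β - Finsupp.single (j, x) 1) = conjIndex β - Finsupp.single (j.bar, x) 1 := by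
  classical
  ext ⟨i, y⟩
  have hj : j = i.bar ↔ j.bar = i := (Function.Involutive.eq_iff Idx.bar_bar).symm
  simp only [conjIndex_apply, Finsupp.tsub_apply, Finsupp.single_apply, Prod.mk.injEq, hj]

variable {L : Type*} {Λ : Finset L}

theorem conjIndex_extendIndex (γ : MultiIndex Λ) :
    conjIndex (extendIndex Λ γ) = extendIndex Λ (conjIndex γ) := by
  rw [conjIndex, conjIndex, extendIndex, extendIndex, ← Finsupp.mapDomain_comp,
    ← Finsupp.mapDomain_comp]
  rfl

theorem conj_monomialValue (γ : MultiIndex Λ) (M : Config Λ) :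
    (starRingEnd ℂ) (monomialValue γ M) = monomialValue (conjIndex γ) M := by
  rw [monomialValue, monomialValue, conjIndex, Finsupp.prod_mapDomain_index (by simp)
    (fun _ _ _ => pow_add _ _ _), Finsupp.prod, map_prod]
  simp only [map_pow, conj_ladder]
  rfl

end Conjugation

section ClassicalField

variable {L : Type*} [DecidableEq L] {Λ : Finset L}

theorem eval_monomialBracket_single (β : MultiIndex Λ) (M : Config Λ) (i : Idx) (x : Λ) :
    eval (ladder M) (monomialBracket β (Finsupp.single (i, x) 1)) = ∑ j : Idx, ∑ k : Idx,
      Complex.I * (eps j i k : ℂ) * (β (j, x) : ℂ) *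
        (monomialValue (β - Finsupp.single (j, x) 1) M * ladder M (k, x)) := by
  have hX : (monomial (Finsupp.single (i, x) 1) 1 : Poly Λ) = MvPolynomial.X (i, x) := rfl
  rw [monomialBracket, hX, poisson_X_right, map_sum, Fintype.sum_prod_type]
  refine Finset.sum_congr rfl fun j _ => ?_
  rw [Finset.sum_eq_single x (fun y _ hy => by simp [eval_letterBracket, hy]) (by simp),
    eval_letterBracket, if_pos rfl, pderiv_monomial, map_mul, eval_monomial, map_sum,
    Finset.mul_sum]
  refine Finset.sum_congr rfl fun k _ => ?_
  rw [smul_eval, eval_X, monomialValue]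
  ring

theorem conj_eval_monomialBracket_single (β : MultiIndex Λ) (M : Config Λ) (i : Idx) (x : Λ) :
    (starRingEnd ℂ) (eval (ladder M) (monomialBracket β (Finsupp.single (i, x) 1))) =
      eval (ladder M) (monomialBracket (conjIndex β) (Finsupp.single (i.bar, x) 1)) := by
  rw [eval_monomialBracket_single, eval_monomialBracket_single, map_sum, ← Idx.sum_bar]
  refine Finset.sum_congr rfl fun j _ => ?_
  rw [map_sum, ← Idx.sum_bar]
  refine Finset.sum_congr rfl fun k _ => ?_
  have heps : eps j i.bar k = -eps j.bar i k.bar := by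
    simpa only [Idx.bar_bar] using eps_bar j.bar i k.bar
  simp [conj_monomialValue, conjIndex_sub_single, conj_ladder, conjIndex_apply, heps, Idx.bar_bar]

theorem norm_eval_monomialBracket_le {M : Config Λ} (hM : M ∈ phaseSpace Λ) (β α : MultiIndex Λ) :
    ‖eval (ladder M) (monomialBracket β α)‖ ≤ α.degree * Real.exp β.degree :=
  (norm_eval_le_coeffNorm hM _).trans
    ((coeffNorm_monomialBracket_le β α).trans (overlap_le_degree_mul_exp β α))

theorem norm_eval_monomialBracket_single_sub_le {M M' : Config Λ} (hM : M ∈ phaseSpace Λ)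
    (hM' : M' ∈ phaseSpace Λ) (β : MultiIndex Λ) (p : Idx × Λ) :
    ‖eval (ladder M) (monomialBracket β (Finsupp.single p 1)) -
        eval (ladder M') (monomialBracket β (Finsupp.single p 1))‖ ≤
      overlap β (Finsupp.single p 1) * (Real.exp β.degree * dist M M') := by
  have hdegree : ∀ γ ∈ (monomialBracket β (Finsupp.single p 1)).support, γ.degree ≤ β.degree :=
    fun γ hγ => by simpa using (degree_of_mem_support_monomialBracket hγ).le
  refine (norm_eval_sub_le hM hM' hdegree).trans ?_
  gcongr
  · exact coeffNorm_monomialBracket_le β _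
  · linarith [Real.add_one_le_exp (β.degree : ℝ)]

/-- The potential restricted to the finite volume `Λ`. -/
noncomputable abbrev localPotential {L : Type*} (V : ℝ → MultiIndex L → ℂ) (Λ : Finset L) :
    ℝ → MultiIndex Λ → ℂ :=
  fun t β => V t (extendIndex Λ β)

variable {V : ℝ → MultiIndex L → ℂ} {v : ℕ → ℝ}

theorem hamiltonianField_eq_tsum (V : ℝ → MultiIndex L → ℂ) (t : ℝ) (M : Config Λ) (i : Idx)
    (x : Λ) : hamiltonianField V Λ t M i x = ∑' β, localPotential V Λ t β •
      eval (ladder M) (monomialBracket β (Finsupp.single (i, x) 1)) := by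
  refine tsum_congr fun β => ?_
  rw [eval_monomialBracket_single, smul_eq_mul]
  simp_rw [monomialValue_add, monomialValue_single]

theorem conj_hamiltonianField (hreal : ∀ t α, (starRingEnd ℂ) (V t α) = V t (conjIndex α))
    (t : ℝ) (M : Config Λ) (i : Idx) (x : Λ) :
    (starRingEnd ℂ) (hamiltonianField V Λ t M i x) = hamiltonianField V Λ t M i.bar x := by
  rw [hamiltonianField_eq_tsum, hamiltonianField_eq_tsum, Complex.conj_tsum,
    ← (Function.Involutive.toPerm conjIndex conjIndex_conjIndex).tsum_eq
      fun β => localPotential V Λ t β • _]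
  refine tsum_congr fun β => ?_
  rw [smul_eq_mul, smul_eq_mul, map_mul, conj_eval_monomialBracket_single, hreal,
    conjIndex_extendIndex]
  rfl

theorem hasSum_hamiltonianField (hW : IsBoundedPotential (localPotential V Λ) v) {M : Config Λ}
    (hM : M ∈ phaseSpace Λ) (t : ℝ) (i : Idx) (x : Λ) :
    HasSum (fun β => localPotential V Λ t β •
      eval (ladder M) (monomialBracket β (Finsupp.single (i, x) 1)))
      (hamiltonianField V Λ t M i x) := by
  rw [hamiltonianField_eq_tsum]
  exact (hW.summable_smul (fun β => norm_eval_monomialBracket_le hM β _) t).hasSum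

theorem continuous_hamiltonianField (hW : IsBoundedPotential (localPotential V Λ) v)
    {M : Config Λ} (hM : M ∈ phaseSpace Λ) (i : Idx) (x : Λ) :
    Continuous fun t => hamiltonianField V Λ t M i x := by
  simp_rw [hamiltonianField_eq_tsum]
  exact hW.continuous_tsum_smul fun β => norm_eval_monomialBracket_le hM β _

/- The sum is `{H, |M(x)|²} / 2`, and `|M(x)|²` Poisson commutes with every polynomial. -/
theorem sum_ladder_mul_hamiltonianField (hW : IsBoundedPotential (localPotential V Λ) v)
    {M : Config Λ} (hM : M ∈ phaseSpace Λ) (t : ℝ) (x : Λ) :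
    ∑ i : Idx, ladder M (i.bar, x) * hamiltonianField V Λ t M i x = 0 := by
  have h := hasSum_sum fun (i : Idx) (_ : i ∈ Finset.univ) =>
    (hasSum_hamiltonianField hW hM t i x).mul_left (ladder M (i.bar, x))
  rw [← h.tsum_eq]
  refine (tsum_congr fun β => ?_).trans tsum_zero
  simp only [eval_monomialBracket_single, smul_eq_mul, sum_idx, Idx.bar, eps]
  push_cast
  ring

theorem norm_hamiltonianField_sub_le (hW : IsBoundedPotential (localPotential V Λ) v)
    {M M' : Config Λ} (hM : M ∈ phaseSpace Λ) (hM' : M' ∈ phaseSpace Λ) (t : ℝ) (i : Idx)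
    (x : Λ) :
    ‖hamiltonianField V Λ t M i x - hamiltonianField V Λ t M' i x‖ ≤
      (∑' n, v n) * dist M M' := by
  obtain ⟨a, ha, hsum⟩ := hW.hasSum_overlap_le (Finsupp.single (i, x) 1) t
  rw [Finsupp.degree_single, Nat.cast_one, one_mul] at ha
  rw [← ((hasSum_hamiltonianField hW hM t i x).sub (hasSum_hamiltonianField hW hM' t i x)).tsum_eq]
  refine (tsum_of_norm_bounded (hsum.mul_right (dist M M')) fun β => ?_).trans
    (mul_le_mul_of_nonneg_right ha dist_nonneg)
  rw [← smul_sub, norm_smul, mul_assoc, mul_assoc]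
  exact mul_le_mul_of_nonneg_left (norm_eval_monomialBracket_single_sub_le hM hM' β _)
    (norm_nonneg _)

end ClassicalField

/-! ### The classical flow -/

section RetractConfig

variable {L : Type*} {Λ : Finset L}

/-- The retraction of the configurations onto the phase space, radial at each site. -/
noncomputable def retractConfig (M : Config Λ) : Config Λ := fun x => retract 1 (M x)

theorem retractConfig_mem (M : Config Λ) : retractConfig M ∈ phaseSpace Λ := fun x =>
  norm_retract_le one_pos (M x)

theorem retractConfig_of_mem {M : Config Λ} (hM : M ∈ phaseSpace Λ) : retractConfig M = M :=
  funext fun x => retract_of_norm_le one_pos (hM x)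

theorem lipschitzWith_retractConfig : LipschitzWith 2 (retractConfig : Config Λ → Config Λ) :=
  LipschitzWith.of_dist_le_mul fun M M' => (dist_pi_le_iff (by positivity)).2 fun x =>
    ((lipschitzWith_retract one_pos).dist_le_mul _ _).trans
      (mul_le_mul_of_nonneg_left (dist_le_pi_dist M M' x) (by positivity))

end RetractConfig

section ClassicalFlow

variable {L : Type*} [DecidableEq L] {Λ : Finset L} {V : ℝ → MultiIndex L → ℂ} {v : ℕ → ℝ}

/-- The Hamiltonian vector field in Cartesian coordinates, composed with the retraction onto the
phase space to make it globally Lipschitz. -/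
noncomputable def extendedField (V : ℝ → MultiIndex L → ℂ) (t : ℝ) (M : Config Λ) : Config Λ :=
  fun x => ofLadderVec fun i => hamiltonianField V Λ t (retractConfig M) i x

theorem continuous_extendedField (hW : IsBoundedPotential (localPotential V Λ) v) (M : Config Λ) :
    Continuous fun t => extendedField V t M :=
  continuous_pi fun x => ofLadderVec.continuous.comp
    (continuous_pi fun i => continuous_hamiltonianField hW (retractConfig_mem M) i x)

theorem exists_lipschitzWith_extendedField (hW : IsBoundedPotential (localPotential V Λ) v) :
    ∃ K : ℝ≥0, ∀ t, LipschitzWith K (extendedField (Λ := Λ) V t) := by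
  obtain ⟨K, hK⟩ := CanLift.prf (β := ℝ≥0) (∑' n, v n) hW.tsum_nonneg
  refine ⟨‖ofLadderVec‖₊ * (K * 2), fun t => LipschitzWith.of_dist_le_mul fun M M' =>
    (dist_pi_le_iff (by positivity)).2 fun x => ?_⟩
  have hfield : ∀ i, ‖hamiltonianField V Λ t (retractConfig M) i x -
      hamiltonianField V Λ t (retractConfig M') i x‖ ≤ K * (2 * dist M M') := fun i =>
    (hK ▸ norm_hamiltonianField_sub_le hW (retractConfig_mem M) (retractConfig_mem M') t i
      x).trans (mul_le_mul_of_nonneg_left (lipschitzWith_retractConfig.dist_le_mul M M') K.2)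
  calc dist (extendedField V t M x) (extendedField V t M' x)
      ≤ ‖ofLadderVec‖ * (K * (2 * dist M M')) := by
        rw [extendedField, extendedField, dist_eq_norm, ← map_sub]
        exact (ofLadderVec.le_opNorm _).trans (mul_le_mul_of_nonneg_left
          ((pi_norm_le_iff_of_nonneg (by positivity)).2 hfield) (norm_nonneg _))
    _ = (‖ofLadderVec‖₊ * (K * 2) : ℝ≥0) * dist M M' := by
        push_cast
        ring

theorem ladderVec_extendedField (hreal : ∀ t α, (starRingEnd ℂ) (V t α) = V t (conjIndex α))
    (t : ℝ) (M : Config Λ) (x : Λ) :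
    ladderVec (extendedField V t M x) =
      fun i => hamiltonianField V Λ t (retractConfig M) i x :=
  ladderVec_ofLadderVec fun i => conj_hamiltonianField hreal t _ i x

theorem inner_retractConfig_extendedField
    (hreal : ∀ t α, (starRingEnd ℂ) (V t α) = V t (conjIndex α))
    (hW : IsBoundedPotential (localPotential V Λ) v) (t : ℝ) (M : Config Λ) (x : Λ) :
    inner ℝ (retractConfig M x) (extendedField V t M x) = 0 := by
  have h := sum_ladder_mul_hamiltonianField hW (retractConfig_mem M) t x
  simp only [ladder_eq_ladderVec] at h
  have hinner := ofReal_inner_eq_sum_ladderVec (retractConfig M x) (extendedField V t M x)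
  rw [ladderVec_extendedField hreal, h] at hinner
  exact_mod_cast hinner

theorem inner_extendedField (hreal : ∀ t α, (starRingEnd ℂ) (V t α) = V t (conjIndex α))
    (hW : IsBoundedPotential (localPotential V Λ) v) (t : ℝ) (M : Config Λ) (x : Λ) :
    inner ℝ (M x) (extendedField V t M x) = 0 := by
  have hM : M x = max 1 ‖M x‖ • retractConfig M x := by
    have h : 0 < max 1 ‖M x‖ := lt_max_of_lt_left one_pos
    rw [retractConfig, retract, smul_smul, mul_one_div_cancel h.ne', one_smul]
  rw [hM, inner_smul_left, inner_retractConfig_extendedField hreal hW, mul_zero]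

theorem norm_apply_eq_of_hasDerivAt_extendedField
    (hreal : ∀ t α, (starRingEnd ℂ) (V t α) = V t (conjIndex α))
    (hW : IsBoundedPotential (localPotential V Λ) v) {M : ℝ → Config Λ}
    (hM : ∀ t, HasDerivAt M (extendedField V t (M t)) t) (t : ℝ) (x : Λ) :
    ‖M t x‖ = ‖M 0 x‖ := by
  have hd : ∀ r, HasDerivAt (fun r => ‖M r x‖ ^ 2) 0 r := fun r => by
    simpa [inner_extendedField hreal hW] using (hasDerivAt_pi.1 (hM r) x).norm_sq
  have hsq := is_const_of_deriv_eq_zero (fun r => (hd r).differentiableAt)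
    (fun r => (hd r).deriv) t 0
  exact (pow_left_inj₀ (norm_nonneg _) (norm_nonneg _) two_ne_zero).1 hsq

theorem isClassicalSolution_of_hasDerivAt_extendedField
    (hreal : ∀ t α, (starRingEnd ℂ) (V t α) = V t (conjIndex α))
    (hW : IsBoundedPotential (localPotential V Λ) v) {M : ℝ → Config Λ}
    (hM₀ : M 0 ∈ phaseSpace Λ) (hM : ∀ t, HasDerivAt M (extendedField V t (M t)) t) :
    IsClassicalSolution V Λ (M 0) M := by
  have hmem : ∀ t, M t ∈ phaseSpace Λ := fun t x =>
    (norm_apply_eq_of_hasDerivAt_extendedField hreal hW hM t x).trans_le (hM₀ x)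
  refine ⟨rfl, hmem, fun t i x => ?_⟩
  have h := ladderVec.hasFDerivAt.comp_hasDerivAt t (hasDerivAt_pi.1 (hM t) x)
  rw [ladderVec_extendedField hreal, retractConfig_of_mem (hmem t)] at h
  simp_rw [ladder_eq_ladderVec]
  exact hasDerivAt_pi.1 h i

theorem IsClassicalSolution.hasDerivAt_extendedField {M₀ : Config Λ} {M : ℝ → Config Λ}
    (hM : IsClassicalSolution V Λ M₀ M) (t : ℝ) : HasDerivAt M (extendedField V t (M t)) t := by
  refine hasDerivAt_pi.2 fun x => ?_
  have hladder : HasDerivAt (fun r => ladderVec (M r x))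
      (fun i => hamiltonianField V Λ t (M t) i x) t :=
    hasDerivAt_pi.2 fun i => by simpa only [ladder_eq_ladderVec] using hM.hasDerivAt t i x
  simpa [Function.comp_def, ofLadderVec_ladderVec, extendedField,
    retractConfig_of_mem (hM.mem_phaseSpace t)] using
    ofLadderVec.hasFDerivAt.comp_hasDerivAt t hladder

theorem existsUnique_isClassicalSolution
    (hreal : ∀ t α, (starRingEnd ℂ) (V t α) = V t (conjIndex α))
    (hW : IsBoundedPotential (localPotential V Λ) v) {M₀ : Config Λ} (hM₀ : M₀ ∈ phaseSpace Λ) :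
    ∃! M : ℝ → Config Λ, IsClassicalSolution V Λ M₀ M := by
  obtain ⟨K, hK⟩ := exists_lipschitzWith_extendedField hW
  obtain ⟨M, rfl, hM⟩ := exists_global_solution (continuous_extendedField hW)
    (fun _ => ⟨K, fun t _ => hK t⟩) M₀
  refine ⟨M, isClassicalSolution_of_hasDerivAt_extendedField hreal hW hM₀ hM, fun M' hM' => ?_⟩
  exact ODE_solution_unique_univ (v := extendedField V) (s := fun _ => univ)
    (fun t => (hK t).lipschitzOnWith) (fun t => ⟨hM'.hasDerivAt_extendedField t, mem_univ _⟩)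
    (fun t => ⟨hM t, mem_univ _⟩) hM'.initial

theorem hasDerivAt_eval {σ : Type*} [Fintype σ] {y : ℝ → σ → ℂ} {y' : σ → ℂ} {t : ℝ}
    (hy : ∀ p, HasDerivAt (fun r => y r p) (y' p) t) (A : MvPolynomial σ ℂ) :
    HasDerivAt (fun r => eval (y r) A) (∑ p, eval (y t) (pderiv p A) * y' p) t := by
  classical
  induction A using MvPolynomial.induction_on with
  | C a => simpa using hasDerivAt_const t a
  | add A B hA hB =>
    simp only [map_add, add_mul, Finset.sum_add_distrib]
    exact hA.add hB
  | mul_X A q hA =>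
    simp only [map_mul, eval_X]
    refine (hA.mul (hy q)).congr_deriv ?_
    simp only [Derivation.leibniz, pderiv_X, Pi.single_apply, smul_eq_mul, mul_ite, mul_one,
      mul_zero, map_add, map_mul, eval_X, apply_ite (eval (y t)), map_zero, add_mul, ite_mul,
      zero_mul, Finset.sum_add_distrib, Finset.sum_ite_eq, Finset.mem_univ, if_true,
      Finset.sum_mul]
    rw [add_comm]
    exact congrArg _ (Finset.sum_congr rfl fun p _ => by ring)

theorem hasSum_sum_pderiv_mul_hamiltonianField (hW : IsBoundedPotential (localPotential V Λ) v)
    {M : Config Λ} (hM : M ∈ phaseSpace Λ) (t : ℝ) (α : MultiIndex Λ) :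
    HasSum (fun β => localPotential V Λ t β • eval (ladder M) (monomialBracket β α))
      (∑ p : Idx × Λ, eval (ladder M) (pderiv p (monomial α 1)) *
        hamiltonianField V Λ t M p.1 p.2) := by
  refine (hasSum_sum fun (p : Idx × Λ) (_ : p ∈ Finset.univ) =>
    (hasSum_hamiltonianField hW hM t p.1 p.2).mul_left _).congr_fun fun β => ?_
  rw [monomialBracket, poisson_eq_sum_pderiv_mul, map_sum, Finset.smul_sum]
  refine Finset.sum_congr rfl fun p _ => ?_
  rw [map_mul, smul_eq_mul, smul_eq_mul, mul_left_comm]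
  rfl

theorem IsClassicalSolution.hasDerivAt_monomialValue
    (hW : IsBoundedPotential (localPotential V Λ) v) {M₀ : Config Λ} {M : ℝ → Config Λ}
    (hM : IsClassicalSolution V Λ M₀ M) (t : ℝ) (α : MultiIndex Λ) :
    HasDerivAt (fun r => monomialValue α (M r))
      (∑' β, localPotential V Λ t β • eval (ladder (M t)) (monomialBracket β α)) t := by
  have h := hasDerivAt_eval (fun p : Idx × Λ => hM.hasDerivAt t p.1 p.2) (monomial α 1)
  rw [← (hasSum_sum_pderiv_mul_hamiltonianField hW (hM.mem_phaseSpace t) t α).tsum_eq] at h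
  simp only [eval_monomial, one_mul] at h
  exact h

theorem IsClassicalSolution.isApproxFlow (hW : IsBoundedPotential (localPotential V Λ) v)
    {M₀ : Config Λ} {M : ℝ → Config Λ} (hM : IsClassicalSolution V Λ M₀ M) {E : Type*}
    [NormedAddCommGroup E] [NormedSpace ℂ E] {e : E} (he : ‖e‖ = 1) :
    IsApproxFlow (localPotential V Λ) 0 fun t γ => monomialValue γ (M t) • e := by
  refine ⟨fun t γ => ?_, fun t β α => eval (ladder (M t)) (monomialBracket β α) • e,
    fun t α => ?_, fun t β α => ?_⟩
  · rw [norm_smul, he, mul_one]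
    exact (norm_monomialValue_le (hM.mem_phaseSpace t) γ).trans (one_le_pow₀ (by norm_num))
  · have hsum := (hW.summable_smul
      (fun β => norm_eval_monomialBracket_le (hM.mem_phaseSpace t) β α) t).tsum_smul_const e
    simp only [← smul_assoc, hsum]
    exact (hM.hasDerivAt_monomialValue hW t α).smul_const e
  · rw [observe_monomialValue_smul, sub_self, norm_zero, zero_mul]

end ClassicalFlow

/-! ### The spin algebra -/

section SiteMatrix

variable {X : Type*} [Fintype X] [DecidableEq X] {n : ℕ}

theorem siteMatrix_update_right (x : X) (S : Matrix (Fin (n + 1)) (Fin (n + 1)) ℂ)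
    (σ : X → Fin (n + 1)) (a : Fin (n + 1)) :
    siteMatrix x S σ (Function.update σ x a) = S (σ x) a := by
  rw [siteMatrix, if_pos fun y hy => (Function.update_of_ne hy _ _).symm, Function.update_self]

theorem siteMatrix_update_left (x : X) (S : Matrix (Fin (n + 1)) (Fin (n + 1)) ℂ)
    (σ τ : X → Fin (n + 1)) (a : Fin (n + 1)) :
    siteMatrix x S (Function.update σ x a) τ =
      if ∀ y, y ≠ x → σ y = τ y then S a (τ x) else 0 := by
  rw [siteMatrix, Function.update_self]
  exact if_congr (forall₂_congr fun y hy => by rw [Function.update_of_ne hy]) rfl rfl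

theorem sum_siteMatrix_mul (x : X) (S : Matrix (Fin (n + 1)) (Fin (n + 1)) ℂ)
    (σ : X → Fin (n + 1)) (f : (X → Fin (n + 1)) → ℂ) :
    ∑ ρ, siteMatrix x S σ ρ * f ρ = ∑ a, S (σ x) a * f (Function.update σ x a) := by
  refine (Finset.sum_of_injOn (Function.update σ x) (Function.update_injective σ x).injOn
    (fun _ _ => Finset.mem_coe.2 (Finset.mem_univ _)) (fun ρ _ hρ => ?_)
    fun a _ => by rw [siteMatrix_update_right]).symm
  rw [siteMatrix, if_neg fun h => hρ ⟨ρ x, Finset.mem_coe.2 (Finset.mem_univ _),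
    Function.update_eq_iff.2 ⟨rfl, fun y hy => h y hy⟩⟩, zero_mul]

theorem siteMatrix_mul_same (x : X) (S T : Matrix (Fin (n + 1)) (Fin (n + 1)) ℂ) :
    siteMatrix x S * siteMatrix x T = siteMatrix x (S * T) := by
  ext σ τ
  rw [Matrix.mul_apply, sum_siteMatrix_mul]
  simp only [siteMatrix_update_left]
  simp only [siteMatrix, Matrix.mul_apply]
  split_ifs <;> simp

theorem commute_siteMatrix {x y : X} (hxy : x ≠ y)
    (S T : Matrix (Fin (n + 1)) (Fin (n + 1)) ℂ) :
    Commute (siteMatrix x S) (siteMatrix y T) := by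
  ext σ τ
  rw [siteMatrix_mul_apply hxy, siteMatrix_mul_apply hxy.symm]
  exact if_congr ⟨fun h w a b => h w b a, fun h w a b => h w b a⟩ (mul_comm _ _) rfl

theorem siteMatrix_add (x : X) (S T : Matrix (Fin (n + 1)) (Fin (n + 1)) ℂ) :
    siteMatrix x (S + T) = siteMatrix x S + siteMatrix x T := by
  ext σ τ
  simp only [siteMatrix, Matrix.add_apply]
  split_ifs <;> simp

theorem siteMatrix_smul (x : X) (c : ℂ) (S : Matrix (Fin (n + 1)) (Fin (n + 1)) ℂ) :
    siteMatrix x (c • S) = c • siteMatrix x S := by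
  ext σ τ
  simp only [siteMatrix, Matrix.smul_apply]
  split_ifs <;> simp

theorem siteMatrix_sub (x : X) (S T : Matrix (Fin (n + 1)) (Fin (n + 1)) ℂ) :
    siteMatrix x (S - T) = siteMatrix x S - siteMatrix x T := by
  ext σ τ
  simp only [siteMatrix, Matrix.sub_apply]
  split_ifs <;> simp

theorem conjTranspose_siteMatrix (x : X) (S : Matrix (Fin (n + 1)) (Fin (n + 1)) ℂ) :
    (siteMatrix x S)ᴴ = siteMatrix x Sᴴ := by
  ext σ τ
  simp only [siteMatrix, Matrix.conjTranspose_apply]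
  rw [apply_ite star, star_zero]
  exact if_congr (forall₂_congr fun y _ => eq_comm) rfl rfl

theorem siteMatrix_diagonal (x : X) (d : Fin (n + 1) → ℂ) :
    siteMatrix x (Matrix.diagonal d) = Matrix.diagonal fun σ : X → Fin (n + 1) => d (σ x) := by
  ext σ τ
  simp only [siteMatrix, Matrix.diagonal_apply, ← ite_and]
  refine if_congr ⟨fun h => funext fun y => ?_, fun h => h ▸ ⟨fun _ _ => rfl, rfl⟩⟩ rfl rfl
  rcases eq_or_ne y x with rfl | hy
  exacts [h.2, h.1 y hy]

end SiteMatrix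

section Generator

variable (n : ℕ)

theorem star_raising_apply (a b : Fin (n + 1)) : star (raising n a b) = raising n a b := by
  rw [raising, apply_ite star, star_zero, Complex.star_def, Complex.conj_ofReal]

theorem raising_mul_self (a b : Fin (n + 1)) :
    raising n a b * raising n a b =
      if (a : ℕ) + 1 = b then (b : ℂ) * ((n : ℂ) + 1 - (b : ℕ)) else 0 := by
  rw [raising]
  split_ifs
  · have hb : (b : ℝ) ≤ n := by exact_mod_cast Nat.lt_succ_iff.1 b.2
    rw [← Complex.ofReal_mul, Real.mul_self_sqrt (mul_nonneg b.1.cast_nonneg (by linarith))]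
    push_cast
    rfl
  · exact mul_zero 0

theorem raising_mul_conjTranspose :
    raising n * (raising n)ᴴ =
      Matrix.diagonal fun a : Fin (n + 1) => ((a : ℂ) + 1) * ((n : ℂ) - (a : ℕ)) := by
  ext a a'
  simp only [Matrix.mul_apply, Matrix.conjTranspose_apply, star_raising_apply,
    Matrix.diagonal_apply]
  split_ifs with h
  · subst h
    simp only [raising_mul_self]
    rw [Fin.sum_univ_eq_sum_range
      (fun b => if (a : ℕ) + 1 = b then (b : ℂ) * ((n : ℂ) + 1 - b) else 0), Finset.sum_ite_eq]
    split_ifs with ha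
    · push_cast
      ring
    · have : (a : ℕ) = n := by have := a.2; rw [Finset.mem_range] at ha; lia
      rw [this, sub_self, mul_zero]
  · refine Finset.sum_eq_zero fun b _ => ?_
    by_cases hb : (a : ℕ) + 1 = b
    · rw [mul_comm, raising, if_neg fun hb' => h (Fin.ext (by lia)), zero_mul]
    · rw [raising, if_neg hb, zero_mul]

theorem conjTranspose_mul_raising :
    (raising n)ᴴ * raising n =
      Matrix.diagonal fun a : Fin (n + 1) => (a : ℂ) * ((n : ℂ) + 1 - (a : ℕ)) := by
  ext a a'
  simp only [Matrix.mul_apply, Matrix.conjTranspose_apply, star_raising_apply,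
    Matrix.diagonal_apply]
  split_ifs with h
  · subst h
    simp only [raising_mul_self]
    rw [Fin.sum_univ_eq_sum_range
      (fun b => if b + 1 = (a : ℕ) then (a : ℂ) * ((n : ℂ) + 1 - (a : ℕ)) else 0)]
    rcases Nat.eq_zero_or_eq_succ_pred (a : ℕ) with ha | ha
    · simp [ha]
    · rw [ha]
      simp
  · refine Finset.sum_eq_zero fun b _ => ?_
    by_cases hb : (b : ℕ) + 1 = a
    · rw [mul_comm, raising, if_neg fun hb' => h (Fin.ext (by lia)), zero_mul]
    · rw [raising, if_neg hb, zero_mul]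

theorem generator_two :
    generator n 2 = Matrix.diagonal fun a : Fin (n + 1) => ((n : ℂ) / 2 - (a : ℕ)) := rfl

theorem conjTranspose_generator_two : (generator n 2)ᴴ = generator n 2 := by
  rw [generator_two, Matrix.diagonal_conjTranspose]
  congr 1
  funext a
  simp

theorem raising_commutator_conjTranspose :
    raising n * (raising n)ᴴ - (raising n)ᴴ * raising n = (2 : ℂ) • generator n 2 := by
  rw [raising_mul_conjTranspose, conjTranspose_mul_raising, generator_two, Matrix.diagonal_sub,
    ← Matrix.diagonal_smul]
  congr 1
  funext a
  rw [Pi.smul_apply, smul_eq_mul]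
  ring

theorem generator_two_commutator_raising :
    generator n 2 * raising n - raising n * generator n 2 = raising n := by
  ext a b
  rw [generator_two, Matrix.sub_apply, Matrix.diagonal_mul, Matrix.mul_diagonal]
  by_cases h : (a : ℕ) + 1 = b
  · rw [← h]
    push_cast
    ring
  · simp [raising, h]

theorem generator_two_commutator_conjTranspose :
    generator n 2 * (raising n)ᴴ - (raising n)ᴴ * generator n 2 = -(raising n)ᴴ := by
  have h := congrArg Matrix.conjTranspose (generator_two_commutator_raising n)
  rw [Matrix.conjTranspose_sub, Matrix.conjTranspose_mul, Matrix.conjTranspose_mul,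
    conjTranspose_generator_two] at h
  rw [← neg_sub, h]

theorem generator_zero_add_I_smul :
    generator n 0 + Complex.I • generator n 1 = raising n := by
  have hI : Complex.I * (1 / (2 * Complex.I)) = 1 / 2 := by field_simp
  simp only [generator, Matrix.cons_val_zero, Matrix.cons_val_one, smul_smul, hI]
  module

theorem generator_zero_sub_I_smul :
    generator n 0 - Complex.I • generator n 1 = (raising n)ᴴ := by
  have hI : Complex.I * (1 / (2 * Complex.I)) = 1 / 2 := by field_simp
  simp only [generator, Matrix.cons_val_zero, Matrix.cons_val_one, smul_smul, hI]
  module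

end Generator

section SpinMatrix

theorem spinMatrix_plus (n : ℕ) :
    spinMatrix n Idx.plus = (((√2 : ℝ) : ℂ)⁻¹ * ((n : ℂ) / 2)⁻¹) • raising n := by
  rw [spinMatrix, rescaledSpin, rescaledSpin, smul_comm Complex.I, ← smul_add,
    generator_zero_add_I_smul, smul_smul]

theorem spinMatrix_minus (n : ℕ) :
    spinMatrix n Idx.minus = (((√2 : ℝ) : ℂ)⁻¹ * ((n : ℂ) / 2)⁻¹) • (raising n)ᴴ := by
  rw [spinMatrix, rescaledSpin, rescaledSpin, smul_comm Complex.I, ← smul_sub,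
    generator_zero_sub_I_smul, smul_smul]

theorem spinMatrix_z (n : ℕ) : spinMatrix n Idx.z = ((n : ℂ) / 2)⁻¹ • generator n 2 := rfl

theorem conjTranspose_spinMatrix (n : ℕ) (i : Idx) :
    (spinMatrix n i)ᴴ = spinMatrix n i.bar := by
  cases i <;> simp only [Idx.bar, spinMatrix_plus, spinMatrix_minus, spinMatrix_z,
    Matrix.conjTranspose_smul, Matrix.conjTranspose_conjTranspose, conjTranspose_generator_two] <;>
    simp

theorem inv_sqrt_two_mul_self : ((√2 : ℝ) : ℂ)⁻¹ * ((√2 : ℝ) : ℂ)⁻¹ = 1 / 2 := by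
  rw [← mul_inv, ← Complex.ofReal_mul, Real.mul_self_sqrt zero_le_two, Complex.ofReal_ofNat,
    one_div]

variable {n : ℕ}

theorem spinMatrix_commutator_plus_minus (hn : n ≠ 0) :
    ((n : ℂ) / 2) • (spinMatrix n Idx.plus * spinMatrix n Idx.minus -
      spinMatrix n Idx.minus * spinMatrix n Idx.plus) = spinMatrix n Idx.z := by
  rw [spinMatrix_plus, spinMatrix_minus, spinMatrix_z, smul_mul_smul_comm, smul_mul_smul_comm,
    ← smul_sub, raising_commutator_conjTranspose, smul_smul, smul_smul, mul_mul_mul_comm,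
    inv_sqrt_two_mul_self]
  congr 1
  field_simp [Nat.cast_ne_zero.2 hn]

theorem spinMatrix_commutator_z_plus (hn : n ≠ 0) :
    ((n : ℂ) / 2) • (spinMatrix n Idx.z * spinMatrix n Idx.plus -
      spinMatrix n Idx.plus * spinMatrix n Idx.z) = spinMatrix n Idx.plus := by
  have hs : (n : ℂ) / 2 ≠ 0 := div_ne_zero (Nat.cast_ne_zero.2 hn) two_ne_zero
  rw [spinMatrix_plus, spinMatrix_z, smul_mul_smul_comm, smul_mul_smul_comm,
    mul_comm ((n : ℂ) / 2)⁻¹, ← smul_sub, generator_two_commutator_raising, smul_smul,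
    mul_comm, inv_mul_cancel_right₀ hs]

theorem spinMatrix_commutator_z_minus (hn : n ≠ 0) :
    ((n : ℂ) / 2) • (spinMatrix n Idx.z * spinMatrix n Idx.minus -
      spinMatrix n Idx.minus * spinMatrix n Idx.z) = -spinMatrix n Idx.minus := by
  have hs : (n : ℂ) / 2 ≠ 0 := div_ne_zero (Nat.cast_ne_zero.2 hn) two_ne_zero
  rw [spinMatrix_minus, spinMatrix_z, smul_mul_smul_comm, smul_mul_smul_comm,
    mul_comm ((n : ℂ) / 2)⁻¹, ← smul_sub, generator_two_commutator_conjTranspose, smul_smul,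
    mul_comm, inv_mul_cancel_right₀ hs, smul_neg]

theorem spinMatrix_commutator (hn : n ≠ 0) (i j : Idx) :
    ((n : ℂ) / 2) • (spinMatrix n i * spinMatrix n j - spinMatrix n j * spinMatrix n i) =
      ∑ k, (eps i j k : ℂ) • spinMatrix n k := by
  have hanti : ∀ a b : Idx, ((n : ℂ) / 2) •
      (spinMatrix n a * spinMatrix n b - spinMatrix n b * spinMatrix n a) =
      -(((n : ℂ) / 2) •
        (spinMatrix n b * spinMatrix n a - spinMatrix n a * spinMatrix n b)) := fun a b => by
    rw [← smul_neg, neg_sub]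
  rw [sum_idx]
  cases i <;> cases j <;> simp only [eps, Int.cast_zero, Int.cast_one, Int.cast_neg, zero_smul,
    one_smul, neg_smul, add_zero, zero_add, sub_self, smul_zero]
  · rw [hanti, spinMatrix_commutator_z_plus hn]
  · exact spinMatrix_commutator_plus_minus hn
  · exact spinMatrix_commutator_z_plus hn
  · exact spinMatrix_commutator_z_minus hn
  · rw [hanti, spinMatrix_commutator_plus_minus hn]
  · rw [hanti, spinMatrix_commutator_z_minus hn, neg_neg]

end SpinMatrix

/-! ### Spin operators -/

section SpinOperators

variable {L : Type*} [DecidableEq L] {Λ : Finset L} {n : ℕ}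

theorem spinOp_commutator (hn : n ≠ 0) (p q : Idx × Λ) :
    (Complex.I * ((n : ℂ) / 2)) • (spinOp Λ n p * spinOp Λ n q - spinOp Λ n q * spinOp Λ n p) =
      (letterBracket p q).eval (spinOp Λ n) := by
  obtain ⟨i, x⟩ := p
  obtain ⟨j, y⟩ := q
  rw [eval_letterBracket]
  rcases eq_or_ne x y with rfl | hxy
  · rw [if_pos rfl]
    simp only [spinOp, ← map_mul, ← map_sub, ← map_smul, ← map_sum]
    rw [siteMatrix_mul_same, siteMatrix_mul_same, ← siteMatrix_sub, mul_smul, ← siteMatrix_smul,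
      spinMatrix_commutator hn, sum_idx, sum_idx, siteMatrix_add, siteMatrix_add]
    simp only [siteMatrix_smul, smul_add, mul_smul]
  · rw [if_neg hxy, spinOp, spinOp, ← map_mul, ← map_mul, (commute_siteMatrix hxy _ _).eq,
      sub_self, smul_zero]

theorem star_spinOp (p : Idx × Λ) :
    star (spinOp Λ n p) = spinOp Λ n (Prod.map Idx.bar id p) := by
  rw [spinOp, spinOp, ← map_star, Matrix.star_eq_conjTranspose, conjTranspose_siteMatrix,
    conjTranspose_spinMatrix]
  rfl

open scoped Matrix.Norms.L2Operator in
theorem norm_toEuclideanCLM_diagonal_le {ι : Type*} [Fintype ι] [DecidableEq ι] {d : ι → ℂ}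
    {c : ℝ} (hc : 0 ≤ c) (hd : ∀ a, ‖d a‖ ≤ c) :
    ‖Matrix.toEuclideanCLM (𝕜 := ℂ) (n := ι) (Matrix.diagonal d)‖ ≤ c := by
  rw [Matrix.l2_opNorm_toEuclideanCLM, Matrix.l2_opNorm_diagonal]
  exact (pi_norm_le_iff_of_nonneg hc).2 hd

theorem norm_toEuclideanCLM_siteMatrix_smul_diagonal_le {X : Type*} [Fintype X] [DecidableEq X]
    (x : X) {r c : ℝ} (hc : 0 ≤ c) {d : Fin (n + 1) → ℝ} (hd : ∀ a, |r * d a| ≤ c) :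
    ‖Matrix.toEuclideanCLM (𝕜 := ℂ) (n := X → Fin (n + 1))
      (siteMatrix x ((r : ℂ) • Matrix.diagonal fun a => (d a : ℂ)))‖ ≤ c := by
  rw [← Matrix.diagonal_smul, siteMatrix_diagonal]
  refine norm_toEuclideanCLM_diagonal_le hc fun σ => ?_
  rw [Pi.smul_apply, smul_eq_mul, ← Complex.ofReal_mul, Complex.norm_real]
  exact hd (σ x)

theorem spinOp_plus_mul_star (x : Λ) :
    spinOp Λ n (Idx.plus, x) * star (spinOp Λ n (Idx.plus, x)) =
      Matrix.toEuclideanCLM (𝕜 := ℂ) (n := Λ → Fin (n + 1)) (siteMatrix x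
        (((2 / (n : ℝ) ^ 2 : ℝ) : ℂ) •
          Matrix.diagonal fun a : Fin (n + 1) =>
            ((((a : ℝ) + 1) * ((n : ℝ) - (a : ℕ)) : ℝ) : ℂ))) := by
  rw [star_spinOp, spinOp, spinOp, ← map_mul]
  simp only [Prod.map, Idx.bar, id]
  rw [siteMatrix_mul_same, spinMatrix_plus, spinMatrix_minus, smul_mul_smul_comm,
    raising_mul_conjTranspose, mul_mul_mul_comm, inv_sqrt_two_mul_self]
  congr 3
  · push_cast
    rw [inv_div]
    ring
  · push_cast
    rfl

theorem norm_spinOp_plus_le (x : Λ) : ‖spinOp Λ n (Idx.plus, x)‖ ≤ 3 / 2 := by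
  have hsq : ‖spinOp Λ n (Idx.plus, x)‖ * ‖spinOp Λ n (Idx.plus, x)‖ ≤ 2 := by
    rw [← CStarRing.norm_self_mul_star, spinOp_plus_mul_star]
    refine norm_toEuclideanCLM_siteMatrix_smul_diagonal_le x zero_le_two fun a => ?_
    have ha : ((a : ℕ) : ℝ) ≤ n := by exact_mod_cast Nat.lt_succ_iff.1 a.2
    have hle : ((a : ℝ) + 1) * ((n : ℝ) - (a : ℕ)) ≤ (n : ℝ) ^ 2 := by
      rcases Nat.lt_or_ge (a : ℕ) n with h | h
      · have h' : (a : ℝ) + 1 ≤ n := by exact_mod_cast h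
        nlinarith [(a : ℕ).cast_nonneg (α := ℝ)]
      · have h' : (n : ℝ) ≤ (a : ℕ) := by exact_mod_cast h
        nlinarith [sq_nonneg (n : ℝ)]
    rw [abs_of_nonneg (mul_nonneg (by positivity)
      (mul_nonneg (by positivity) (sub_nonneg.2 ha))), div_mul_eq_mul_div]
    exact div_le_of_le_mul₀ (by positivity) zero_le_two (mul_le_mul_of_nonneg_left hle zero_le_two)
  nlinarith [norm_nonneg (spinOp Λ n (Idx.plus, x))]

theorem norm_spinOp_z_le (x : Λ) : ‖spinOp Λ n (Idx.z, x)‖ ≤ 1 := by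
  have hz : spinMatrix n Idx.z = ((((n : ℝ) / 2)⁻¹ : ℝ) : ℂ) •
      Matrix.diagonal fun a : Fin (n + 1) => (((n : ℝ) / 2 - (a : ℕ) : ℝ) : ℂ) := by
    rw [spinMatrix_z, generator_two]
    push_cast
    rfl
  rw [spinOp, hz]
  refine norm_toEuclideanCLM_siteMatrix_smul_diagonal_le x zero_le_one fun a => ?_
  have ha : ((a : ℕ) : ℝ) ≤ n := by exact_mod_cast Nat.lt_succ_iff.1 a.2
  have hle : |(n : ℝ) / 2 - (a : ℕ)| ≤ n / 2 :=
    abs_le.2 ⟨by linarith, by linarith [(a : ℕ).cast_nonneg (α := ℝ)]⟩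
  rw [abs_mul, abs_inv, abs_of_nonneg (by positivity : (0 : ℝ) ≤ n / 2)]
  exact inv_mul_le_one_of_le₀ hle (by positivity)

/- The rescaled ladder operators have norm at most `√2`, attained for spin `1/2`. -/
theorem norm_spinOp_le (p : Idx × Λ) : ‖spinOp Λ n p‖ ≤ 3 / 2 := by
  obtain ⟨i, x⟩ := p
  cases i
  · exact norm_spinOp_plus_le x
  · exact (norm_spinOp_z_le x).trans (by norm_num)
  · have h : spinOp Λ n (Idx.minus, x) = star (spinOp Λ n (Idx.plus, x)) :=
      (star_spinOp (Idx.plus, x)).symm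
    rw [h]
    exact (norm_star (E := SpinOp Λ n) _).trans_le (norm_spinOp_plus_le x)

end SpinOperators

/-! ### Reordering words of operators with small commutators -/

section Reordering

variable {σ 𝒜 : Type*} [NormedRing 𝒜] [NormOneClass 𝒜] {S : σ → 𝒜} {b κ : ℝ}

theorem norm_commutator_wordProd_le (hb : ∀ p, ‖S p‖ ≤ b)
    (hκ : ∀ p q, ‖S p * S q - S q * S p‖ ≤ κ * b) (a : σ) (w : List σ) :
    ‖S a * wordProd S w - wordProd S w * S a‖ ≤ w.length * (κ * b ^ w.length) := by
  induction w with
  | nil => simp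
  | cons q w ih =>
    calc ‖S a * wordProd S (q :: w) - wordProd S (q :: w) * S a‖
        = ‖(S a * S q - S q * S a) * wordProd S w +
            S q * (S a * wordProd S w - wordProd S w * S a)‖ := by
          rw [wordProd_cons]
          congr 1
          noncomm_ring
      _ ≤ κ * b * b ^ w.length + b * (w.length * (κ * b ^ w.length)) :=
          norm_add_le_of_le
            (norm_mul_le_of_le (hκ a q) (norm_wordProd_le hb w)) (norm_mul_le_of_le (hb q) ih)
      _ = (q :: w).length * (κ * b ^ (q :: w).length) := by
          rw [List.length_cons, pow_succ]
          push_cast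
          ring

theorem norm_wordProd_cons_sub_append_cons_le (hb : ∀ p, ‖S p‖ ≤ b)
    (hκ : ∀ p q, ‖S p * S q - S q * S p‖ ≤ κ * b) (a : σ) (u l₁ l₂ : List σ) :
    ‖wordProd S (a :: u) - wordProd S (l₁ ++ a :: l₂)‖ ≤
      b * ‖wordProd S u - wordProd S (l₁ ++ l₂)‖ +
        l₁.length * (κ * b ^ (l₁.length + l₂.length)) := by
  have hsplit : wordProd S (a :: u) - wordProd S (l₁ ++ a :: l₂) =
      S a * (wordProd S u - wordProd S (l₁ ++ l₂)) +
        (S a * wordProd S l₁ - wordProd S l₁ * S a) * wordProd S l₂ := by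
    rw [wordProd_cons, wordProd_append, wordProd_append, wordProd_cons]
    noncomm_ring
  rw [hsplit, pow_add, ← mul_assoc κ, ← mul_assoc]
  exact norm_add_le_of_le (norm_mul_le_of_le (hb a) le_rfl)
    (norm_mul_le_of_le (norm_commutator_wordProd_le hb hκ a l₁) (norm_wordProd_le hb l₂))

theorem norm_wordProd_sub_perm_le (hb : ∀ p, ‖S p‖ ≤ b) (hb1 : 1 ≤ b) (hκ0 : 0 ≤ κ)
    (hκ : ∀ p q, ‖S p * S q - S q * S p‖ ≤ κ * b) {w w' : List σ} (hw : w.Perm w') :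
    ‖wordProd S w - wordProd S w'‖ ≤ (w.length : ℝ) ^ 2 * (κ * b ^ w.length) := by
  induction w generalizing w' with
  | nil =>
    rw [List.nil_perm.1 hw]
    simp
  | cons a u ih =>
    obtain ⟨l₁, l₂, rfl⟩ := List.append_of_mem (hw.subset List.mem_cons_self)
    have hu : u.Perm (l₁ ++ l₂) := List.Perm.cons_inv (hw.trans List.perm_middle)
    have hlen : l₁.length + l₂.length = u.length := by rw [hu.length_eq, List.length_append]
    have hl : (l₁.length : ℝ) ≤ u.length := by exact_mod_cast (by lia)
    have hB : 0 ≤ κ * b ^ u.length := by positivity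
    calc ‖wordProd S (a :: u) - wordProd S (l₁ ++ a :: l₂)‖
        ≤ b * ‖wordProd S u - wordProd S (l₁ ++ l₂)‖ + l₁.length * (κ * b ^ u.length) :=
          hlen ▸ norm_wordProd_cons_sub_append_cons_le hb hκ a u l₁ l₂
      _ ≤ b * ((u.length : ℝ) ^ 2 * (κ * b ^ u.length)) +
            b * (u.length * (κ * b ^ u.length)) :=
          add_le_add (mul_le_mul_of_nonneg_left (ih hu) (zero_le_one.trans hb1))
            ((mul_le_mul_of_nonneg_right hl hB).trans
              (le_mul_of_one_le_left (by positivity) hb1))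
      _ = ((u.length : ℝ) ^ 2 + u.length) * (κ * b ^ u.length * b) := by ring
      _ ≤ ((u.length : ℝ) + 1) ^ 2 * (κ * b ^ u.length * b) :=
          mul_le_mul_of_nonneg_right (by nlinarith [u.length.cast_nonneg (α := ℝ)])
            (by positivity)
      _ = ((a :: u).length : ℝ) ^ 2 * (κ * b ^ (a :: u).length) := by
          rw [List.length_cons, pow_succ b]
          push_cast
          ring

end Reordering

/-! ### Quantized monomials -/

theorem normalOrder_perm {X : Type*} (w : List (Idx × X)) : (normalOrder w).Perm w := by
  induction w with
  | nil => simp [normalOrder]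
  | cons p w ih =>
    refine List.Perm.trans ?_ (ih.cons p)
    obtain ⟨i, x⟩ := p
    cases i
    · simp [normalOrder]
    · simp [normalOrder]
    · simp [normalOrder, -List.append_assoc]

theorem normalOrder_reverse_map_bar {X : Type*} (w : List (Idx × X)) :
    normalOrder (w.reverse.map (Prod.map Idx.bar id)) =
      (normalOrder w).reverse.map (Prod.map Idx.bar id) := by
  have hfilter : ∀ i : Idx, (w.reverse.map (Prod.map Idx.bar id)).filter (fun p => p.1 = i) =
      ((w.filter fun p => p.1 = i.bar).reverse).map (Prod.map Idx.bar id) := by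
    intro i
    rw [List.filter_map, ← List.filter_reverse]
    congr 2
    funext p
    obtain ⟨j, x⟩ := p
    cases i <;> cases j <;> simp [Idx.bar]
  rw [normalOrder, normalOrder, hfilter, hfilter, hfilter]
  simp only [Idx.bar, List.reverse_append, List.map_append, List.append_assoc]
  rfl

/-- The word of the factors of `M^α` in normal order. -/
noncomputable def orderedWord {X : Type*} (α : MultiIndex X) : List (Idx × X) :=
  normalOrder α.toMultiset.toList

theorem coe_orderedWord {X : Type*} (α : MultiIndex X) :
    (orderedWord α : Multiset (Idx × X)) = α.toMultiset := by
  rw [orderedWord, Multiset.coe_eq_coe.2 (normalOrder_perm _), Multiset.coe_toList]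

theorem star_wordProd {σ 𝒜 : Type*} [Monoid 𝒜] [StarMul 𝒜] (S : σ → 𝒜) (w : List σ) :
    star (wordProd S w) = wordProd (fun p => star (S p)) w.reverse := by
  induction w with
  | nil => simp
  | cons p w ih =>
    rw [wordProd_cons, star_mul, ih, List.reverse_cons, wordProd_append, wordProd_cons,
      wordProd_nil, mul_one]

section QuantMonomial

variable {L : Type*} [DecidableEq L] {Λ : Finset L} {n : ℕ}

theorem quantize_eq_observe (A : Poly Λ) : quantize n A = observe (quantMonomial Λ n) A :=
  (observe_apply _ _).symm

theorem quantMonomial_eq_wordProd_normalOrder {w : List (Idx × Λ)} {α : MultiIndex Λ}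
    (h : (w : Multiset (Idx × Λ)) = α.toMultiset) :
    quantMonomial Λ n α = wordProd (spinOp Λ n) (normalOrder w) := by
  rw [quantMonomial, ← h]
  rfl

theorem quantMonomial_eq_wordProd (α : MultiIndex Λ) :
    quantMonomial Λ n α = wordProd (spinOp Λ n) (orderedWord α) :=
  quantMonomial_eq_wordProd_normalOrder (Multiset.coe_toList _)

theorem norm_quantMonomial_le (α : MultiIndex Λ) :
    ‖quantMonomial Λ n α‖ ≤ (3 / 2 : ℝ) ^ α.degree := by
  rw [quantMonomial_eq_wordProd, ← length_of_coe_eq_toMultiset (coe_orderedWord α)]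
  exact norm_wordProd_le norm_spinOp_le _

theorem norm_quantMonomial_le_exp (α : MultiIndex Λ) :
    ‖quantMonomial Λ n α‖ ≤ 1 * Real.exp α.degree := by
  rw [one_mul, ← Real.exp_one_pow]
  exact (norm_quantMonomial_le α).trans
    (pow_le_pow_left₀ (by norm_num) (by linarith [Real.exp_one_gt_d9]) _)

theorem star_quantMonomial (α : MultiIndex Λ) :
    star (quantMonomial Λ n α) = quantMonomial Λ n (conjIndex α) := by
  set w := α.toMultiset.toList
  have hα : (w : Multiset (Idx × Λ)) = α.toMultiset := Multiset.coe_toList _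
  have hα' : ((w.reverse.map (Prod.map Idx.bar id) : List (Idx × Λ)) : Multiset (Idx × Λ)) =
      (conjIndex α).toMultiset := by
    rw [conjIndex, ← Finsupp.toMultiset_map, ← hα, Multiset.map_coe]
    exact Multiset.coe_eq_coe.2 ((List.reverse_perm w).map _)
  rw [quantMonomial_eq_wordProd_normalOrder hα, quantMonomial_eq_wordProd_normalOrder hα',
    normalOrder_reverse_map_bar, star_wordProd, wordProd, wordProd, List.map_map]
  exact congrArg List.prod (List.map_congr_left fun p _ => star_spinOp p)

end QuantMonomial

/-! ### Commutators of quantized monomials -/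

theorem isBiderivation_smul_commutator {𝒜 : Type*} [Ring 𝒜] [Algebra ℂ 𝒜] (c : ℂ) :
    IsBiderivation fun A B : 𝒜 => c • (A * B - B * A) := by
  constructor <;>
  · intro a b b'
    rw [smul_mul_assoc, mul_smul_comm, ← smul_add]
    congr 1
    noncomm_ring

theorem eval_wordBracket_of_commutator {X 𝒜 : Type*} [DecidableEq X] [Ring 𝒜] [Algebra ℂ 𝒜]
    (S : Idx × X → 𝒜) (c : ℂ)
    (hS : ∀ p q, c • (S p * S q - S q * S p) = (letterBracket p q).eval S)
    (u w : List (Idx × X)) :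
    (wordBracket u w).eval S =
      c • (wordProd S u * wordProd S w - wordProd S w * wordProd S u) :=
  eval_wordBracket (isBiderivation_smul_commutator c) hS u w

theorem Expansion.norm_eval_le {σ 𝒜 : Type*} [NormedRing 𝒜] [NormedAlgebra ℂ 𝒜] {S : σ → 𝒜}
    {f : Expansion σ} {κ : ℝ} (hf : ∀ t ∈ f, ‖wordProd S t.2‖ ≤ κ) :
    ‖f.eval S‖ ≤ f.size * κ := by
  induction f with
  | nil => simp
  | cons t f ih =>
    rw [List.forall_mem_cons] at hf
    rw [eval_cons, size_cons, add_mul]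
    refine norm_add_le_of_le ?_ (ih hf.2)
    rw [norm_smul]
    exact mul_le_mul_of_nonneg_left hf.1 (norm_nonneg _)

/- Bernoulli's inequality for `8 / 7`, whose square times `3 / 2` is still below `2`. -/
theorem natCast_sq_mul_pow_le (N : ℕ) : (N : ℝ) ^ 2 * (3 / 2) ^ N ≤ 49 * 2 ^ N := by
  have hbernoulli : (N : ℝ) ≤ 7 * (8 / 7) ^ N := by
    have := one_add_mul_le_pow (by norm_num : (-2 : ℝ) ≤ 1 / 7) N
    norm_num at this
    linarith
  calc (N : ℝ) ^ 2 * (3 / 2) ^ N ≤ (7 * (8 / 7) ^ N) ^ 2 * (3 / 2) ^ N := by gcongr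
    _ = 49 * ((8 / 7) ^ 2 * (3 / 2)) ^ N := by
        rw [mul_pow, mul_pow ((8 / 7 : ℝ) ^ 2), ← pow_mul, ← pow_mul, mul_comm N 2]
        ring
    _ ≤ 49 * 2 ^ N := by
        gcongr
        norm_num

section Commutator

variable {L : Type*} [DecidableEq L] {Λ : Finset L} {n : ℕ}

theorem quantMonomial_commutator_eq_eval (hn : n ≠ 0) (β α : MultiIndex Λ) :
    (Complex.I * ((n : ℂ) / 2)) • (quantMonomial Λ n β * quantMonomial Λ n α -
      quantMonomial Λ n α * quantMonomial Λ n β) =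
    (wordBracket (orderedWord β) (orderedWord α)).eval (spinOp Λ n) := by
  rw [quantMonomial_eq_wordProd, quantMonomial_eq_wordProd]
  exact (eval_wordBracket_of_commutator (spinOp Λ n) _ (spinOp_commutator hn) _ _).symm

theorem norm_spinOp_commutator_le (hn : n ≠ 0) (p q : Idx × Λ) :
    ‖spinOp Λ n p * spinOp Λ n q - spinOp Λ n q * spinOp Λ n p‖ ≤ 2 / n * (3 / 2) := by
  have hword : ∀ t ∈ letterBracket p q, ‖wordProd (spinOp Λ n) t.2‖ ≤ 3 / 2 := fun t ht => by
    have h := norm_wordProd_le (norm_spinOp_le (n := n)) t.2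
    rwa [length_of_mem_letterBracket ht, pow_one] at h
  have hsize : (letterBracket p q).size ≤ 1 :=
    (size_letterBracket_le p q).trans (by split_ifs <;> norm_num)
  have heval := (Expansion.norm_eval_le hword).trans
    (mul_le_mul_of_nonneg_right hsize (by norm_num))
  rw [← spinOp_commutator hn, norm_smul, norm_mul, Complex.norm_I, one_mul, norm_div,
    Complex.norm_natCast, Complex.norm_two] at heval
  rw [div_mul_eq_mul_div, le_div_iff₀ (by positivity)]
  linarith

theorem norm_wordProd_sub_quantMonomial_le (hn : n ≠ 0) {w : List (Idx × Λ)} {α : MultiIndex Λ}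
    (h : (w : Multiset (Idx × Λ)) = α.toMultiset) :
    ‖wordProd (spinOp Λ n) w - quantMonomial Λ n α‖ ≤
      (w.length : ℝ) ^ 2 * (2 / n * (3 / 2) ^ w.length) := by
  rw [quantMonomial_eq_wordProd_normalOrder h]
  exact norm_wordProd_sub_perm_le norm_spinOp_le (by norm_num) (by positivity)
    (norm_spinOp_commutator_le hn) (normalOrder_perm w).symm

theorem norm_eval_sub_observe_le (hn : n ≠ 0) {f : Expansion (Idx × Λ)} {N : ℕ}
    (hf : ∀ t ∈ f, t.2.length ≤ N) :
    ‖f.eval (spinOp Λ n) - observe (quantMonomial Λ n) (f.eval X)‖ ≤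
      f.size * ((N : ℝ) ^ 2 * (2 / n * (3 / 2) ^ N)) := by
  induction f with
  | nil => simp
  | cons t f ih =>
    rw [List.forall_mem_cons] at hf
    have hw : (t.2 : Multiset (Idx × Λ)) =
        (Multiset.toFinsupp (t.2 : Multiset (Idx × Λ))).toMultiset := by
      rw [Multiset.toFinsupp_toMultiset]
    rw [Expansion.eval_cons, Expansion.eval_cons, Expansion.size_cons, map_add, add_sub_add_comm,
      add_mul, map_smul, wordProd_X hw, observe_monomial, one_smul, ← smul_sub]
    refine norm_add_le_of_le ?_ (ih hf.2)
    rw [norm_smul]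
    refine mul_le_mul_of_nonneg_left ((norm_wordProd_sub_quantMonomial_le hn hw).trans ?_)
      (norm_nonneg _)
    have hlen : t.2.length ≤ N := hf.1
    gcongr
    norm_num

theorem norm_quantMonomial_commutator_sub_le (hn : n ≠ 0) (β α : MultiIndex Λ) :
    ‖(Complex.I * ((n : ℂ) / 2)) • (quantMonomial Λ n β * quantMonomial Λ n α -
        quantMonomial Λ n α * quantMonomial Λ n β) -
      observe (quantMonomial Λ n) (monomialBracket β α)‖ ≤
      98 / n * (overlap β α * 2 ^ (β.degree + α.degree)) := by
  have hβ := coe_orderedWord β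
  have hα := coe_orderedWord α
  have hlen : ∀ t ∈ wordBracket (orderedWord β) (orderedWord α),
      t.2.length ≤ β.degree + α.degree := by
    intro t ht
    have := length_of_mem_wordBracket ht
    rw [length_of_coe_eq_toMultiset hβ, length_of_coe_eq_toMultiset hα] at this
    lia
  rw [quantMonomial_commutator_eq_eval hn, monomialBracket_eq_eval hβ hα]
  set N := β.degree + α.degree
  calc _ ≤ (wordBracket (orderedWord β) (orderedWord α)).size *
          ((N : ℝ) ^ 2 * (2 / n * (3 / 2) ^ N)) := norm_eval_sub_observe_le hn hlen
    _ ≤ (overlap β α : ℝ) * ((N : ℝ) ^ 2 * (2 / n * (3 / 2) ^ N)) :=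
        mul_le_mul_of_nonneg_right (size_wordBracket_le_overlap hβ hα) (by positivity)
    _ = (overlap β α : ℝ) * (2 / n) * ((N : ℝ) ^ 2 * (3 / 2) ^ N) := by ring
    _ ≤ (overlap β α : ℝ) * (2 / n) * (49 * 2 ^ N) :=
        mul_le_mul_of_nonneg_left (natCast_sq_mul_pow_le N) (by positivity)
    _ = 98 / n * (overlap β α * 2 ^ N) := by ring

end Commutator

/-! ### Heisenberg evolution -/

section Sandwich

variable {𝒜 : Type*} [NormedRing 𝒜] [NormedAlgebra ℂ 𝒜]

theorem observe_mul_mul {σ : Type*} (Q : (σ →₀ ℕ) → 𝒜) (u u' : 𝒜) (A : MvPolynomial σ ℂ) :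
    observe (fun γ => u * Q γ * u') A = u * observe Q A * u' := by
  simp only [observe_apply, Finset.mul_sum, Finset.sum_mul, mul_smul_comm, smul_mul_assoc]

theorem hasSum_smul_mul_commutator_mul {ι : Type*} {w : ι → ℂ} {Q : ι → 𝒜} {H : 𝒜}
    (h : HasSum (fun β => w β • Q β) H) (c : ℂ) (a u u' : 𝒜) :
    HasSum (fun β => w β • (u * (c • (Q β * a - a * Q β)) * u'))
      (u * (c • (H * a - a * H)) * u') := by
  have hsum := ((((h.mul_right a).sub (h.mul_left a)).const_smul c).mul_left u).mul_right u'
  refine hsum.congr_fun fun β => ?_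
  simp only [smul_mul_assoc, mul_smul_comm, ← smul_sub]
  rw [smul_comm]

variable [StarRing 𝒜] [ContinuousStar 𝒜] [StarModule ℂ 𝒜]

theorem hasDerivAt_star_mul_mul {c : ℂ} (hc : c ∈ skewAdjoint ℂ) {H : 𝒜} (hH : IsSelfAdjoint H)
    {U₁ U₂ : ℝ → 𝒜} {t : ℝ} (h₁ : HasDerivAt U₁ (c • (H * U₁ t)) t)
    (h₂ : HasDerivAt U₂ (c • (H * U₂ t)) t) (a : 𝒜) :
    HasDerivAt (fun t => star (U₁ t) * a * U₂ t)
      (star (U₁ t) * (-c • (H * a - a * H)) * U₂ t) t := by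
  refine ((h₁.star.mul_const a).mul h₂).congr_deriv ?_
  rw [star_smul, star_mul, hH.star_eq, skewAdjoint.mem_iff.1 hc]
  simp only [neg_smul, neg_mul, mul_neg, mul_smul_comm, smul_mul_assoc, mul_sub, sub_mul,
    smul_sub, mul_assoc]
  abel

theorem star_mul_eq_one_of_hasDerivAt {c : ℂ} (hc : c ∈ skewAdjoint ℂ) {H : ℝ → 𝒜}
    (hH : ∀ t, IsSelfAdjoint (H t)) {U₁ U₂ : ℝ → 𝒜}
    (h₁ : ∀ t, HasDerivAt U₁ (c • (H t * U₁ t)) t) (h₂ : ∀ t, HasDerivAt U₂ (c • (H t * U₂ t)) t)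
    {t₀ : ℝ} (h₁₀ : U₁ t₀ = 1) (h₂₀ : U₂ t₀ = 1) (t : ℝ) : star (U₁ t) * U₂ t = 1 := by
  have hderiv : ∀ t, HasDerivAt (fun t => star (U₁ t) * U₂ t) 0 t := fun t => by
    simpa using hasDerivAt_star_mul_mul hc (hH t) (h₁ t) (h₂ t) 1
  have hconst := is_const_of_deriv_eq_zero (fun r => (hderiv r).differentiableAt)
    (fun r => (hderiv r).deriv) t t₀
  simpa [h₁₀, h₂₀] using hconst

end Sandwich

theorem norm_star_mul_mul_of_mem_unitary {𝒜 : Type*} [NormedRing 𝒜] [StarRing 𝒜] [CStarRing 𝒜]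
    {u : 𝒜} (hu : u ∈ unitary 𝒜) (a : 𝒜) : ‖star u * a * u‖ = ‖a‖ := by
  rw [CStarRing.norm_mul_mem_unitary _ hu,
    CStarRing.norm_mem_unitary_mul _ (Unitary.star_mem hu)]

section Propagator

variable {L : Type*} [DecidableEq L] {Λ : Finset L} {n : ℕ} {V : ℝ → MultiIndex L → ℂ}
  {v : ℕ → ℝ}

theorem hasSum_quantumHamiltonian (hW : IsBoundedPotential (localPotential V Λ) v) (t : ℝ) :
    HasSum (fun β => localPotential V Λ t β • quantMonomial Λ n β) (quantumHamiltonian V Λ n t) :=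
  (hW.summable_smul norm_quantMonomial_le_exp t).hasSum

theorem continuous_quantumHamiltonian (hW : IsBoundedPotential (localPotential V Λ) v) :
    Continuous (quantumHamiltonian V Λ n) :=
  hW.continuous_tsum_smul norm_quantMonomial_le_exp

theorem isSelfAdjoint_quantumHamiltonian
    (hreal : ∀ t α, (starRingEnd ℂ) (V t α) = V t (conjIndex α))
    (hW : IsBoundedPotential (localPotential V Λ) v) (t : ℝ) :
    IsSelfAdjoint (quantumHamiltonian V Λ n t) := by
  have hsum := hasSum_quantumHamiltonian (n := n) hW t
  refine hsum.star.unique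
    (((Function.Involutive.toPerm conjIndex conjIndex_conjIndex).hasSum_iff.2 hsum).congr_fun
      fun β => ?_)
  change _ = V t (extendIndex Λ (conjIndex β)) • quantMonomial Λ n (conjIndex β)
  rw [star_smul, star_quantMonomial, ← conjIndex_extendIndex, ← hreal, starRingEnd_apply]

theorem neg_I_mul_half_mem_skewAdjoint (n : ℕ) : -(Complex.I * ((n : ℂ) / 2)) ∈ skewAdjoint ℂ := by
  simp [skewAdjoint.mem_iff]

instance {ι : Type*} [Finite ι] :
    IsDedekindFiniteMonoid (EuclideanSpace ℂ ι →L[ℂ] EuclideanSpace ℂ ι) := by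
  classical
  have := Fintype.ofFinite ι
  exact (MulEquivClass.isDedekindFiniteMonoid_iff
    (Matrix.toEuclideanCLM (𝕜 := ℂ) (n := ι)).toRingEquiv).1 inferInstance

theorem IsPropagator.star_mul_eq_one (hreal : ∀ t α, (starRingEnd ℂ) (V t α) = V t (conjIndex α))
    (hW : IsBoundedPotential (localPotential V Λ) v) {U U' : ℝ → SpinOp Λ n}
    (hU : IsPropagator V Λ n U) (hU' : IsPropagator V Λ n U') (t : ℝ) : star (U t) * U' t = 1 :=
  star_mul_eq_one_of_hasDerivAt (neg_I_mul_half_mem_skewAdjoint n)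
    (isSelfAdjoint_quantumHamiltonian hreal hW) hU.hasDerivAt hU'.hasDerivAt hU.initial
    hU'.initial t

theorem IsPropagator.mem_unitary (hreal : ∀ t α, (starRingEnd ℂ) (V t α) = V t (conjIndex α))
    (hW : IsBoundedPotential (localPotential V Λ) v) {U : ℝ → SpinOp Λ n}
    (hU : IsPropagator V Λ n U) (t : ℝ) : U t ∈ unitary (SpinOp Λ n) :=
  have h := hU.star_mul_eq_one hreal hW hU t
  Unitary.mem_iff.2 ⟨h, mul_eq_one_symm h⟩

theorem exists_isPropagator (hW : IsBoundedPotential (localPotential V Λ) v) :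
    ∃ U : ℝ → SpinOp Λ n, IsPropagator V Λ n U := by
  have hcont : Continuous fun t =>
      ContinuousLinearMap.mul ℝ (SpinOp Λ n) (quantumHamiltonian V Λ n t) :=
    (ContinuousLinearMap.mul ℝ (SpinOp Λ n)).continuous.comp (continuous_quantumHamiltonian hW)
  obtain ⟨U, hU₀, hU⟩ :=
    exists_linear_solution (hcont.const_smul (-(Complex.I * ((n : ℂ) / 2)))) 0 1
  exact ⟨U, hU₀, hU⟩

theorem existsUnique_isPropagator (hreal : ∀ t α, (starRingEnd ℂ) (V t α) = V t (conjIndex α))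
    (hW : IsBoundedPotential (localPotential V Λ) v) :
    ∃! U : ℝ → SpinOp Λ n, IsPropagator V Λ n U := by
  obtain ⟨U, hU⟩ := exists_isPropagator (n := n) hW
  refine ⟨U, hU, fun U' hU' => funext fun t => ?_⟩
  exact (left_inv_eq_right_inv (mul_eq_one_symm (hU.star_mul_eq_one hreal hW hU t))
    (hU.star_mul_eq_one hreal hW hU' t)).symm

theorem IsPropagator.isApproxFlow (hreal : ∀ t α, (starRingEnd ℂ) (V t α) = V t (conjIndex α))
    (hW : IsBoundedPotential (localPotential V Λ) v) (hn : n ≠ 0) {U : ℝ → SpinOp Λ n}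
    (hU : IsPropagator V Λ n U) :
    IsApproxFlow (localPotential V Λ) (98 / n)
      fun t γ => star (U t) * quantMonomial Λ n γ * U t := by
  have hnorm : ∀ t a, ‖star (U t) * a * U t‖ = ‖a‖ := fun t a =>
    norm_star_mul_mul_of_mem_unitary (hU.mem_unitary hreal hW t) a
  refine ⟨fun t γ => (hnorm t _).trans_le (norm_quantMonomial_le γ),
    fun t β α => star (U t) * ((Complex.I * ((n : ℂ) / 2)) •
      (quantMonomial Λ n β * quantMonomial Λ n α -
        quantMonomial Λ n α * quantMonomial Λ n β)) * U t, fun t α => ?_, fun t β α => ?_⟩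
  · rw [(hasSum_smul_mul_commutator_mul (hasSum_quantumHamiltonian hW t) _ _ _ _).tsum_eq]
    simpa only [neg_neg] using hasDerivAt_star_mul_mul (neg_I_mul_half_mem_skewAdjoint n)
      (isSelfAdjoint_quantumHamiltonian hreal hW t) (hU.hasDerivAt t) (hU.hasDerivAt t)
      (quantMonomial Λ n α)
  · rw [observe_mul_mul, ← sub_mul, ← mul_sub, hnorm]
    exact norm_quantMonomial_commutator_sub_le hn β α

end Propagator

/-! ### The Egorov estimate -/

section Egorov

universe u

variable {L : Type u}

section Extend

variable {Λ₀ Λ : Finset L} (h : Λ₀ ⊆ Λ) (A : Poly Λ₀)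

theorem Poly.extend_eq_sum : A.extend h = ∑ γ ∈ A.support, monomial
    (γ.mapDomain (Prod.map id fun x : Λ₀ => (⟨x.1, h x.2⟩ : Λ))) (A.coeff γ) := by
  conv_lhs => rw [Poly.extend, A.as_sum, map_sum]
  exact Finset.sum_congr rfl fun γ _ => rename_monomial _ _ _

theorem Poly.coeffNorm_extend_le : coeffNorm (A.extend h) ≤ coeffNorm A := by
  rw [A.extend_eq_sum h]
  exact coeffNorm_sum_monomial_le _ _ _

theorem Poly.degree_le_of_mem_support_extend {γ : MultiIndex Λ} (hγ : γ ∈ (A.extend h).support) :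
    γ.degree ≤ A.support.sup Finsupp.degree := by
  obtain ⟨β, rfl, hβ⟩ := coeff_rename_ne_zero _ _ _ (mem_support_iff.1 hγ)
  rw [Finsupp.degree_mapDomain]
  exact Finset.le_sup (f := Finsupp.degree) (mem_support_iff.2 hβ)

end Extend

variable [DecidableEq L] {V : ℝ → MultiIndex L → ℂ} {v : ℕ → ℝ} {Λ : Finset L}

theorem isClassicalSolution_classicalFlow
    (hreal : ∀ t α, (starRingEnd ℂ) (V t α) = V t (conjIndex α))
    (hW : IsBoundedPotential (localPotential V Λ) v) {M₀ : Config Λ} (hM₀ : M₀ ∈ phaseSpace Λ) :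
    IsClassicalSolution V Λ M₀ fun t => classicalFlow V Λ t M₀ := by
  have h := (existsUnique_isClassicalSolution hreal hW hM₀).exists
  simp only [classicalFlow, dif_pos h]
  exact h.choose_spec

theorem isPropagator_propagator {n : ℕ} (hW : IsBoundedPotential (localPotential V Λ) v) :
    IsPropagator V Λ n (propagator V Λ n) := by
  have h := exists_isPropagator (n := n) hW
  rw [propagator, dif_pos h]
  exact h.choose_spec

theorem Transports.norm_classicalEvolution_sub_le {B B' : Poly Λ} {t ε C : ℝ}
    (hB : Transports (localPotential V Λ) t 0 ε C B B')
    (hreal : ∀ t α, (starRingEnd ℂ) (V t α) = V t (conjIndex α))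
    (hW : IsBoundedPotential (localPotential V Λ) v) {M : Config Λ} (hM : M ∈ phaseSpace Λ) :
    ‖classicalEvolution V Λ t B.value M - B'.value M‖ ≤ ε := by
  have hsol := isClassicalSolution_classicalFlow hreal hW hM
  have he : ‖(ULift.up 1 : ULift.{u} ℂ)‖ = 1 := norm_one
  have h := hB (ULift.{u} ℂ) 0 _ le_rfl (hsol.isApproxFlow hW he)
  rw [observe_monomialValue_smul, observe_monomialValue_smul, hsol.initial, ← sub_smul, norm_smul,
    he, mul_one, mul_zero, add_zero] at h
  exact h

theorem Transports.norm_quantumEvolution_sub_le {B B' : Poly Λ} {t ε C : ℝ}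
    (hB : Transports (localPotential V Λ) t 0 ε C B B')
    (hreal : ∀ t α, (starRingEnd ℂ) (V t α) = V t (conjIndex α))
    (hW : IsBoundedPotential (localPotential V Λ) v) {n : ℕ} (hn : n ≠ 0) :
    ‖quantumEvolution V Λ n t (quantize n B) - quantize n B'‖ ≤ ε + C * (98 / n) := by
  have hU := isPropagator_propagator (n := n) hW
  have h := hB (SpinOp Λ n) (98 / n) _ (by positivity) (hU.isApproxFlow hreal hW hn)
  rwa [observe_mul_mul, observe_mul_mul, hU.initial, star_one, one_mul, mul_one,
    ← quantize_eq_observe, ← quantize_eq_observe] at h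

end Egorov

end SpinEgorov

theorem mainTheorem1 {L : Type*} [DecidableEq L]
    (V : ℝ → SpinEgorov.MultiIndex L → ℂ)
    (hreal : ∀ t α, (starRingEnd ℂ) (V t α) = V t (SpinEgorov.conjIndex α))
    (hnorm : SpinEgorov.potentialNorm V < ⊤)
    (hcont : ∀ α, Continuous fun t => V t α) :
    -- the classical and the quantum dynamics are well defined
    (∀ Λ : Finset L, ∀ M₀ ∈ SpinEgorov.phaseSpace Λ,
      ∃! M : ℝ → SpinEgorov.Config Λ, SpinEgorov.IsClassicalSolution V Λ M₀ M) ∧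
    (∀ (Λ : Finset L) (n : ℕ), 1 ≤ n →
      ∃! U : ℝ → SpinEgorov.SpinOp Λ n, SpinEgorov.IsPropagator V Λ n U) ∧
    -- the Egorov estimate
    ∀ (Λ₀ : Finset L) (A : SpinEgorov.Poly Λ₀) (ε : ℝ), 0 < ε →
      ∃ C : ℝ → ℝ, ∀ (Λ : Finset L) (hΛ : Λ₀ ⊆ Λ),
        ∃ At : ℝ → SpinEgorov.Poly Λ,
          (∀ t : ℝ, ∀ M ∈ SpinEgorov.phaseSpace Λ,
            ‖SpinEgorov.classicalEvolution V Λ t (A.extend hΛ).value M - (At t).value M‖ ≤ ε) ∧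
          ∀ (n : ℕ), 1 ≤ n → ∀ t : ℝ,
            ‖SpinEgorov.quantumEvolution V Λ n t (SpinEgorov.quantize n (A.extend hΛ)) -
                SpinEgorov.quantize n (At t)‖ ≤ ε + C t / ((n : ℝ) / 2) := by
  obtain ⟨v, hv⟩ := SpinEgorov.exists_isBoundedPotential hnorm hcont
  refine ⟨fun Λ M₀ hM₀ => SpinEgorov.existsUnique_isClassicalSolution hreal (hv Λ) hM₀,
    fun Λ n _ => SpinEgorov.existsUnique_isPropagator hreal (hv Λ), fun Λ₀ A ε hε => ?_⟩
  choose C hC using fun t : ℝ => SpinEgorov.exists_transport (|t| * ∑' n, v n)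
    (A.support.sup Finsupp.degree) (SpinEgorov.coeffNorm A) hε
  refine ⟨fun t => 49 * C t, fun Λ hΛ => ?_⟩
  choose At hAt using fun t : ℝ => hC t (hv Λ) (t₁ := t) (t₀ := 0) (by rw [zero_sub, abs_neg])
    (fun _ hγ => A.degree_le_of_mem_support_extend hΛ hγ) (A.coeffNorm_extend_le hΛ)
  refine ⟨At, fun t M hM => (hAt t).norm_classicalEvolution_sub_le hreal (hv Λ) hM,
    fun n hn t => ((hAt t).norm_quantumEvolution_sub_le hreal (hv Λ)
      (Nat.one_le_iff_ne_zero.1 hn)).trans_eq ?_⟩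
  field_simp
  ring
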